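/- Let $R$ be a commutative unital ring. All modules are $\mathbb Z$-graded $R$-modules (graded modules concentrated in degrees $\ge 0$ are a special case), elements are homogeneous of specified degree, $|\underline a|=|a|-1$ denotes the shifted degree, all maps below are the shifted ones (obtained by conjugating with the shift $a\mapsto\underline a$), and signs are Koszul signs for shifted degrees. **Algebras and inner products.** An $A_\infty$ algebra $(B,\nu)$ has maps $\underline{\nu_n}:\underline B^{\otimes n}\to\underline B$, $n\ge1$, of shifted degree $1$ with $\sum_{i+\ell+j=n,\ \ell\ge1}\underline{\nu_{i+1+j}}\circ(\mathrm{id}^{\otimes i}\otimes\underline{\nu_\ell}\otimes \mathrm{id}^{\otimes j})=0$ for all $n\ge1$; write $d_B=\nu_1$. An $A_\infty$ inner product $I$ of degree $D\in\mathbb Z$ on $B$ is a morphism of $A_\infty$ modules $B\to B^*$ of degree $D$ over $\mathrm{id}_B$, where $B$ is a module over itself by $\beta_{k,\ell}=\nu_{k+\ell+1}$. That is, it consists of maps $\underline{I_{k,\ell}}:\underline B^{\otimes k}\otimes \underline B\otimes\underline B^{\otimes\ell}\to\underline{B^*}$ of shifted degree $D$, $k,\ell\ge0$, such that for all $r,s\geq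 0$ and all $u_1,\dots,u_r,m,v_1,\dots,v_s,m'\in B$ the sum, with Koszul signs, of the following terms vanishes: all terms obtained from $I(u_1,\dots,u_r,m,v_1,\dots,v_s)(m')$ by applying one $\nu_n$ to $n\ge1$ consecutive entries among $u_1,\dots,u_r,m,v_1,\dots,v_s$, and all terms $I(u_{i+1},\dots,u_r,m,v_1,\dots,v_j)\big(\nu(v_{j+1},\dots,v_s,m',u_1,\dots,u_i)\big)$ with $0\le i\le r$, $0\le j\le s$. If $k=(k_n)_{n\ge1}$ is a family of maps $\underline{k_n}:\underline A^{\otimes n}\to\underline B$ of shifted degree $0$ and $K_{p,q}=k_{p+q+1}$, the pullback $K^\sharp(I)$ is $$K^\sharp(I)(u_1,\dots,u_r,m,v_1,\dots,v_s)(m')=\sum\pm I\big(k(\cdot),\dots,k(\cdot),K(\dots,m,\dots),k(\cdot),\dots,k(\cdot)\big)\big(K(v_{q+1},\dots,v_s,m',u_1,\dots,u_i)\big),$$ where the sum is over all $0\le i\le r$, $0\le q\le s$ and all ways to cut $u_{i+1},\dots,u_r,m,v_1,\dots,v_q$ into consecutive nonempty blocks, to which the maps $k$, and $K$ on the block that contains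 $m$, are applied, and $\pm$ is the Koszul sign of moving $u_1,\dots,u_i$ to the end. **Massey inner products.** Let $s,t\ge0$ and let $a_{1,1},\dots,a_{N,N}$, $N=s+t+2$, be homogeneous elements of a graded module $A$ with operations $\mu_n$. A cyclic triangular system consists of elements $x_{i,j}$ for $1\le i\le j\le s+t+1$ and elements $x'_{i,j}$ for $s+2\le i\le j\le N+s$, such that $x_{i,i}=a_{i,i}$ and $x'_{i,i}=a_{i,i}$ for $i\leq N$, $x'_{N+i,N+i}=a_{i,i}$, $|\underline{x_{i,j}}|=\sum_{l=i}^j|\underline{a_{l,l}}|$ and the same for $x'$ (indices of $a$ are taken modulo $N$), $x'_{i,j}=x_{i,j}$ for $s+2\le i\le j\le s+t+1$, and $x'_{N+i,N+j}=x_{i,j}$ for $1\le i\le j\le s$. It is a cyclic defining system if for all $i\le j$ in the respective ranges $$\underline{\mu_1}(\underline{x_{i,j}})=-\sum_{r\ge2}\ \sum_{i\le j_1<\dots<j_r=j}\underline{\mu_r}(\underline{x_{i,j_1}},\underline{x_{j_1+1,j_2}},\dots,\underline{x_{j_{r-1}+1,j}})$$ and the same holds for $x'$. Its staircase inner product with respect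 to $I$ is $$\sum\ (-1)^{\varepsilon}\,\underline{I_{p,q}}\big(\underline{x_{i_0,i_1}},\underline{x_{i_1+1,i_2}},\dots,\underline{x_{u,v}},\underline{x_{v+1,j_1}},\dots,\underline{x_{j_{q-1}+1,w}}\big)\big(\underline{x'_{w+1,N+i_0-1}}\big),$$ summed over $1\le i_0\le u\le s+1\le v\le w\le s+t+1$ and over all ways to cut $[i_0,u-1]$ into $p\ge 0$ and $[v+1,w]$ into $q\ge 0$ consecutive nonempty intervals, with $\varepsilon=\big(\sum_{l<i_0}|\underline{a_{l,l}}|\big)\big(\sum_{i_0\le l\le N}|\underline{a_{l,l}}|\big)$. The $(s,t)$-th Massey inner product set $\langle a_{1,1},\dots,a_{N,N}\rangle_I\subseteq R$ is the set of the staircase inner products of all cyclic defining systems with diagonal elements $a_{1,1},\dots,a_{N,N}$. **Transfer.** Let $(A,d_A)$ be a complex with $|d_A|=1$, let $(B,\nu)$ be an $A_\infty$ algebra, let $f:B\to A$ and $g:A\to B$ be chain maps of degree $0$, and let $h:B\to B$ be of degree $-1$ with $g\circ f-\mathrm{id}_B=d_B\circ h+h\circ d_B$. For $n\ge2$ put $$\underline{p_n}=\sum_{\ell\ge2,\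 r_1+\dots+r_\ell=n,\ r_i\geq 1}\underline{\nu_\ell}\big((\underline h\circ\underline{p_{r_1}})\otimes\dots\otimes(\underline h\circ\underline{p_{r_\ell}})\big),\qquad h\circ p_1:=\mathrm{id}_B,$$ and let $\mu_1=d_A$, $k_1=g$, and $\mu_n=f\circ p_n\circ g^{\otimes n}$, $k_n=h\circ p_n\circ g^{\otimes n}$ for $n\ge2$. These are the transferred operations on $A$ and the transferred morphism $k:A\to B$. Let $K_{p,q}=k_{p+q+1}$. **Theorem.** For every $A_\infty$ inner product $I$ (of any degree $D$) on $B$, all $s,t\ge0$, and all homogeneous cocycles $a_{1,1},\dots,a_{s+t+2,s+t+2}\in A$, $$\langle a_{1,1},\dots,a_{s+t+2,s+t+2}\rangle_{K^\sharp(I)}=\langle g(a_{1,1}),\dots,g(a_{s+t+2,s+t+2})\rangle_I ,$$ where the left-hand set is formed in $(A,\mu_1,\mu_2,\dots)$, the right-hand set in $(B,\nu)$, and $g(a_{i,i})$ is given the degree of $a_{i,i}$. -/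

import Mathlib

open scoped BigOperators

noncomputable section

namespace MasseyIP

/-!
Conventions.  A graded module is an `R`-module `A` with an internal grading `𝒜 : ℤ → Submodule R A`.
A sequence of maps `φ_n : A^{⊗ n} → V`, `n ≥ 1`, is a function `φ : List A → V` on words that is
linear in every letter; `φ_n` is its restriction to the words of length `n`.  The value on the empty
word is never used.

All operations are the *shifted* ones: `a` is identified with its shift (of degree `|a| - 1`), and
`μ_k`, `f_k`, `I_{k,l}` stand for `s ∘ μ_k ∘ (s⁻¹ ⊗ ⋯ ⊗ s⁻¹)` and so on.  Thus
the sign of an interchange is given by the Koszul rule for the shifted degrees.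
-/

/-- Linearity in every letter. -/
structure IsMultilinear (R : Type*) [CommRing R] {A V : Type*} [AddCommGroup A] [Module R A]
    [AddCommGroup V] [Module R V] (φ : List A → V) : Prop where
  map_add : ∀ (u v : List A) (x y : A), φ (u ++ (x + y) :: v) = φ (u ++ x :: v) + φ (u ++ y :: v)
  map_smul : ∀ (u v : List A) (r : R) (x : A), φ (u ++ (r • x) :: v) = r • φ (u ++ x :: v)

/-- A word of elements tagged with degrees is homogeneous if each letter has its tag as degree. -/
def IsHomogeneousWord {R A : Type*} [CommRing R] [AddCommGroup A] [Module R A]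
    (𝒜 : ℤ → Submodule R A) (w : List (ℤ × A)) : Prop :=
  ∀ y ∈ w, y.2 ∈ 𝒜 y.1

/-- The letters of a tagged word, without their tags. -/
def letters {A : Type*} (w : List (ℤ × A)) : List A := w.map Prod.snd

/-- The total shifted degree `(|a₁| - 1) + ⋯ + (|a_n| - 1)` of a tagged word. -/
def sdeg {A : Type*} (w : List (ℤ × A)) : ℤ := (w.map fun y => y.1 - 1).sum

/-! ### `A_∞` algebras -/

/-- An `A_∞` algebra structure on a graded module, given by its shifted operations
`op [a₁, …, a_k] = μ_k(a₁, …, a_k)`, which have shifted degree `1`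
(so that the unshifted `μ_k` has degree `2 - k`). -/
structure AInfAlgebra {R A : Type*} [CommRing R] [AddCommGroup A] [Module R A]
    (𝒜 : ℤ → Submodule R A) where
  op : List A → A
  multilinear : IsMultilinear R op
  degree : ∀ w : List (ℤ × A), w ≠ [] → IsHomogeneousWord 𝒜 w → op (letters w) ∈ 𝒜 (sdeg w + 1 + 1)
  /-- `∑ ± μ_k(a₁, …, a_i, μ_l(a_{i+1}, …, a_{i+l}), a_{i+l+1}, …, a_n) = 0` -/
  relation : ∀ w : List (ℤ × A), IsHomogeneousWord 𝒜 w →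
    ∑ i ∈ Finset.range w.length, ∑ l ∈ Finset.Icc 1 (w.length - i),
      (sdeg (w.take i)).negOnePow •
        op (letters (w.take i) ++ [op (letters ((w.drop i).take l))] ++ letters (w.drop (i + l))) = 0

/-! ### `A_∞` inner products -/

/-- An `A_∞` inner product of degree `D` on an `A_∞` algebra `B`, i.e. a morphism of `A_∞` modules
`I : B → B^*` of degree `D` over `id_B`, where `B` is a module over itself by
`β_{k,l} = μ_{k+l+1}`, and `B^*` is its dual module.  Here
`toFun [a₁, …, a_k] m [a'₁, …, a'_l] m' = I_{k,l}(a₁, …, a_k, m, a'₁, …, a'_l)(m')`. -/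
structure AInfInnerProduct {R B : Type*} [CommRing R] [AddCommGroup B] [Module R B]
    {ℬ : ℤ → Submodule R B} (ν : AInfAlgebra ℬ) (D : ℤ) where
  toFun : List B → B → List B → B → R
  multilinear_left : ∀ m v m', IsMultilinear R fun u => toFun u m v m'
  linear_mid : ∀ u v m', IsLinearMap R fun m => toFun u m v m'
  multilinear_right : ∀ u m m', IsMultilinear R fun v => toFun u m v m'
  linear_dual : ∀ u m v, IsLinearMap R fun m' => toFun u m v m'
  /-- The functional `I_{k,l}(u, m, v)` has shifted degree `sdeg u + |m| - 1 + sdeg v + D`; so its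
  unshifted degree is one more, and it lives on the elements of the opposite degree. -/
  degree : ∀ (u v : List (ℤ × B)) (m m' : ℤ × B), IsHomogeneousWord ℬ (u ++ m :: v ++ [m']) →
    m'.1 ≠ -(sdeg (u ++ m :: v) + D + 1) → toFun (letters u) m.2 (letters v) m'.2 = 0
  /-- The four sums of the morphism equation: `μ` is applied before `m`, around `m`, after `m`, and
  around `m'`. -/
  relation : ∀ (u v : List (ℤ × B)) (m m' : ℤ × B), IsHomogeneousWord ℬ (u ++ m :: v ++ [m']) →
    (∑ i ∈ Finset.range u.length, ∑ l ∈ Finset.Icc 1 (u.length - i),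
      (sdeg (u.take i)).negOnePow •
        toFun (letters (u.take i) ++ [ν.op (letters ((u.drop i).take l))]
          ++ letters (u.drop (i + l))) m.2 (letters v) m'.2)
    + (∑ i ∈ Finset.range (u.length + 1), ∑ j ∈ Finset.range (v.length + 1),
      (sdeg (u.take i)).negOnePow •
        toFun (letters (u.take i)) (ν.op (letters (u.drop i ++ m :: v.take j)))
          (letters (v.drop j)) m'.2)
    + (∑ i ∈ Finset.range v.length, ∑ l ∈ Finset.Icc 1 (v.length - i),
      (sdeg (u ++ m :: v.take i)).negOnePow •
        toFun (letters u) m.2 (letters (v.take i) ++ [ν.op (letters ((v.drop i).take l))]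
          ++ letters (v.drop (i + l))) m'.2)
    + (∑ i ∈ Finset.range (u.length + 1), ∑ j ∈ Finset.range (v.length + 1),
      (sdeg (u.take i) * sdeg (u.drop i ++ m :: v ++ [m'])
          + sdeg (u.drop i ++ m :: v.take j)).negOnePow •
        toFun (letters (u.drop i)) m.2 (letters (v.take j))
          (ν.op (letters (v.drop j ++ m' :: u.take i)))) = 0

/-! ### Pullback of an inner product -/

/-- The sum of `φ [k l₁, …, k l_i]` over all ways to cut the word `l` into consecutive nonempty
words `l₁, …, l_i`. -/
def cutSum {A B V : Type*} [AddCommMonoid V] (k : List A → B) (φ : List B → V) (l : List A) : V :=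
  ∑ c : Composition l.length, φ ((l.splitWrtComposition c).map k)

/-- The pullback of a pairing family `I` on `B` along `k` and the induced `K_{p,q} = k_{p+q+1}`,
on tagged homogeneous elements:
`∑ ± I(k ⊗ ⋯ ⊗ k ⊗ K ⊗ k ⊗ ⋯ ⊗ k)(…, m, …)(K(…, m', …))`.
The word `u.take i` is moved cyclically to the end, which gives the Koszul sign. -/
def pullbackHom {R A B : Type*} [CommRing R] (k : List A → B)
    (I : List B → B → List B → B → R) (u : List (ℤ × A)) (m : ℤ × A) (v : List (ℤ × A))
    (m' : ℤ × A) : R :=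
  ∑ i ∈ Finset.range (u.length + 1), ∑ j ∈ Finset.Icc i u.length,
    ∑ q ∈ Finset.range (v.length + 1), ∑ r ∈ Finset.range (q + 1),
      (sdeg (u.take i) * sdeg (u.drop i ++ m :: v ++ [m'])).negOnePow •
        cutSum k (fun x =>
          cutSum k (fun y =>
            I x (k (letters (u.drop j ++ m :: v.take r))) y
              (k (letters (v.drop q ++ m' :: u.take i))))
            (letters ((v.take q).drop r)))
          (letters ((u.take j).drop i))

open Classical in
/-- The sum of `φ` over the homogeneous components of an element. -/
def homSum {R A V : Type*} [CommRing R] [AddCommGroup A] [Module R A] (𝒜 : ℤ → Submodule R A)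
    [DirectSum.Decomposition 𝒜] [AddCommMonoid V] (φ : ℤ × A → V) (a : A) : V :=
  ∑ d ∈ (DirectSum.decompose 𝒜 a).support, φ (d, (DirectSum.decompose 𝒜 a d : A))

/-- The sum of `φ` over all words obtained from a word by replacing each letter by one of its
homogeneous components. -/
def homSumList {R A V : Type*} [CommRing R] [AddCommGroup A] [Module R A] (𝒜 : ℤ → Submodule R A)
    [DirectSum.Decomposition 𝒜] [AddCommMonoid V] : (List (ℤ × A) → V) → List A → V
  | φ, [] => φ []
  | φ, a :: l => homSum 𝒜 (fun y => homSumList 𝒜 (fun w => φ (y :: w)) l) a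

/-- The pullback `K^♯(I)`: the multilinear extension of `pullbackHom` from homogeneous elements to
all elements. -/
def pullback {R A B : Type*} [CommRing R] [AddCommGroup A] [Module R A]
    (𝒜 : ℤ → Submodule R A) [DirectSum.Decomposition 𝒜] (k : List A → B)
    (I : List B → B → List B → B → R) : List A → A → List A → A → R :=
  fun u m v m' =>
    homSumList 𝒜 (fun u' => homSum 𝒜 (fun n => homSumList 𝒜 (fun v' => homSum 𝒜 (fun n' =>
      pullbackHom k I u' n v' n') m') v) m) u

/-! ### Massey inner products -/

/-- The word `x_{p,j₁}, x_{j₁+1,j₂}, …` of a staircase that starts at `p` and whose steps have the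
given lengths. -/
def stairWord {A : Type*} (x : ℕ → ℕ → A) : ℕ → List ℕ → List A
  | _, [] => []
  | p, n :: ns => x p (p + n - 1) :: stairWord x (p + n) ns

/-- The staircase product `∑_{r ≥ 2} ∑ μ_r(x_{p,j₁}, x_{j₁+1,j₂}, …, x_{j_{r-1}+1,q})`. -/
def staircase {A : Type*} [AddCommGroup A] (op : List A → A) (x : ℕ → ℕ → A) (p q : ℕ) : A :=
  ∑ c : {c : Composition (q + 1 - p) // 2 ≤ c.length}, op (stairWord x p c.1.blocks)

/-- `x_{i,j}`, `p ≤ i ≤ j ≤ q`, is a triangular system (including the corner `x_{p,q}`) with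
diagonal elements `a_p, …, a_q`, of degrees `d_p, …, d_q`. -/
structure IsTriangularSystem {R A : Type*} [CommRing R] [AddCommGroup A] [Module R A]
    (𝒜 : ℤ → Submodule R A) (d : ℕ → ℤ) (a : ℕ → A) (p q : ℕ) (x : ℕ → ℕ → A) : Prop where
  diag : ∀ i, p ≤ i → i ≤ q → x i i = a i
  degree : ∀ i j, p ≤ i → i ≤ j → j ≤ q → x i j ∈ 𝒜 ((∑ l ∈ Finset.Icc i j, (d l - 1)) + 1)

/-- The cyclic continuation of a finite sequence. -/
def cyc {α : Type*} {n : ℕ} [NeZero n] (a : Fin n → α) (j : ℕ) : α := a (Fin.ofNat n j)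

/-- A cyclic triangular system for the `s + t + 2` elements `a_0, …, a_{s+t+1}`, where `a_s` and
`a_{s+t+1}` are the two module elements: triangular systems `x` for `a_0, …, a_{s+t}` and `x'` for
`a_{s+1}, …, a_{s+t+1}, a_0, …, a_{s-1}` that coincide where they overlap.  In `x'`, the index
`s + t + 2 + i` stands for `i`. -/
structure IsCyclicTriangularSystem {R A : Type*} [CommRing R] [AddCommGroup A] [Module R A]
    (𝒜 : ℤ → Submodule R A) (s t : ℕ) (d : Fin (s + t + 2) → ℤ) (a : Fin (s + t + 2) → A)
    (x x' : ℕ → ℕ → A) : Prop where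
  fst : IsTriangularSystem 𝒜 (cyc d) (cyc a) 0 (s + t) x
  snd : IsTriangularSystem 𝒜 (cyc d) (cyc a) (s + 1) (s + t + 1 + s) x'
  overlap_right : ∀ i j, s + 1 ≤ i → i ≤ j → j ≤ s + t → x' i j = x i j
  overlap_left : ∀ i j, i ≤ j → j < s → x' (s + t + 2 + i) (s + t + 2 + j) = x i j

/-- A cyclic triangular system is a cyclic defining system if `d(x_{i,j})` is minus the staircase
product at `(i,j)` everywhere, including the corners, and likewise for `x'`. -/
structure IsCyclicDefiningSystem {R A : Type*} [CommRing R] [AddCommGroup A] [Module R A]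
    (𝒜 : ℤ → Submodule R A) (op : List A → A) (s t : ℕ) (d : Fin (s + t + 2) → ℤ)
    (a : Fin (s + t + 2) → A) (x x' : ℕ → ℕ → A) : Prop
    extends IsCyclicTriangularSystem 𝒜 s t d a x x' where
  d_fst : ∀ i j, i ≤ j → j ≤ s + t → op [x i j] = -staircase op x i j
  d_snd : ∀ i j, s + 1 ≤ i → i ≤ j → j ≤ s + t + 1 + s → op [x' i j] = -staircase op x' i j

/-- The staircase inner product: the sum over all cyclic staircases, which consist of a staircase
from `i` to `u - 1`, the module element `x_{u,v}` with `u ≤ s ≤ v`, a staircase from `v + 1` to `w`,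
and the module element `x'_{w+1,i-1}` (cyclic indices).  The Koszul sign comes from moving
`a_0, …, a_{i-1}` to the end. -/
def staircaseIP {R A : Type*} [CommRing R] (I : List A → A → List A → A → R) (s t : ℕ)
    (d : Fin (s + t + 2) → ℤ) (x x' : ℕ → ℕ → A) : R :=
  ∑ i ∈ Finset.Icc 0 s, ∑ u ∈ Finset.Icc i s,
    ∑ v ∈ Finset.Icc s (s + t), ∑ w ∈ Finset.Icc v (s + t),
      ∑ c : Composition (u - i), ∑ c' : Composition (w - v),
        ((∑ l ∈ Finset.Ico 0 i, (cyc d l - 1)) *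
            (∑ l ∈ Finset.Ico i (s + t + 2), (cyc d l - 1))).negOnePow •
          I (stairWord x i c.blocks) (x u v) (stairWord x (v + 1) c'.blocks)
            (x' (w + 1) (s + t + 1 + i))

/-- The `(s,t)`-th Massey inner product set `⟨a_0, …, a_{s+t+1}⟩_I` of elements `a_i` of degrees
`d_i`. -/
def masseyInnerProduct {R A : Type*} [CommRing R] [AddCommGroup A] [Module R A]
    (𝒜 : ℤ → Submodule R A) (op : List A → A) (I : List A → A → List A → A → R) (s t : ℕ)
    (d : Fin (s + t + 2) → ℤ) (a : Fin (s + t + 2) → A) : Set R :=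
  {r | ∃ x x' : ℕ → ℕ → A,
    IsCyclicDefiningSystem 𝒜 op s t d a x x' ∧ staircaseIP I s t d x x' = r}

/-! ### Homotopy transfer -/

/-- Transfer data: a complex structure on the graded module `A`, chain maps `f : B → A`,
`g : A → B`, and a homotopy `h` with `g ∘ f - id = d_B ∘ h + h ∘ d_B`. -/
structure TransferData {R A B : Type*} [CommRing R] [AddCommGroup A] [Module R A]
    [AddCommGroup B] [Module R B] (𝒜 : ℤ → Submodule R A) {ℬ : ℤ → Submodule R B}
    (ν : AInfAlgebra ℬ) where
  dA : A →ₗ[R] A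
  f : B →ₗ[R] A
  g : A →ₗ[R] B
  h : B →ₗ[R] B
  dA_degree : ∀ n, ∀ a ∈ 𝒜 n, dA a ∈ 𝒜 (n + 1)
  f_degree : ∀ n, ∀ b ∈ ℬ n, f b ∈ 𝒜 n
  g_degree : ∀ n, ∀ a ∈ 𝒜 n, g a ∈ ℬ n
  h_degree : ∀ n, ∀ b ∈ ℬ n, h b ∈ ℬ (n - 1)
  dA_dA : ∀ a, dA (dA a) = 0
  f_chain : ∀ b, f (ν.op [b]) = dA (f b)
  g_chain : ∀ a, g (dA a) = ν.op [g a]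
  homotopy : ∀ b, g (f b) - b = ν.op [h b] + h (ν.op [b])

/-- When a word is cut into at least two nonempty words, each of them is shorter. -/
theorem length_lt_of_mem_split {α : Type*} (l : List α) (c : Composition l.length)
    (hc : 2 ≤ c.length) (w : List α) (hw : w ∈ l.splitWrtComposition c) : w.length < l.length := by
  have h1 : (l.splitWrtComposition c).map List.length = c.blocks := l.map_length_splitWrtComposition c
  have h2 : w.length ∈ c.blocks := h1 ▸ List.mem_map_of_mem hw
  obtain ⟨s, t, hst⟩ := List.append_of_mem h2
  have h3 : c.blocks.sum = l.length := c.blocks_sum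
  have h4 : ∀ i ∈ c.blocks, 0 < i := fun i hi => c.blocks_pos hi
  have h5 : 2 ≤ c.blocks.length := hc
  rw [hst] at h3 h4 h5
  simp only [List.sum_append, List.sum_cons, List.length_append, List.length_cons] at h3 h5
  rcases s with _ | ⟨y, s⟩
  · rcases t with _ | ⟨y, t⟩
    · simp at h5
    · have := h4 y (by simp)
      simp only [List.sum_nil, List.sum_cons] at h3
      omega
  · have := h4 y (by simp)
    simp only [List.sum_cons] at h3
    omega

/-- The letter `b` for a one-letter word `[b]`, and `y` for any other word. -/
def letterOr {B : Type*} : List B → B → B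
  | [b], _ => b
  | _, y => y

/-- The p-kernel
`p_n = ∑_{l ≥ 2, r₁ + ⋯ + r_l = n} ν_l((h ∘ p_{r₁}) ⊗ ⋯ ⊗ (h ∘ p_{r_l}))`, where `h ∘ p_1` is read
as the identity. -/
def pKernel {B : Type*} [AddCommMonoid B] (op : List B → B) (h : B → B) (l : List B) : B :=
  ∑ c : {c : Composition l.length // 2 ≤ c.length},
    op ((l.splitWrtComposition c.1).attach.map fun w => letterOr w.1 (h (pKernel op h w.1)))
termination_by l.length
decreasing_by exact length_lt_of_mem_split l c.1 c.2 w.1 w.2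

/-- The recursion for the p-kernel in closed form. -/
theorem pKernel_eq {B : Type*} [AddCommMonoid B] (op : List B → B) (h : B → B) (l : List B) :
    pKernel op h l = ∑ c : {c : Composition l.length // 2 ≤ c.length},
      op ((l.splitWrtComposition c.1).map fun w => letterOr w (h (pKernel op h w))) := by
  rw [pKernel]
  refine Finset.sum_congr rfl fun c _ => ?_
  congr 1
  conv_rhs => rw [← List.attach_map_subtype_val (l.splitWrtComposition c.1), List.map_map]
  rfl

namespace TransferData

variable {R A B : Type*} [CommRing R] [AddCommGroup A] [Module R A] [AddCommGroup B] [Module R B]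
  {𝒜 : ℤ → Submodule R A} {ℬ : ℤ → Submodule R B} {ν : AInfAlgebra ℬ}

/-- The transferred operations on `A`: `μ_1 = d_A`, and `μ_n = f ∘ p_n ∘ g^{⊗ n}` for `n > 1`. -/
def op (T : TransferData 𝒜 ν) : List A → A
  | [] => 0
  | [a] => T.dA a
  | l => T.f (pKernel ν.op T.h (l.map T.g))

/-- The transferred morphism `A → B`: `k_1 = g`, and `k_n = h ∘ p_n ∘ g^{⊗ n}` for `n > 1`. -/
def k (T : TransferData 𝒜 ν) : List A → B
  | [] => 0
  | [a] => T.g a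
  | l => T.h (pKernel ν.op T.h (l.map T.g))

end TransferData

end MasseyIP

end

open scoped BigOperators

noncomputable section

namespace MasseyIP

/-! ### Sums over paths -/

/-- The strictly increasing paths from `p` to `q`, as the lists of their vertices after `p`. -/
def paths (p q : ℕ) : Finset (List ℕ) :=
  if p = q then {[]}
  else (Finset.Ioc p q).attach.biUnion fun r => (paths r.1 q).image (List.cons r.1)
termination_by q - p
decreasing_by
  have := Finset.mem_Ioc.1 r.2
  omega

/-- The word of the labels of the edges of a path. -/
def edgeWord {L : Type*} (X : ℕ → ℕ → L) : ℕ → List ℕ → List L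
  | _, [] => []
  | p, r :: c => X p r :: edgeWord X r c

/-- The sum of `φ` over the words of all paths from `p` to `q`. -/
def pathSum {L V : Type*} [AddCommMonoid V] (X : ℕ → ℕ → L) (p q : ℕ) (φ : List L → V) : V :=
  ∑ c ∈ paths p q, φ (edgeWord X p c)

theorem backward_induction {q : ℕ} {C : ℕ → Prop}
    (step : ∀ p, (∀ r, p < r → r ≤ q → C r) → C p) (p : ℕ) : C p := by
  induction h : q - p using Nat.strong_induction_on generalizing p with
  | _ n ih =>
    refine step p fun r h1 h2 => ih (q - r) (by omega) r rfl

section PathSum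

variable {L L' V W : Type*} [AddCommMonoid V] [AddCommMonoid W] (X : ℕ → ℕ → L)

@[simp] theorem pathSum_self (p : ℕ) (φ : List L → V) : pathSum X p p φ = φ [] := by
  rw [pathSum, paths]; simp [edgeWord]

theorem pathSum_of_lt {p q : ℕ} (h : q < p) (φ : List L → V) : pathSum X p q φ = 0 := by
  rw [pathSum, paths]
  have h2 : Finset.Ioc p q = ∅ := Finset.Ioc_eq_empty (by omega)
  rw [if_neg (by omega)]
  refine Finset.sum_eq_zero fun c hc => ?_
  obtain ⟨r, -, -⟩ := Finset.mem_biUnion.1 hc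
  exact absurd r.2 (by simp [h2])

theorem pathSum_rec {p q : ℕ} (h : p ≠ q) (φ : List L → V) :
    pathSum X p q φ = ∑ r ∈ Finset.Ioc p q, pathSum X r q fun w => φ (X p r :: w) := by
  rw [pathSum, paths, if_neg h, Finset.sum_biUnion]
  · rw [← Finset.sum_attach (Finset.Ioc p q)]
    refine Finset.sum_congr rfl fun r _ => ?_
    rw [Finset.sum_image (fun _ _ _ _ h => (List.cons.inj h).2)]
    rfl
  · intro r _ r' _ hne
    rw [Function.onFun, Finset.disjoint_left]
    intro c hc hc'
    obtain ⟨a, -, rfl⟩ := Finset.mem_image.1 hc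
    obtain ⟨b, -, hb⟩ := Finset.mem_image.1 hc'
    exact hne (Subtype.ext (List.cons.inj hb).1.symm)

theorem pathSum_congr {X : ℕ → ℕ → L} {p q : ℕ} {φ ψ : List L → V} (h : ∀ w, φ w = ψ w) :
    pathSum X p q φ = pathSum X p q ψ := by
  rw [funext h]

theorem pathSum_congr_edges {X X' : ℕ → ℕ → L} {p q : ℕ}
    (h : ∀ r r', p ≤ r → r < r' → r' ≤ q → X r r' = X' r r') (φ : List L → V) :
    pathSum X p q φ = pathSum X' p q φ := by
  revert h φ
  induction p using backward_induction (q := q) with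
  | step p ih =>
    intro h φ
    by_cases hpq : p = q
    · subst hpq; simp
    rw [pathSum_rec _ hpq, pathSum_rec _ hpq]
    refine Finset.sum_congr rfl fun r hr => ?_
    obtain ⟨h1, h2⟩ := Finset.mem_Ioc.1 hr
    rw [h p r le_rfl h1 h2]
    exact ih r h1 h2 (fun a b ha hb hc => h a b (by omega) hb hc) _

theorem pathSum_add (p q : ℕ) (φ ψ : List L → V) :
    pathSum X p q (fun w => φ w + ψ w) = pathSum X p q φ + pathSum X p q ψ :=
  Finset.sum_add_distrib

@[simp] theorem pathSum_zero (p q : ℕ) : pathSum X p q (fun _ => (0 : V)) = 0 :=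
  Finset.sum_const_zero

theorem pathSum_sum {ι : Type*} (K : Finset ι) (p q : ℕ) (φ : ι → List L → V) :
    pathSum X p q (fun w => ∑ i ∈ K, φ i w) = ∑ i ∈ K, pathSum X p q (φ i) :=
  Finset.sum_comm

theorem pathSum_comm (Y : ℕ → ℕ → L') (p q p' q' : ℕ) (φ : List L → List L' → V) :
    pathSum X p q (fun u => pathSum Y p' q' (φ u)) =
      pathSum Y p' q' (fun v => pathSum X p q fun u => φ u v) :=
  Finset.sum_comm

theorem map_pathSum {F : Type*} [FunLike F V W] [AddMonoidHomClass F V W] (f : F) (p q : ℕ)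
    (φ : List L → V) : f (pathSum X p q φ) = pathSum X p q (fun w => f (φ w)) :=
  map_sum f _ _

theorem pathSum_smul {M : Type*} [DistribSMul M V] (a : M) (p q : ℕ) (φ : List L → V) :
    pathSum X p q (fun w => a • φ w) = a • pathSum X p q φ :=
  Finset.smul_sum.symm

theorem pathSum_map (f : L → L') (p q : ℕ) (φ : List L' → V) :
    pathSum (fun a b => f (X a b)) p q φ = pathSum X p q (fun w => φ (w.map f)) := by
  have h : ∀ (c : List ℕ) (p : ℕ), edgeWord (fun a b => f (X a b)) p c = (edgeWord X p c).map f := by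
    intro c
    induction c with
    | nil => intro; rfl
    | cons r c ih => intro p; simp [edgeWord, ih]
  simp only [pathSum, h]

theorem pathSum_shift (k p q : ℕ) (φ : List L → V) :
    pathSum X (k + p) (k + q) φ = pathSum (fun a b => X (k + a) (k + b)) p q φ := by
  revert φ
  induction p using backward_induction (q := q) with
  | step p ih =>
    intro φ
    by_cases hpq : p = q
    · subst hpq; simp
    rw [pathSum_rec _ hpq, pathSum_rec _ (by omega),
      ← Finset.map_add_left_Ioc, Finset.sum_map]
    refine Finset.sum_congr rfl fun r hr => ?_
    obtain ⟨h1, h2⟩ := Finset.mem_Ioc.1 hr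
    exact ih r h1 h2 _

/-- Cutting the words of the paths from `p` to `q` into two words. -/
theorem pathSum_split {p q : ℕ} {K : Finset ℕ} (hK : Finset.Icc p q ⊆ K)
    (ψ : List L → List L → V) :
    pathSum X p q (fun w => ∑ i ∈ Finset.range (w.length + 1), ψ (w.take i) (w.drop i)) =
      ∑ r ∈ K, pathSum X p r fun u => pathSum X r q (ψ u) := by
  have h0 : ∀ p, (∑ r ∈ K, pathSum X p r fun u => pathSum X r q (ψ u)) =
      ∑ r ∈ K with p ≤ r ∧ r ≤ q, pathSum X p r fun u => pathSum X r q (ψ u) := by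
    intro p
    rw [Finset.sum_filter]
    refine Finset.sum_congr rfl fun r _ => ?_
    split_ifs with h
    · rfl
    · rcases not_and_or.1 h with h | h
      · rw [pathSum_of_lt _ (by omega)]
      · simp [pathSum_of_lt X (show q < r by omega)]
  have h1 : ∀ p, Finset.Icc p q ⊆ K → (K.filter fun r => p ≤ r ∧ r ≤ q) = Finset.Icc p q := by
    intro p hK
    ext r
    simp only [Finset.mem_filter, Finset.mem_Icc]
    exact ⟨fun h => h.2, fun h => ⟨hK (Finset.mem_Icc.2 h), h⟩⟩
  rw [h0, h1 p hK]
  clear h0 h1 hK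
  revert ψ
  induction p using backward_induction (q := q) with
  | step p ih =>
    intro ψ
    rcases lt_trichotomy p q with hpq | hpq | hpq
    · rw [pathSum_rec _ hpq.ne, ← Finset.insert_Icc_succ_left_eq_Icc hpq.le,
        Finset.sum_insert (by simp), pathSum_self, pathSum_rec _ hpq.ne]
      simp only [List.length_cons]
      have h2 : ∀ r w, (∑ i ∈ Finset.range (w.length + 1 + 1),
          ψ ((X p r :: w).take i) ((X p r :: w).drop i)) = ψ [] (X p r :: w) +
          ∑ i ∈ Finset.range (w.length + 1), ψ (X p r :: w.take i) (w.drop i) := by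
        intro r w
        rw [Finset.sum_range_succ', add_comm]
        simp
      simp only [h2, pathSum_add, Finset.sum_add_distrib]
      congr 1
      have h3 : ∀ r ∈ Finset.Icc (Order.succ p) q, (pathSum X p r fun u => pathSum X r q (ψ u)) =
          ∑ r1 ∈ Finset.Ioc p q, if r1 ≤ r then pathSum X r1 r (fun u => pathSum X r q
            (ψ (X p r1 :: u))) else 0 := by
        intro r hr
        have := Finset.mem_Icc.1 hr
        rw [Order.succ_eq_add_one] at this
        rw [pathSum_rec _ (by omega), ← Finset.sum_filter]
        refine Finset.sum_congr ?_ fun _ _ => rfl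
        ext a; simp only [Finset.mem_filter, Finset.mem_Ioc]; omega
      rw [Finset.sum_congr rfl h3, Finset.sum_comm]
      refine Finset.sum_congr rfl fun r1 hr1 => ?_
      obtain ⟨h5, h6⟩ := Finset.mem_Ioc.1 hr1
      rw [ih r1 h5 h6 fun u => ψ (X p r1 :: u), ← Finset.sum_filter]
      refine Finset.sum_congr ?_ fun _ _ => rfl
      ext a; simp only [Finset.mem_filter, Finset.mem_Icc, Order.succ_eq_add_one]; omega
    · subst hpq; simp
    · rw [pathSum_of_lt _ hpq, Finset.Icc_eq_empty (by omega), Finset.sum_empty]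

/-- Each path from `p` to `q` has a unique edge `(u, v)` with `u ≤ m < v`. -/
theorem pathSum_cross {p q m : ℕ} (hp : p ≤ m) (hq : m < q) {K K' : Finset ℕ}
    (hK : Finset.Icc p m ⊆ K) (hK0 : ∀ u ∈ K, u ≤ m) (hK' : Finset.Ioc m q ⊆ K')
    (hK0' : ∀ v ∈ K', m < v) (φ : List L → V) :
    pathSum X p q φ = ∑ u ∈ K, ∑ v ∈ K',
      pathSum X p u fun x => pathSum X v q fun y => φ (x ++ X u v :: y) := by
  revert φ
  induction p using backward_induction (q := q) with
  | step p ih =>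
    intro φ
    have hpK : p ∈ K := hK (Finset.mem_Icc.2 ⟨le_rfl, hp⟩)
    rw [pathSum_rec _ (by omega)]
    have h1 : Finset.Ioc p q = Finset.Ioc p m ∪ Finset.Ioc m q :=
      (Finset.Ioc_union_Ioc_eq_Ioc hp hq.le).symm
    rw [h1, Finset.sum_union (by
      rw [Finset.disjoint_left]; intro a; simp only [Finset.mem_Ioc]; omega),
      ← Finset.add_sum_erase K _ hpK, add_comm]
    congr 1
    · simp only [pathSum_self, List.nil_append]
      refine Finset.sum_subset hK' fun v hv hv' => ?_
      have := hK0' v hv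
      rw [Finset.mem_Ioc] at hv'
      exact pathSum_of_lt _ (by omega) _
    · have h2 : ∀ u ∈ K.erase p, (∑ v ∈ K',
          pathSum X p u fun x => pathSum X v q fun y => φ (x ++ X u v :: y)) =
          ∑ r ∈ Finset.Ioc p m, ∑ v ∈ K', pathSum X r u fun x => pathSum X v q fun y =>
            φ (X p r :: x ++ X u v :: y) := by
        intro u hu
        obtain ⟨hu1, hu2⟩ := Finset.mem_erase.1 hu
        have := hK0 u hu2
        rw [Finset.sum_comm]
        refine Finset.sum_congr rfl fun v _ => ?_
        rw [pathSum_rec _ (Ne.symm hu1)]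
        refine Finset.sum_subset (fun a => ?_) fun a ha ha' => ?_
        · simp only [Finset.mem_Ioc]; omega
        · simp only [Finset.mem_Ioc] at ha ha'
          exact pathSum_of_lt _ (by omega) _
      rw [Finset.sum_congr rfl h2, Finset.sum_comm]
      refine Finset.sum_congr rfl fun r hr => ?_
      obtain ⟨h5, h6⟩ := Finset.mem_Ioc.1 hr
      rw [ih r h5 (by omega) h6 (fun a ha => hK (by
        simp only [Finset.mem_Icc] at ha ⊢; omega)), ← Finset.add_sum_erase K _ hpK]
      simp only [pathSum_of_lt X h5, Finset.sum_const_zero, zero_add]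
      rfl

end PathSum

/-! ### Compositions, cuts and staircases as paths -/

theorem sum_composition_succ {V : Type*} [AddCommMonoid V] (n : ℕ) (ψ : List ℕ → V) :
    ∑ c : Composition (n + 1), ψ c.blocks =
      ∑ k ∈ Finset.range (n + 1), ∑ c : Composition (n - k), ψ ((k + 1) :: c.blocks) := by
  rw [Finset.sum_sigma']
  symm
  refine Finset.sum_bij (fun x hx => ⟨(x.1 + 1) :: x.2.blocks, ?_, ?_⟩) ?_ ?_ ?_ ?_
  · intro i hi
    rcases List.mem_cons.1 hi with rfl | hi
    · omega
    · exact x.2.blocks_pos hi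
  · have := Finset.mem_range.1 (Finset.mem_sigma.1 hx).1
    rw [List.sum_cons, x.2.blocks_sum]
    omega
  · intros; exact Finset.mem_univ _
  · rintro ⟨k, c⟩ _ ⟨k', c'⟩ _ h
    have h' := congrArg Composition.blocks h
    simp only [List.cons.injEq, Nat.add_right_cancel_iff] at h'
    obtain ⟨rfl, h2⟩ := h'
    rw [Composition.ext h2]
  · intro c _
    rcases h : c.blocks with _ | ⟨k, l⟩
    · have := c.blocks_sum
      rw [h] at this
      simp at this
    · have hs := c.blocks_sum
      have hp : 0 < k := c.blocks_pos (by rw [h]; simp)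
      rw [h, List.sum_cons] at hs
      refine ⟨⟨k - 1, ⟨l, fun hi => c.blocks_pos (by rw [h]; simp [hi]), by omega⟩⟩, ?_, ?_⟩
      · simp only [Finset.mem_sigma, Finset.mem_range, Finset.mem_univ, and_true]; omega
      · apply Composition.ext
        simp only [h, List.cons.injEq, and_true]; omega
  · intros; rfl

theorem sum_composition_zero {V : Type*} [AddCommMonoid V] (ψ : List ℕ → V) :
    ∑ c : Composition 0, ψ c.blocks = ψ [] := by
  rw [Fintype.sum_eq_single (Composition.ones 0) (fun c h => absurd (Composition.ext (by
    rw [(Composition.blocks_eq_nil c).2 rfl, (Composition.blocks_eq_nil _).2 rfl])) h)]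
  simp

theorem sum_stairWord {L V : Type*} [AddCommMonoid V] (x : ℕ → ℕ → L) {p q : ℕ} (hpq : p ≤ q)
    (φ : List L → V) :
    ∑ c : Composition (q - p), φ (stairWord x p c.blocks) =
      pathSum (fun a b => x a (b - 1)) p q φ := by
  revert φ hpq
  induction p using backward_induction (q := q) with
  | step p ih =>
    intro hpq φ
    rcases hpq.eq_or_lt with rfl | hlt
    · rw [Nat.sub_self, sum_composition_zero (fun c => φ (stairWord x p c)), pathSum_self]
      rfl
    · obtain ⟨n, hn⟩ : ∃ n, q - p = n + 1 := ⟨q - p - 1, by omega⟩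
      rw [hn, sum_composition_succ n (fun c => φ (stairWord x p c)), pathSum_rec _ hlt.ne]
      refine Finset.sum_bij (fun k _ => p + (k + 1)) ?_ ?_ ?_ ?_
      · intro k hk
        have := Finset.mem_range.1 hk
        rw [Finset.mem_Ioc]; omega
      · intros; omega
      · intro r hr
        have := Finset.mem_Ioc.1 hr
        exact ⟨r - p - 1, Finset.mem_range.2 (by omega), by omega⟩
      · intro k hk
        have := Finset.mem_range.1 hk
        rw [← ih (p + (k + 1)) (by omega) (by omega) (by omega)]
        have : n - k = q - (p + (k + 1)) := by omega
        rw [this]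
        rfl

section CutSum

variable {A B V : Type*} [AddCommMonoid V] (k : List A → B)

theorem cutSum_nil (φ : List B → V) : cutSum k φ [] = φ [] :=
  (sum_composition_zero (fun c => φ ((List.splitWrtCompositionAux [] c).map k))).trans rfl

theorem cutSum_eq (φ : List B → V) {l : List A} (hl : l ≠ []) :
    cutSum k φ l = ∑ i ∈ Finset.range (l.length + 1),
      if l.take i = [] then 0 else cutSum k (fun y => φ (k (l.take i) :: y)) (l.drop i) := by
  obtain ⟨n, hn⟩ : ∃ n, l.length = n + 1 :=
    ⟨l.length - 1, by have := List.length_pos_iff.2 hl; omega⟩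
  have h1 : cutSum k φ l = ∑ c : Composition l.length,
      φ ((List.splitWrtCompositionAux l c.blocks).map k) := rfl
  rw [h1, hn, sum_composition_succ n (fun c => φ ((List.splitWrtCompositionAux l c).map k)),
    Finset.sum_range_succ' _ (n + 1)]
  simp only [List.take_zero, if_true, add_zero]
  refine Finset.sum_congr rfl fun i _ => ?_
  rw [if_neg (by simp [hl])]
  have h2 : n - i = (l.drop (i + 1)).length := by rw [List.length_drop]; omega
  have h3 : cutSum k (fun y => φ (k (l.take (i + 1)) :: y)) (l.drop (i + 1)) =
      ∑ c : Composition (l.drop (i + 1)).length,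
        φ (k (l.take (i + 1)) :: (List.splitWrtCompositionAux (l.drop (i + 1)) c.blocks).map k) :=
    rfl
  rw [h3, ← h2]
  simp only [List.splitWrtCompositionAux, List.splitAt_eq, List.map_cons]

end CutSum

/-! ### Maps that are additive in every letter -/

/-- Additivity in every letter. -/
structure IsMultiadditive {A V : Type*} [AddCommGroup A] [AddCommGroup V] (φ : List A → V) :
    Prop where
  map_add : ∀ (u v : List A) (x y : A), φ (u ++ (x + y) :: v) = φ (u ++ x :: v) + φ (u ++ y :: v)

section Multiadditive

variable {A V : Type*} [AddCommGroup A] [AddCommGroup V]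

theorem IsMultilinear.isMultiadditive {R : Type*} [CommRing R] [Module R A] [Module R V]
    {φ : List A → V} (h : IsMultilinear R φ) : IsMultiadditive φ := ⟨h.map_add⟩

/-- The map `x ↦ φ (u ++ x :: v)`. -/
def letterHom {φ : List A → V} (h : IsMultiadditive φ) (u v : List A) : A →+ V :=
  AddMonoidHom.mk' (fun x => φ (u ++ x :: v)) (h.map_add u v)

theorem IsMultiadditive.map_zero {φ : List A → V} (h : IsMultiadditive φ) (u v : List A) :
    φ (u ++ 0 :: v) = 0 := _root_.map_zero (letterHom h u v)

theorem IsMultiadditive.of_mem_zero {φ : List A → V} (h : IsMultiadditive φ) {w : List A}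
    (hw : (0 : A) ∈ w) : φ w = 0 := by
  obtain ⟨u, v, rfl⟩ := List.append_of_mem hw
  exact h.map_zero u v

theorem IsMultiadditive.cons {φ : List A → V} (h : IsMultiadditive φ) (a : A) :
    IsMultiadditive fun w => φ (a :: w) :=
  ⟨fun u v x y => h.map_add (a :: u) v x y⟩

theorem IsMultiadditive.map_pathSum_cons {φ : List A → V} (h : IsMultiadditive φ) {L : Type*}
    (X : ℕ → ℕ → L) (p q : ℕ) (f : List L → A) (v : List A) :
    φ (pathSum X p q f :: v) = pathSum X p q fun w => φ (f w :: v) :=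
  map_pathSum X (letterHom h [] v) p q f

theorem IsMultiadditive.map_pathSum_mid {φ : List A → V} (h : IsMultiadditive φ) {L : Type*}
    (X : ℕ → ℕ → L) (p q : ℕ) (f : List L → A) (u v : List A) :
    φ (u ++ pathSum X p q f :: v) = pathSum X p q fun w => φ (u ++ f w :: v) :=
  map_pathSum X (letterHom h u v) p q f

theorem pathSum_eq_zero_of_start {X : ℕ → ℕ → A} {p q : ℕ} (hpq : p < q)
    (hX : ∀ r, p < r → r ≤ q → X p r = 0) {φ : List A → V} (h : IsMultiadditive φ) :
    pathSum X p q φ = 0 := by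
  rw [pathSum_rec _ hpq.ne]
  refine Finset.sum_eq_zero fun r hr => ?_
  obtain ⟨h1, h2⟩ := Finset.mem_Ioc.1 hr
  rw [hX r h1 h2]
  exact Finset.sum_eq_zero fun c _ => h.map_zero [] _

theorem pathSum_eq_zero_of_end {X : ℕ → ℕ → A} {p q : ℕ} (hpq : p < q)
    (hX : ∀ r, p ≤ r → r < q → X r q = 0) {φ : List A → V} (h : IsMultiadditive φ) :
    pathSum X p q φ = 0 := by
  rw [pathSum_cross X (m := q - 1) (K := Finset.Icc p (q - 1)) (K' := Finset.Ioc (q - 1) q)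
    (by omega) (by omega) subset_rfl (fun u hu => (Finset.mem_Icc.1 hu).2) subset_rfl
    (fun v hv => (Finset.mem_Ioc.1 hv).1)]
  refine Finset.sum_eq_zero fun u hu => Finset.sum_eq_zero fun v hv => ?_
  obtain ⟨h1, h2⟩ := Finset.mem_Icc.1 hu
  obtain ⟨h3, h4⟩ := Finset.mem_Ioc.1 hv
  obtain rfl : v = q := by omega
  rw [hX u h1 (by omega)]
  simp only [pathSum_self]
  exact Finset.sum_eq_zero fun c _ => h.map_zero _ _

/-- Cutting the words of the paths for `X` and applying `k` to the pieces. -/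
theorem pathSum_cutSum {L : Type*} (X : ℕ → ℕ → L) (k : List L → A) (p q : ℕ) {φ : List A → V}
    (h : IsMultiadditive φ) :
    pathSum X p q (cutSum k φ) = pathSum (fun a b => pathSum X a b k) p q φ := by
  revert φ
  induction p using backward_induction (q := q) with
  | step p ih =>
    intro φ h
    rcases lt_trichotomy p q with hpq | rfl | hpq
    · have h1 : pathSum X p q (cutSum k φ) = pathSum X p q fun w =>
          ∑ i ∈ Finset.range (w.length + 1), if w.take i = [] then 0 else
            cutSum k (fun y => φ (k (w.take i) :: y)) (w.drop i) := by
        rw [pathSum_rec _ hpq.ne, pathSum_rec _ hpq.ne]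
        refine Finset.sum_congr rfl fun r _ => pathSum_congr fun w => ?_
        exact cutSum_eq k φ (by simp)
      rw [h1, pathSum_split X (K := Finset.Icc p q) subset_rfl
        fun u v => if u = [] then 0 else cutSum k (fun y => φ (k u :: y)) v, pathSum_rec _ hpq.ne,
        ← Finset.insert_Icc_succ_left_eq_Icc hpq.le, Finset.sum_insert (by simp)]
      simp only [pathSum_self, if_true, pathSum_zero, zero_add]
      refine Finset.sum_congr ?_ fun r hr => ?_
      · ext a; simp only [Finset.mem_Ioc, Finset.mem_Icc, Order.succ_eq_add_one]; omega
      · have hr := Finset.mem_Ioc.1 hr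
        have h2 : ∀ v : List A, φ (pathSum X p r k :: v) = pathSum X p r fun u => φ (k u :: v) :=
          h.map_pathSum_cons X p r k
        simp only [h2]
        rw [pathSum_comm (fun a b => pathSum X a b k) X,
          pathSum_rec X (show p ≠ r by omega), pathSum_rec X (show p ≠ r by omega)]
        refine Finset.sum_congr rfl fun r1 _ => pathSum_congr fun u => ?_
        simp only [List.cons_ne_nil, if_false]
        exact ih r (by omega) hr.2 (h.cons _)
    · simp [cutSum_nil]
    · rw [pathSum_of_lt _ hpq, pathSum_of_lt _ hpq]

/-- The expansion of a path sum for a perturbation by `δ` such that each path has at most one edge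
on which `δ` does not vanish. -/
theorem pathSum_add_perturbation {X δ : ℕ → ℕ → A} {p q P Q : ℕ} (hPQ : P < Q)
    (hδ : ∀ r r', p ≤ r → r < r' → r' ≤ q → ¬ (r ≤ P ∧ Q ≤ r') → δ r r' = 0)
    {φ : List A → V} (h : IsMultiadditive φ) :
    pathSum (fun a b => X a b + δ a b) p q φ = pathSum X p q φ +
      ∑ r ∈ Finset.Icc p q, ∑ r' ∈ Finset.Ioc r q,
        pathSum X p r fun u => pathSum X r' q fun v => φ (u ++ δ r r' :: v) := by
  revert hδ φ
  induction p using backward_induction (q := q) with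
  | step p ih =>
    intro hδ φ h
    rcases lt_trichotomy p q with hpq | rfl | hpq
    · rw [pathSum_rec _ hpq.ne]
      have h1 : ∀ r ∈ Finset.Ioc p q, (pathSum (fun a b => X a b + δ a b) r q fun w =>
            φ ((X p r + δ p r) :: w)) = (pathSum X r q fun w => φ (X p r :: w)) +
          (∑ a ∈ Finset.Icc r q, ∑ r' ∈ Finset.Ioc a q,
            pathSum X r a fun u => pathSum X r' q fun v => φ (X p r :: u ++ δ a r' :: v)) +
          pathSum X r q fun w => φ (δ p r :: w) := by
        intro r hr
        obtain ⟨h1, h2⟩ := Finset.mem_Ioc.1 hr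
        have h3 : ∀ w, φ ((X p r + δ p r) :: w) = φ (X p r :: w) + φ (δ p r :: w) :=
          fun w => h.map_add [] w _ _
        simp only [h3]
        rw [pathSum_add, ih r h1 h2 (fun a b ha => hδ a b (by omega)) (h.cons (X p r))]
        congr 1
        by_cases h4 : p ≤ P ∧ Q ≤ r
        · refine pathSum_congr_edges (fun a b ha hb hc => ?_) _
          rw [hδ a b (by omega) hb hc (by omega), add_zero]
        · rw [hδ p r le_rfl h1 h2 h4]
          have : ∀ w, φ (0 :: w) = 0 := fun w => h.map_zero [] w
          simp only [this, pathSum_zero]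
      rw [Finset.sum_congr rfl h1, Finset.sum_add_distrib, Finset.sum_add_distrib,
        ← pathSum_rec _ hpq.ne, add_assoc, add_comm (∑ r ∈ _, _) (∑ r ∈ _, _)]
      congr 1
      rw [← Finset.insert_Icc_succ_left_eq_Icc hpq.le, Finset.sum_insert (by simp)]
      simp only [pathSum_self, List.nil_append]
      congr 1
      have h3 : ∀ r ∈ Finset.Icc (Order.succ p) q, (∑ r' ∈ Finset.Ioc r q,
          pathSum X p r fun u => pathSum X r' q fun v => φ (u ++ δ r r' :: v)) =
          ∑ r1 ∈ Finset.Ioc p q, if r1 ≤ r then ∑ r' ∈ Finset.Ioc r q,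
            pathSum X r1 r (fun u => pathSum X r' q fun v => φ (X p r1 :: u ++ δ r r' :: v))
          else 0 := by
        intro r hr
        have := Finset.mem_Icc.1 hr
        rw [Order.succ_eq_add_one] at this
        rw [← Finset.sum_filter, Finset.sum_comm]
        refine Finset.sum_congr rfl fun r' _ => ?_
        rw [pathSum_rec _ (by omega)]
        refine Finset.sum_congr ?_ fun _ _ => rfl
        ext a; simp only [Finset.mem_filter, Finset.mem_Ioc]; omega
      rw [Finset.sum_congr rfl h3, Finset.sum_comm]
      refine Finset.sum_congr rfl fun r1 hr1 => ?_
      obtain ⟨h5, h6⟩ := Finset.mem_Ioc.1 hr1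
      rw [← Finset.sum_filter]
      refine Finset.sum_congr ?_ fun _ _ => rfl
      ext a; simp only [Finset.mem_filter, Finset.mem_Icc, Order.succ_eq_add_one]; omega
    · simp
    · rw [pathSum_of_lt _ hpq, pathSum_of_lt _ hpq, Finset.Icc_eq_empty (by omega)]
      simp

end Multiadditive

/-! ### Tagged families -/

/-- The family `X` with the degrees that it has if `X p q` has shifted degree `e q - e p`. -/
def tagged {A : Type*} (e : ℕ → ℤ) (X : ℕ → ℕ → A) (p q : ℕ) : ℤ × A := (e q - e p + 1, X p q)

theorem pathSum_tagged {A V : Type*} [AddCommMonoid V] (e : ℕ → ℤ) (X : ℕ → ℕ → A) (p q : ℕ)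
    (φ : List A → V) :
    pathSum (tagged e X) p q (fun w => φ (letters w)) = pathSum X p q φ :=
  (pathSum_map (tagged e X) Prod.snd p q φ).symm

@[simp] theorem sdeg_nil {A : Type*} : sdeg ([] : List (ℤ × A)) = 0 := rfl

@[simp] theorem sdeg_cons {A : Type*} (y : ℤ × A) (w : List (ℤ × A)) :
    sdeg (y :: w) = y.1 - 1 + sdeg w := by simp [sdeg]

@[simp] theorem sdeg_append {A : Type*} (v w : List (ℤ × A)) :
    sdeg (v ++ w) = sdeg v + sdeg w := by simp [sdeg]

@[simp] theorem letters_nil {A : Type*} : letters ([] : List (ℤ × A)) = [] := rfl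

@[simp] theorem letters_cons {A : Type*} (y : ℤ × A) (w : List (ℤ × A)) :
    letters (y :: w) = y.2 :: letters w := rfl

@[simp] theorem letters_append {A : Type*} (v w : List (ℤ × A)) :
    letters (v ++ w) = letters v ++ letters w := by simp [letters]

theorem pathSum_congr_ne_nil {L V : Type*} [AddCommMonoid V] {X : ℕ → ℕ → L} {p q : ℕ}
    (hpq : p ≠ q) {φ ψ : List L → V} (h : ∀ w, w ≠ [] → φ w = ψ w) :
    pathSum X p q φ = pathSum X p q ψ := by
  rw [pathSum_rec _ hpq, pathSum_rec _ hpq]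
  exact Finset.sum_congr rfl fun r _ => pathSum_congr fun w => h _ (by simp)

section Homogeneous

variable {R A : Type*} [CommRing R] [AddCommGroup A] [Module R A] {𝒜 : ℤ → Submodule R A}

theorem pathSum_tagged_congr {V : Type*} [AddCommMonoid V] {e : ℕ → ℤ} {X : ℕ → ℕ → A} {p q : ℕ}
    (hX : ∀ r r', p ≤ r → r < r' → r' ≤ q → X r r' ∈ 𝒜 (e r' - e r + 1))
    {φ ψ : List (ℤ × A) → V}
    (h : ∀ w, IsHomogeneousWord 𝒜 w → sdeg w = e q - e p → φ w = ψ w) :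
    pathSum (tagged e X) p q φ = pathSum (tagged e X) p q ψ := by
  revert hX φ ψ
  induction p using backward_induction (q := q) with
  | step p ih =>
    intro hX φ ψ h
    rcases lt_trichotomy p q with hpq | rfl | hpq
    · rw [pathSum_rec _ hpq.ne, pathSum_rec _ hpq.ne]
      refine Finset.sum_congr rfl fun r hr => ?_
      obtain ⟨h1, h2⟩ := Finset.mem_Ioc.1 hr
      refine ih r h1 h2 (fun a b ha => hX a b (by omega)) fun w hw hw' => h _ ?_ ?_
      · intro y hy
        rcases List.mem_cons.1 hy with rfl | hy
        · exact hX p r le_rfl h1 h2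
        · exact hw y hy
      · rw [sdeg_cons, hw']
        simp only [tagged]
        ring
    · rw [pathSum_self, pathSum_self]
      exact h [] (by simp [IsHomogeneousWord]) (by simp)
    · rw [pathSum_of_lt _ hpq, pathSum_of_lt _ hpq]

theorem pathSum_mem {B : Type*} [AddCommGroup B] [Module R B] {ℬ : ℤ → Submodule R B} {e : ℕ → ℤ}
    {X : ℕ → ℕ → A} {p q : ℕ} (hpq : p ≠ q)
    (hX : ∀ r r', p ≤ r → r < r' → r' ≤ q → X r r' ∈ 𝒜 (e r' - e r + 1)) {φ : List A → B} {D : ℤ}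
    (hφ : ∀ w : List (ℤ × A), w ≠ [] → IsHomogeneousWord 𝒜 w → φ (letters w) ∈ ℬ (sdeg w + D)) :
    pathSum X p q φ ∈ ℬ (e q - e p + D) := by
  classical
  let φ' : List (ℤ × A) → B := fun w => if φ (letters w) ∈ ℬ (e q - e p + D) then φ (letters w)
    else 0
  have h : pathSum X p q φ = pathSum (tagged e X) p q φ' := by
    rw [← pathSum_tagged e]
    have h1 : ∀ f : List (ℤ × A) → B, pathSum (tagged e X) p q f =
        pathSum (tagged e X) p q fun w => if w = [] then 0 else f w := fun f =>
      pathSum_congr_ne_nil hpq fun w hw => (if_neg hw).symm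
    rw [h1, h1 φ']
    refine pathSum_tagged_congr hX fun w hw hw' => ?_
    split_ifs with h
    · rfl
    · exact (if_pos (hw' ▸ hφ w h hw)).symm
  rw [h]
  refine Submodule.sum_mem _ fun c _ => ?_
  simp only [φ']
  split_ifs with h
  · exact h
  · exact Submodule.zero_mem _

end Homogeneous

/-! ### The curvature of a family -/

/-- The signed sum of `φ` over the words of all paths from `p` to `q` with one edge marked, where
the label of the marked edge is given by `δ`. -/
def markedSum {A V : Type*} [AddCommGroup V] (e : ℕ → ℤ) (X δ : ℕ → ℕ → A) (p q : ℕ)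
    (φ : List A → V) : V :=
  ∑ r ∈ Finset.Icc p q, ∑ r' ∈ Finset.Ioc r q, (e r - e p).negOnePow •
    pathSum X p r fun u => pathSum X r' q fun v => φ (u ++ δ r r' :: v)

section Curvature

variable {R A : Type*} [CommRing R] [AddCommGroup A] [Module R A] {𝒜 : ℤ → Submodule R A}
  {V : Type*} [AddCommGroup V]

theorem pathSum_insert {e : ℕ → ℤ} {X : ℕ → ℕ → A} {p q : ℕ}
    (hX : ∀ r r', p ≤ r → r < r' → r' ≤ q → X r r' ∈ 𝒜 (e r' - e r + 1))
    (op : List A → A) {φ : List A → V} (hφ : IsMultiadditive φ) :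
    pathSum (tagged e X) p q (fun w => ∑ i ∈ Finset.range w.length,
      ∑ l ∈ Finset.Icc 1 (w.length - i), (sdeg (w.take i)).negOnePow •
        φ (letters (w.take i) ++ [op (letters ((w.drop i).take l))] ++ letters (w.drop (i + l)))) =
    markedSum e X (fun a b => pathSum X a b op) p q φ := by
  set ψ : List (ℤ × A) → List (ℤ × A) → List (ℤ × A) → V := fun u v t =>
    if v = [] then 0 else (sdeg u).negOnePow • φ (letters u ++ [op (letters v)] ++ letters t)
    with hψ
  have h1 : ∀ w : List (ℤ × A), (∑ i ∈ Finset.range w.length,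
      ∑ l ∈ Finset.Icc 1 (w.length - i), (sdeg (w.take i)).negOnePow •
        φ (letters (w.take i) ++ [op (letters ((w.drop i).take l))] ++
          letters (w.drop (i + l)))) =
      ∑ i ∈ Finset.range (w.length + 1), (fun u y => ∑ l ∈ Finset.range (y.length + 1),
        ψ u (y.take l) (y.drop l)) (w.take i) (w.drop i) := by
    intro w
    rw [Finset.sum_range_succ]
    have h2 : (fun u y => ∑ l ∈ Finset.range (y.length + 1), ψ u (y.take l) (y.drop l))
        (w.take w.length) (w.drop w.length) = 0 := by
      simp [hψ]
    rw [h2, add_zero]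
    refine Finset.sum_congr rfl fun i hi => ?_
    have hi := Finset.mem_range.1 hi
    simp only
    rw [Finset.sum_range_succ', List.length_drop]
    have h3 : ψ (w.take i) ((w.drop i).take 0) ((w.drop i).drop 0) = 0 := by simp [hψ]
    rw [h3, add_zero, Finset.range_eq_Ico, Finset.sum_Ico_add' (fun l => ψ (w.take i)
      ((w.drop i).take l) ((w.drop i).drop l)) 0 (w.length - i) 1]
    refine Finset.sum_congr ?_ fun l hl => ?_
    · ext a; simp only [Finset.mem_Icc, Finset.mem_Ico]; omega
    · have hl := Finset.mem_Ico.1 hl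
      rw [hψ]
      simp only
      rw [if_neg, List.drop_drop]
      intro h
      have := congrArg List.length h
      simp only [List.length_take, List.length_drop, List.length_nil] at this
      omega
  simp only [h1]
  rw [pathSum_split _ (K := Finset.Icc p q) subset_rfl (fun u y =>
    ∑ l ∈ Finset.range (y.length + 1), ψ u (y.take l) (y.drop l))]
  refine Finset.sum_congr rfl fun r hr => ?_
  obtain ⟨hr1, hr2⟩ := Finset.mem_Icc.1 hr
  have h2 : ∀ u, (pathSum (tagged e X) r q fun y => ∑ l ∈ Finset.range (y.length + 1),
      ψ u (y.take l) (y.drop l)) = ∑ r' ∈ Finset.Ioc r q, pathSum (tagged e X) r r' fun v =>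
        pathSum (tagged e X) r' q fun t => ψ u v t := by
    intro u
    rw [pathSum_split _ (K := Finset.Icc r q) subset_rfl (ψ u),
      ← Finset.insert_Icc_succ_left_eq_Icc hr2, Finset.sum_insert (by simp)]
    simp only [pathSum_self, hψ, if_true, pathSum_zero, zero_add]
    refine Finset.sum_congr ?_ fun _ _ => rfl
    ext a; simp only [Finset.mem_Ioc, Finset.mem_Icc, Order.succ_eq_add_one]; omega
  simp only [h2]
  rw [pathSum_sum]
  refine Finset.sum_congr rfl fun r' hr' => ?_
  obtain ⟨hr3, hr4⟩ := Finset.mem_Ioc.1 hr'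
  have h3 : ∀ u t, φ (u ++ pathSum X r r' op :: t) = pathSum X r r' fun v => φ (u ++ op v :: t) :=
    hφ.map_pathSum_mid X r r' op
  simp only [h3]
  rw [← pathSum_smul, ← pathSum_tagged e X p r]
  refine pathSum_tagged_congr (fun a b ha hb hc => hX a b ha hb (by omega)) fun u _ hu => ?_
  rw [pathSum_comm X X, ← pathSum_tagged e X r r', ← pathSum_smul]
  refine pathSum_congr_ne_nil hr3.ne fun v hv => ?_
  rw [← pathSum_tagged e X r' q, ← pathSum_smul]
  refine pathSum_congr fun t => ?_
  rw [← hu, hψ]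
  simp only
  rw [if_neg hv, List.append_assoc, List.singleton_append]

/-- The Bianchi identity for the curvature of a family of homogeneous elements. -/
theorem AInfAlgebra.markedSum_curvature (ν : AInfAlgebra 𝒜) {e : ℕ → ℤ} {X : ℕ → ℕ → A} {p q : ℕ}
    (hX : ∀ r r', p ≤ r → r < r' → r' ≤ q → X r r' ∈ 𝒜 (e r' - e r + 1)) :
    markedSum e X (fun a b => pathSum X a b ν.op) p q ν.op = 0 := by
  rw [← pathSum_insert hX ν.op ν.multilinear.isMultiadditive, ← pathSum_zero (tagged e X) p q]
  exact pathSum_tagged_congr hX fun w hw _ => ν.relation w hw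

end Curvature

theorem pathSum_split_split {L V : Type*} [AddCommMonoid V] (X Y : ℕ → ℕ → L) {p q p' q' : ℕ}
    {K K' : Finset ℕ} (hK : Finset.Icc p q ⊆ K) (hK' : Finset.Icc p' q' ⊆ K')
    (ψ : List L → List L → List L → List L → V) :
    (pathSum X p q fun u => pathSum Y p' q' fun v =>
      ∑ i ∈ Finset.range (u.length + 1), ∑ j ∈ Finset.range (v.length + 1),
        ψ (u.take i) (u.drop i) (v.take j) (v.drop j)) =
      ∑ r ∈ K, ∑ r' ∈ K', pathSum X p r fun u₁ => pathSum X r q fun u₂ =>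
        pathSum Y p' r' fun v₁ => pathSum Y r' q' fun v₂ => ψ u₁ u₂ v₁ v₂ := by
  simp only [pathSum_sum]
  rw [pathSum_split X hK (fun u₁ u₂ => pathSum Y p' q' fun v =>
    ∑ j ∈ Finset.range (v.length + 1), ψ u₁ u₂ (v.take j) (v.drop j))]
  refine Finset.sum_congr rfl fun r _ => ?_
  simp only [← pathSum_sum]
  refine pathSum_congr fun u₁ => pathSum_congr fun u₂ => ?_
  exact pathSum_split Y hK' (ψ u₁ u₂)

/-! ### Cyclic families -/

/-- The arcs `[p, q)` that avoid one of the two module positions `s` and `s + t + 1`. -/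
def Admissible (s t p q : ℕ) : Prop :=
  p < q ∧ (q ≤ s + t + 1 ∨ (s + 1 ≤ p ∧ q ≤ s + t + 2 + s))

/-- A family of homogeneous elements, labelled by the admissible arcs of a circle with `s + t + 2`
positions of total shifted degree `T`. -/
structure IsCyclicFamily {R A : Type*} [CommRing R] [AddCommGroup A] [Module R A]
    (𝒜 : ℤ → Submodule R A) (s t : ℕ) (e : ℕ → ℤ) (T : ℤ) (X : ℕ → ℕ → A) : Prop where
  homogeneous : ∀ p q, Admissible s t p q → X p q ∈ 𝒜 (e q - e p + 1)
  periodic : ∀ i j, i < j → j ≤ s → X (s + t + 2 + i) (s + t + 2 + j) = X i j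
  degree_periodic : ∀ i, i ≤ s → e (s + t + 2 + i) = e i + T

/-- The signed sum over the base points `i, u ≤ s < v, w` of cyclic words. -/
def cyclicSum {V : Type*} [AddCommGroup V] (s t : ℕ) (e : ℕ → ℤ) (T : ℤ)
    (G : ℕ → ℕ → ℕ → ℕ → V) : V :=
  ∑ i ∈ Finset.Icc 0 s, ∑ u ∈ Finset.Icc 0 s,
    ∑ v ∈ Finset.Icc (s + 1) (s + t + 1), ∑ w ∈ Finset.Icc (s + 1) (s + t + 1),
      ((e i - e 0) * (e 0 + T - e i)).negOnePow • G i u v w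

/-- The sum of `I` over the cyclic words with the given base points. -/
def pairingTerm {A V : Type*} [AddCommGroup V] (I : List A → A → List A → A → V) (s t : ℕ)
    (X : ℕ → ℕ → A) (i u v w : ℕ) : V :=
  pathSum X i u fun x => pathSum X v w fun y => I x (X u v) y (X w (s + t + 2 + i))

/-- The signed sum of `I` over the cyclic words with one edge marked. -/
def markedTerm {A V : Type*} [AddCommGroup V] (I : List A → A → List A → A → V) (s t : ℕ)
    (e : ℕ → ℤ) (X δ : ℕ → ℕ → A) (i u v w : ℕ) : V :=
  (pathSum X v w fun y => markedSum e X δ i u fun x => I x (X u v) y (X w (s + t + 2 + i)))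
  + (e u - e i).negOnePow •
    (pathSum X i u fun x => pathSum X v w fun y => I x (δ u v) y (X w (s + t + 2 + i)))
  + (e v - e i).negOnePow •
    (pathSum X i u fun x => markedSum e X δ v w fun y => I x (X u v) y (X w (s + t + 2 + i)))
  + (e w - e i).negOnePow •
    (pathSum X i u fun x => pathSum X v w fun y => I x (X u v) y (δ w (s + t + 2 + i)))

theorem sum_comm_last {α β γ δ V : Type*} [AddCommMonoid V] (a : Finset α) (b : Finset β)
    (c : Finset γ) (d : Finset δ) (f : α → β → γ → δ → V) :
    ∑ i ∈ a, ∑ j ∈ b, ∑ k ∈ c, ∑ l ∈ d, f i j k l =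
      ∑ l ∈ d, ∑ i ∈ a, ∑ j ∈ b, ∑ k ∈ c, f i j k l := by
  rw [Finset.sum_comm (s := d)]
  refine Finset.sum_congr rfl fun i _ => ?_
  rw [Finset.sum_comm (s := d)]
  refine Finset.sum_congr rfl fun j _ => ?_
  rw [Finset.sum_comm (s := d)]

theorem cyclicSum_eq {V : Type*} [AddCommGroup V] (s t : ℕ) (e : ℕ → ℤ) (T : ℤ)
    (G : ℕ → ℕ → ℕ → ℕ → V) :
    cyclicSum s t e T G = ∑ i ∈ Finset.Icc 0 s, ((e i - e 0) * (e 0 + T - e i)).negOnePow •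
      ∑ u ∈ Finset.Icc 0 s, ∑ v ∈ Finset.Icc (s + 1) (s + t + 1),
        ∑ w ∈ Finset.Icc (s + 1) (s + t + 1), G i u v w := by
  simp only [cyclicSum, Finset.smul_sum]

theorem cyclicSum_add {V : Type*} [AddCommGroup V] (s t : ℕ) (e : ℕ → ℤ) (T : ℤ)
    (G G' : ℕ → ℕ → ℕ → ℕ → V) :
    cyclicSum s t e T (fun i u v w => G i u v w + G' i u v w) =
      cyclicSum s t e T G + cyclicSum s t e T G' := by
  simp only [cyclicSum, smul_add, Finset.sum_add_distrib]

theorem cyclicSum_congr {V : Type*} [AddCommGroup V] {s t : ℕ} {e : ℕ → ℤ} {T : ℤ}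
    {G G' : ℕ → ℕ → ℕ → ℕ → V}
    (h : ∀ i u v w, i ≤ s → u ≤ s → s + 1 ≤ v → v ≤ s + t + 1 → s + 1 ≤ w → w ≤ s + t + 1 →
      G i u v w = G' i u v w) :
    cyclicSum s t e T G = cyclicSum s t e T G' := by
  refine Finset.sum_congr rfl fun i hi => Finset.sum_congr rfl fun u hu =>
    Finset.sum_congr rfl fun v hv => Finset.sum_congr rfl fun w hw => ?_
  simp only [Finset.mem_Icc] at hi hu hv hw
  rw [h i u v w hi.2 hu.2 hv.1 hv.2 hw.1 hw.2]

section Relation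

variable {R B : Type*} [CommRing R] [AddCommGroup B] [Module R B] {ℬ : ℤ → Submodule R B}
  {ν : AInfAlgebra ℬ} {D : ℤ}

namespace AInfInnerProduct

variable (I : AInfInnerProduct ν D)

theorem multiadditive_left (m : B) (y : List B) (m' : B) :
    IsMultiadditive fun x => I.toFun x m y m' := (I.multilinear_left m y m').isMultiadditive

theorem multiadditive_right (x : List B) (m m' : B) :
    IsMultiadditive fun y => I.toFun x m y m' := (I.multilinear_right x m m').isMultiadditive

theorem map_pathSum_mid {L : Type*} (X : ℕ → ℕ → L) (p q : ℕ) (f : List L → B) (x y : List B)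
    (m' : B) : I.toFun x (pathSum X p q f) y m' = pathSum X p q fun w => I.toFun x (f w) y m' :=
  map_pathSum X (IsLinearMap.mk' _ (I.linear_mid x y m')) p q f

theorem map_pathSum_dual {L : Type*} (X : ℕ → ℕ → L) (p q : ℕ) (f : List L → B) (x y : List B)
    (m : B) : I.toFun x m y (pathSum X p q f) = pathSum X p q fun w => I.toFun x m y (f w) :=
  map_pathSum X (IsLinearMap.mk' _ (I.linear_dual x m y)) p q f

theorem map_sum_mid {ι : Type*} (K : Finset ι) (f : ι → B) (x y : List B)
    (m' : B) : I.toFun x (∑ i ∈ K, f i) y m' = ∑ i ∈ K, I.toFun x (f i) y m' :=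
  map_sum (IsLinearMap.mk' _ (I.linear_mid x y m')) f K

theorem map_sum_dual {ι : Type*} (K : Finset ι) (f : ι → B) (x y : List B)
    (m : B) : I.toFun x m y (∑ i ∈ K, f i) = ∑ i ∈ K, I.toFun x m y (f i) :=
  map_sum (IsLinearMap.mk' _ (I.linear_dual x m y)) f K

end AInfInnerProduct

/-- Each arc around `s` is a path before `s`, an edge across `s` and a path after `s`. -/
theorem pathSum_cross_fst {L V : Type*} [AddCommMonoid V] (X : ℕ → ℕ → L) {s t r r' : ℕ}
    (hr : r ≤ s) (hr' : s + 1 ≤ r') (hr'' : r' ≤ s + t + 1) (φ : List L → V) :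
    pathSum X r r' φ = ∑ u ∈ Finset.Icc 0 s, ∑ v ∈ Finset.Icc (s + 1) (s + t + 1),
      pathSum X r u fun x => pathSum X v r' fun y => φ (x ++ X u v :: y) := by
  refine pathSum_cross X hr hr' (fun a => ?_) (fun a => ?_) (fun a => ?_) (fun a => ?_) φ <;>
    simp only [Finset.mem_Icc, Finset.mem_Ioc] <;> omega

/-- Each arc around `s + t + 1` is a path before `s + t + 1`, an edge across it and a path
after it. -/
theorem pathSum_cross_snd {L V : Type*} [AddCommMonoid V] (X : ℕ → ℕ → L) {s t r r' : ℕ}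
    (hX : ∀ i j, i < j → j ≤ s → X (s + t + 2 + i) (s + t + 2 + j) = X i j)
    (hr : r ≤ s) (hr' : s + 1 ≤ r') (hr'' : r' ≤ s + t + 1) (φ : List L → V) :
    pathSum X r' (s + t + 2 + r) φ = ∑ w ∈ Finset.Icc (s + 1) (s + t + 1), ∑ i ∈ Finset.Icc 0 s,
      pathSum X r' w fun x => pathSum X i r fun y => φ (x ++ X w (s + t + 2 + i) :: y) := by
  rw [pathSum_cross X (K := Finset.Icc (s + 1) (s + t + 1))
    (K' := (Finset.Icc 0 s).map (addLeftEmbedding (s + t + 2))) (m := s + t + 1) hr'' (by omega)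
    (fun a => by simp only [Finset.mem_Icc]; omega) (fun a ha => (Finset.mem_Icc.1 ha).2)
    (fun a ha => Finset.mem_map.2 ⟨a - (s + t + 2), by
      simp only [Finset.mem_Icc, Finset.mem_Ioc] at ha ⊢; omega, by
      simp only [Finset.mem_Ioc] at ha
      simp only [addLeftEmbedding_apply]; omega⟩)
    (fun a ha => by
      obtain ⟨b, -, rfl⟩ := Finset.mem_map.1 ha
      simp only [addLeftEmbedding_apply]; omega)]
  refine Finset.sum_congr rfl fun w _ => ?_
  rw [Finset.sum_map]
  refine Finset.sum_congr rfl fun i _ => pathSum_congr fun x => ?_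
  rw [addLeftEmbedding_apply, pathSum_shift]
  exact pathSum_congr_edges (fun a b _ hb hc => hX a b hb (by omega)) _

variable {s t : ℕ} {e : ℕ → ℤ} {T : ℤ} {X : ℕ → ℕ → B}

theorem IsCyclicFamily.sum_relation_mid (hX : IsCyclicFamily ℬ s t e T X)
    (I : AInfInnerProduct ν D) :
    cyclicSum s t e T (fun i u v w => pathSum (tagged e X) i u fun x =>
      pathSum (tagged e X) v w fun y =>
        ∑ j ∈ Finset.range (x.length + 1), ∑ k ∈ Finset.range (y.length + 1),
          (sdeg (x.take j)).negOnePow • I.toFun (letters (x.take j))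
            (ν.op (letters (x.drop j ++ tagged e X u v :: y.take k)))
            (letters (y.drop k)) (X w (s + t + 2 + i))) =
    cyclicSum s t e T fun i u v w => (e u - e i).negOnePow •
      (pathSum X i u fun x => pathSum X v w fun y =>
        I.toFun x (pathSum X u v ν.op) y (X w (s + t + 2 + i))) := by
  rw [cyclicSum_eq, cyclicSum_eq]
  refine Finset.sum_congr rfl fun i hi => ?_
  have hi := Finset.mem_Icc.1 hi
  congr 1
  have h1 : ∀ u ∈ Finset.Icc 0 s, ∀ v ∈ Finset.Icc (s + 1) (s + t + 1),
      ∀ w ∈ Finset.Icc (s + 1) (s + t + 1),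
      (pathSum (tagged e X) i u fun x =>
      pathSum (tagged e X) v w fun y =>
        ∑ j ∈ Finset.range (x.length + 1), ∑ k ∈ Finset.range (y.length + 1),
          (sdeg (x.take j)).negOnePow • I.toFun (letters (x.take j))
            (ν.op (letters (x.drop j ++ tagged e X u v :: y.take k)))
            (letters (y.drop k)) (X w (s + t + 2 + i))) =
      ∑ r ∈ Finset.Icc 0 s, ∑ r' ∈ Finset.Icc (s + 1) (s + t + 1), (e r - e i).negOnePow •
        (pathSum X i r fun x₁ => pathSum X r' w fun y₂ => pathSum X r u fun x₂ =>
          pathSum X v r' fun y₁ =>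
            I.toFun x₁ (ν.op (x₂ ++ X u v :: y₁)) y₂ (X w (s + t + 2 + i))) := by
    intro u hu v hv w hw
    rw [Finset.mem_Icc] at hu hv hw
    rw [pathSum_split_split _ _ (K := Finset.Icc 0 s) (K' := Finset.Icc (s + 1) (s + t + 1))
      (fun a => by simp only [Finset.mem_Icc]; omega)
      (fun a => by simp only [Finset.mem_Icc]; omega)
      (fun x₁ x₂ y₁ y₂ => (sdeg x₁).negOnePow • I.toFun (letters x₁)
        (ν.op (letters (x₂ ++ tagged e X u v :: y₁))) (letters y₂) (X w (s + t + 2 + i)))]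
    refine Finset.sum_congr rfl fun r hr => Finset.sum_congr rfl fun r' hr' => ?_
    rw [Finset.mem_Icc] at hr hr'
    rw [← pathSum_smul, ← pathSum_tagged e X i r]
    refine pathSum_tagged_congr (fun a b ha hb hc => hX.homogeneous a b (by
      unfold Admissible; omega)) fun x₁ _ hx₁ => ?_
    rw [pathSum_comm X X, ← pathSum_tagged e X r u, ← pathSum_smul]
    refine pathSum_congr fun x₂ => ?_
    rw [pathSum_comm X X, ← pathSum_tagged e X v r', ← pathSum_smul]
    refine pathSum_congr fun y₁ => ?_
    rw [← pathSum_tagged e X r' w, ← pathSum_smul]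
    refine pathSum_congr fun y₂ => ?_
    rw [hx₁]
    simp [tagged]
  rw [Finset.sum_congr rfl fun u hu => Finset.sum_congr rfl fun v hv =>
    Finset.sum_congr rfl fun w hw => h1 u hu v hv w hw]
  have h2 : ∀ r ∈ Finset.Icc 0 s, ∀ r' ∈ Finset.Icc (s + 1) (s + t + 1),
      ∀ w ∈ Finset.Icc (s + 1) (s + t + 1), (e r - e i).negOnePow •
      (pathSum X i r fun x => pathSum X r' w fun y =>
        I.toFun x (pathSum X r r' ν.op) y (X w (s + t + 2 + i))) =
      ∑ u ∈ Finset.Icc 0 s, ∑ v ∈ Finset.Icc (s + 1) (s + t + 1), (e r - e i).negOnePow •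
        (pathSum X i r fun x₁ => pathSum X r' w fun y₂ => pathSum X r u fun x₂ =>
          pathSum X v r' fun y₁ =>
            I.toFun x₁ (ν.op (x₂ ++ X u v :: y₁)) y₂ (X w (s + t + 2 + i))) := by
    intro r hr r' hr' w hw
    rw [Finset.mem_Icc] at hr hr' hw
    rw [pathSum_cross_fst X (t := t) hr.2 hr'.1 hr'.2 ν.op]
    simp only [I.map_sum_mid, I.map_pathSum_mid, pathSum_sum, Finset.smul_sum]
  rw [Finset.sum_congr rfl fun r hr => Finset.sum_congr rfl fun r' hr' =>
    Finset.sum_congr rfl fun w hw => h2 r hr r' hr' w hw]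
  rw [sum_comm_last]
  refine Finset.sum_congr rfl fun r _ => ?_
  rw [sum_comm_last]
  refine Finset.sum_congr rfl fun r' _ => ?_
  rw [Finset.sum_congr rfl fun u _ => Finset.sum_comm, Finset.sum_comm]

theorem IsCyclicFamily.sum_relation_dual (hX : IsCyclicFamily ℬ s t e T X)
    (I : AInfInnerProduct ν D) :
    cyclicSum s t e T (fun i u v w => pathSum (tagged e X) i u fun x =>
      pathSum (tagged e X) v w fun y =>
        ∑ j ∈ Finset.range (x.length + 1), ∑ k ∈ Finset.range (y.length + 1),
          (sdeg (x.take j) * sdeg (x.drop j ++ tagged e X u v :: y ++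
              [tagged e X w (s + t + 2 + i)]) +
            sdeg (x.drop j ++ tagged e X u v :: y.take k)).negOnePow •
          I.toFun (letters (x.drop j)) (X u v) (letters (y.take k))
            (ν.op (letters (y.drop k ++ tagged e X w (s + t + 2 + i) :: x.take j)))) =
    cyclicSum s t e T fun i u v w => (e w - e i).negOnePow •
      (pathSum X i u fun x => pathSum X v w fun y =>
        I.toFun x (X u v) y (pathSum X w (s + t + 2 + i) ν.op)) := by
  unfold cyclicSum
  have h1 : ∀ i ∈ Finset.Icc 0 s, ∀ u ∈ Finset.Icc 0 s, ∀ v ∈ Finset.Icc (s + 1) (s + t + 1),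
      ∀ w ∈ Finset.Icc (s + 1) (s + t + 1), ((e i - e 0) * (e 0 + T - e i)).negOnePow •
      (pathSum (tagged e X) i u fun x =>
      pathSum (tagged e X) v w fun y =>
        ∑ j ∈ Finset.range (x.length + 1), ∑ k ∈ Finset.range (y.length + 1),
          (sdeg (x.take j) * sdeg (x.drop j ++ tagged e X u v :: y ++
              [tagged e X w (s + t + 2 + i)]) +
            sdeg (x.drop j ++ tagged e X u v :: y.take k)).negOnePow •
          I.toFun (letters (x.drop j)) (X u v) (letters (y.take k))
            (ν.op (letters (y.drop k ++ tagged e X w (s + t + 2 + i) :: x.take j)))) =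
      ∑ r ∈ Finset.Icc 0 s, ∑ r' ∈ Finset.Icc (s + 1) (s + t + 1),
        ((e r - e 0) * (e 0 + T - e r)).negOnePow • (e r' - e r).negOnePow •
        (pathSum X r u fun x₂ => pathSum X v r' fun y₁ => pathSum X r' w fun y₂ =>
          pathSum X i r fun x₁ =>
            I.toFun x₂ (X u v) y₁ (ν.op (y₂ ++ X w (s + t + 2 + i) :: x₁))) := by
    intro i hi u hu v hv w hw
    rw [Finset.mem_Icc] at hi hu hv hw
    set ψ : List (ℤ × B) → List (ℤ × B) → List (ℤ × B) → List (ℤ × B) → R :=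
      fun x₁ x₂ y₁ y₂ => (sdeg x₁ * sdeg (x₂ ++ tagged e X u v :: (y₁ ++ y₂) ++
          [tagged e X w (s + t + 2 + i)]) + sdeg (x₂ ++ tagged e X u v :: y₁)).negOnePow •
        I.toFun (letters x₂) (X u v) (letters y₁)
          (ν.op (letters (y₂ ++ tagged e X w (s + t + 2 + i) :: x₁))) with hψ
    have h3 : ∀ x y : List (ℤ × B),
        (∑ j ∈ Finset.range (x.length + 1), ∑ k ∈ Finset.range (y.length + 1),
          (sdeg (x.take j) * sdeg (x.drop j ++ tagged e X u v :: y ++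
              [tagged e X w (s + t + 2 + i)]) +
            sdeg (x.drop j ++ tagged e X u v :: y.take k)).negOnePow •
          I.toFun (letters (x.drop j)) (X u v) (letters (y.take k))
            (ν.op (letters (y.drop k ++ tagged e X w (s + t + 2 + i) :: x.take j)))) =
        ∑ j ∈ Finset.range (x.length + 1), ∑ k ∈ Finset.range (y.length + 1),
          ψ (x.take j) (x.drop j) (y.take k) (y.drop k) := by
      intro x y
      refine Finset.sum_congr rfl fun j _ => Finset.sum_congr rfl fun k _ => ?_
      simp only [hψ, List.take_append_drop]
    simp only [h3]
    rw [pathSum_split_split _ _ (K := Finset.Icc 0 s) (K' := Finset.Icc (s + 1) (s + t + 1))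
      (fun a => by simp only [Finset.mem_Icc]; omega)
      (fun a => by simp only [Finset.mem_Icc]; omega), Finset.smul_sum]
    refine Finset.sum_congr rfl fun r hr => ?_
    rw [Finset.smul_sum]
    refine Finset.sum_congr rfl fun r' hr' => ?_
    rw [Finset.mem_Icc] at hr hr'
    have hh : ∀ a c, c ≤ s + t + 1 → ∀ a' b', a ≤ a' → a' < b' → b' ≤ c →
        X a' b' ∈ ℬ (e b' - e a' + 1) := fun a c h a' b' _ h2 h3 =>
      hX.homogeneous a' b' (by unfold Admissible; omega)
    have h4 : (pathSum X r u fun x₂ => pathSum X v r' fun y₁ => pathSum X r' w fun y₂ =>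
          pathSum X i r fun x₁ =>
            I.toFun x₂ (X u v) y₁ (ν.op (y₂ ++ X w (s + t + 2 + i) :: x₁))) =
        pathSum X i r fun x₁ => pathSum X r u fun x₂ => pathSum X v r' fun y₁ =>
          pathSum X r' w fun y₂ =>
            I.toFun x₂ (X u v) y₁ (ν.op (y₂ ++ X w (s + t + 2 + i) :: x₁)) := by
      rw [pathSum_comm X X i r]
      refine pathSum_congr fun x₂ => ?_
      rw [pathSum_comm X X i r]
      refine pathSum_congr fun y₁ => ?_
      rw [pathSum_comm X X i r]
    rw [h4, ← pathSum_smul, ← pathSum_smul, ← pathSum_smul, ← pathSum_tagged e X i r]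
    refine pathSum_tagged_congr (hh i r (by omega)) fun x₁ _ hx₁ => ?_
    rw [← pathSum_smul, ← pathSum_smul, ← pathSum_smul, ← pathSum_tagged e X r u]
    refine pathSum_tagged_congr (hh r u (by omega)) fun x₂ _ hx₂ => ?_
    rw [← pathSum_smul, ← pathSum_smul, ← pathSum_smul, ← pathSum_tagged e X v r']
    refine pathSum_tagged_congr (hh v r' (by omega)) fun y₁ _ hy₁ => ?_
    rw [← pathSum_smul, ← pathSum_smul, ← pathSum_smul, ← pathSum_tagged e X r' w]
    refine pathSum_tagged_congr (hh r' w (by omega)) fun y₂ _ hy₂ => ?_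
    simp only [hψ, smul_smul, ← Int.negOnePow_add]
    congr 1
    · rw [Int.negOnePow_eq_iff]
      simp only [sdeg_append, sdeg_cons, sdeg_nil, hx₁, hx₂, hy₁, hy₂, tagged,
        hX.degree_periodic i hi.2]
      refine ⟨(e r - e i) * (e i - e 0), ?_⟩
      ring
    · simp [tagged]
  have h2 : ∀ r ∈ Finset.Icc 0 s, ∀ u ∈ Finset.Icc 0 s, ∀ v ∈ Finset.Icc (s + 1) (s + t + 1),
      ∀ r' ∈ Finset.Icc (s + 1) (s + t + 1),
      ((e r - e 0) * (e 0 + T - e r)).negOnePow • (e r' - e r).negOnePow •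
      (pathSum X r u fun x => pathSum X v r' fun y =>
        I.toFun x (X u v) y (pathSum X r' (s + t + 2 + r) ν.op)) =
      ∑ w ∈ Finset.Icc (s + 1) (s + t + 1), ∑ i ∈ Finset.Icc 0 s,
        ((e r - e 0) * (e 0 + T - e r)).negOnePow • (e r' - e r).negOnePow •
        (pathSum X r u fun x₂ => pathSum X v r' fun y₁ => pathSum X r' w fun y₂ =>
          pathSum X i r fun x₁ =>
            I.toFun x₂ (X u v) y₁ (ν.op (y₂ ++ X w (s + t + 2 + i) :: x₁))) := by
    intro r hr u hu v hv r' hr'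
    rw [Finset.mem_Icc] at hr hr' hu hv
    rw [pathSum_cross_snd X hX.periodic hr.2 hr'.1 hr'.2 ν.op]
    simp only [I.map_sum_dual, I.map_pathSum_dual, pathSum_sum, Finset.smul_sum]
  rw [Finset.sum_congr rfl fun i hi => Finset.sum_congr rfl fun u hu => Finset.sum_congr rfl
    fun v hv => Finset.sum_congr rfl fun w hw => h1 i hi u hu v hv w hw,
    Finset.sum_congr rfl fun i hi => Finset.sum_congr rfl fun u hu => Finset.sum_congr rfl
    fun v hv => Finset.sum_congr rfl fun w hw => h2 i hi u hu v hv w hw]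
  rw [Finset.sum_congr rfl fun i _ => sum_comm_last _ _ _ _ _, Finset.sum_comm]
  refine Finset.sum_congr rfl fun r _ => ?_
  rw [Finset.sum_comm]
  refine Finset.sum_congr rfl fun u _ => ?_
  rw [Finset.sum_comm]
  refine Finset.sum_congr rfl fun v _ => ?_
  rw [Finset.sum_congr rfl fun i _ => Finset.sum_comm, Finset.sum_comm]
  refine Finset.sum_congr rfl fun r' _ => ?_
  rw [Finset.sum_comm]

/-- The relation of an inner product, summed over all cyclic words of a family. -/
theorem IsCyclicFamily.cyclicSum_curvature (hX : IsCyclicFamily ℬ s t e T X)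
    (I : AInfInnerProduct ν D) :
    cyclicSum s t e T (markedTerm I.toFun s t e X fun a b => pathSum X a b ν.op) = 0 := by
  have hh : ∀ a c, c ≤ s + t + 1 → ∀ a' b', a ≤ a' → a' < b' → b' ≤ c →
      X a' b' ∈ ℬ (e b' - e a' + 1) := fun a c h a' b' _ h2 h3 =>
    hX.homogeneous a' b' (by unfold Admissible; omega)
  unfold markedTerm
  rw [cyclicSum_add, cyclicSum_add, cyclicSum_add, ← hX.sum_relation_mid I,
    ← hX.sum_relation_dual I, ← cyclicSum_add, ← cyclicSum_add, ← cyclicSum_add]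
  unfold cyclicSum
  refine Finset.sum_eq_zero fun i hi => Finset.sum_eq_zero fun u hu => Finset.sum_eq_zero
    fun v hv => Finset.sum_eq_zero fun w hw => ?_
  rw [Finset.mem_Icc] at hi hu hv hw
  have h1 : (pathSum X v w fun y => markedSum e X (fun a b => pathSum X a b ν.op) i u fun x =>
      I.toFun x (X u v) y (X w (s + t + 2 + i))) =
      pathSum (tagged e X) i u fun x => pathSum (tagged e X) v w fun y =>
        ∑ j ∈ Finset.range x.length, ∑ l ∈ Finset.Icc 1 (x.length - j),
          (sdeg (x.take j)).negOnePow • I.toFun (letters (x.take j) ++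
            [ν.op (letters ((x.drop j).take l))] ++ letters (x.drop (j + l))) (X u v) (letters y)
            (X w (s + t + 2 + i)) := by
    rw [pathSum_comm, ← pathSum_tagged e X v w]
    refine pathSum_congr fun y => ?_
    exact (pathSum_insert (hh i u (by omega)) ν.op (I.multiadditive_left _ _ _)).symm
  have h2 : ((e v - e i).negOnePow • pathSum X i u fun x =>
      markedSum e X (fun a b => pathSum X a b ν.op) v w fun y =>
        I.toFun x (X u v) y (X w (s + t + 2 + i))) =
      pathSum (tagged e X) i u fun x => pathSum (tagged e X) v w fun y =>
        ∑ j ∈ Finset.range y.length, ∑ l ∈ Finset.Icc 1 (y.length - j),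
          (sdeg (x ++ tagged e X u v :: y.take j)).negOnePow • I.toFun (letters x) (X u v)
            (letters (y.take j) ++ [ν.op (letters ((y.drop j).take l))] ++ letters (y.drop (j + l)))
            (X w (s + t + 2 + i)) := by
    rw [← pathSum_smul, ← pathSum_tagged e X i u]
    refine pathSum_tagged_congr (hh i u (by omega)) fun x _ hx => ?_
    rw [← pathSum_insert (hh v w (by omega)) ν.op (I.multiadditive_right _ _ _), ← pathSum_smul]
    refine pathSum_congr fun y => ?_
    simp only [Finset.smul_sum, smul_smul, ← Int.negOnePow_add]
    refine Finset.sum_congr rfl fun j _ => Finset.sum_congr rfl fun l _ => ?_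
    congr 2
    simp only [sdeg_append, sdeg_cons, hx, tagged]
    ring
  beta_reduce
  rw [h1, h2, ← pathSum_add, ← pathSum_add, ← pathSum_add]
  simp only [← pathSum_add]
  refine (congrArg _ ?_).trans (smul_zero _)
  rw [← pathSum_zero (tagged e X) i u]
  refine pathSum_tagged_congr (hh i u (by omega)) fun x hx _ => ?_
  rw [← pathSum_zero (tagged e X) v w]
  refine pathSum_tagged_congr (hh v w (by omega)) fun y hy _ => ?_
  refine I.relation x y (tagged e X u v) (tagged e X w (s + t + 2 + i)) ?_
  intro z hz
  simp only [List.mem_append, List.mem_cons, List.not_mem_nil, or_false] at hz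
  rcases hz with (hz | rfl | hz) | rfl
  · exact hx z hz
  · exact hX.homogeneous u v (by unfold Admissible; omega)
  · exact hy z hz
  · exact hX.homogeneous w _ (by unfold Admissible; omega)

end Relation

/-! ### Elementary gauge transformations -/

/-- The arc `[p, q)` does not meet the arc `[p₀, q₀)` on a circle with `N` positions. -/
def ArcDisjoint (N p₀ q₀ p q : ℕ) : Prop :=
  (q ≤ p₀ ∨ q₀ ≤ p) ∧ (q ≤ N + p₀ ∨ N + q₀ ≤ p) ∧ (N + q ≤ p₀ ∨ q₀ ≤ N + p)

instance (N p₀ q₀ p q : ℕ) : Decidable (ArcDisjoint N p₀ q₀ p q) := by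
  unfold ArcDisjoint; infer_instance

/-- The arc `[p, q)` contains the arc `[p₀, q₀)` on a circle with `N` positions. -/
def ArcContains (N p₀ q₀ p q : ℕ) : Prop :=
  (p ≤ p₀ ∧ q₀ ≤ q) ∨ (p ≤ N + p₀ ∧ N + q₀ ≤ q)

/-- The family that is `X` on the arcs disjoint from `[p₀, q₀)`, and `z` on `[p₀, q₀)`, and that
vanishes on all other arcs. -/
def excise {A : Type*} [Zero A] (N p₀ q₀ : ℕ) (z : A) (X : ℕ → ℕ → A) (p q : ℕ) : A :=
  if ArcDisjoint N p₀ q₀ p q then X p q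
  else if (p = p₀ ∧ q = q₀) ∨ (p = N + p₀ ∧ q = N + q₀) then z else 0

/-- The degrees of the family `excise N p₀ q₀ z X`. -/
def exciseDeg (N q₀ : ℕ) (e : ℕ → ℤ) (q : ℕ) : ℤ :=
  e q - (if q₀ ≤ q then 1 else 0) - (if N + q₀ ≤ q then 1 else 0) - (if q₀ ≤ N + q then 1 else 0)

/-- The change of `X` under the gauge transformation by an element `z` at `[p₀, q₀)`. -/
def gaugeChange {A : Type*} [AddCommGroup A] (op : List A → A) (N p₀ q₀ : ℕ) (z : A) (e : ℕ → ℤ)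
    (X : ℕ → ℕ → A) (p q : ℕ) : A :=
  if p ≤ p₀ ∧ q₀ ≤ q then (e p₀ - e p).negOnePow • pathSum (excise N p₀ q₀ z X) p q op
  else if p ≤ N + p₀ ∧ N + q₀ ≤ q then
    (e (N + p₀) - e p).negOnePow • pathSum (excise N p₀ q₀ z X) p q op
  else 0

theorem markedSum_of_lt {A V : Type*} [AddCommGroup V] (e : ℕ → ℤ) (X δ : ℕ → ℕ → A) {p q : ℕ}
    (h : q < p) (φ : List A → V) : markedSum e X δ p q φ = 0 := by
  rw [markedSum, Finset.Icc_eq_empty (by omega), Finset.sum_empty]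

theorem markedSum_eq_zero {A V : Type*} [AddCommGroup A] [AddCommGroup V] (e : ℕ → ℤ)
    {X δ : ℕ → ℕ → A} {p q : ℕ} (h : ∀ r r', p ≤ r → r < r' → r' ≤ q → δ r r' = 0)
    {φ : List A → V} (hφ : IsMultiadditive φ) : markedSum e X δ p q φ = 0 := by
  refine Finset.sum_eq_zero fun r hr => Finset.sum_eq_zero fun r' hr' => ?_
  obtain ⟨h1, h2⟩ := Finset.mem_Icc.1 hr
  obtain ⟨h3, h4⟩ := Finset.mem_Ioc.1 hr'
  rw [h r r' h1 h3 h4]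
  simp only [hφ.map_zero, pathSum_zero, smul_zero]

theorem IsMultiadditive.map_units_smul {A V : Type*} [AddCommGroup A] [AddCommGroup V]
    {φ : List A → V} (h : IsMultiadditive φ) (n : ℤˣ) (u v : List A) (x : A) :
    φ (u ++ (n • x) :: v) = n • φ (u ++ x :: v) := by
  rw [Units.smul_def, Units.smul_def]
  exact map_zsmul (letterHom h u v) (n : ℤ) x

section Gauge

variable {R B : Type*} [CommRing R] [AddCommGroup B] [Module R B] {ℬ : ℤ → Submodule R B}
  {s t : ℕ} {e : ℕ → ℤ} {T : ℤ} {X : ℕ → ℕ → B} {p₀ q₀ : ℕ} {z : B}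

theorem units_smul_mem {n : ℤ} {x : B} (hx : x ∈ ℬ n) (a : ℤˣ) : a • x ∈ ℬ n := by
  rw [Units.smul_def]
  exact zsmul_mem hx _

theorem Admissible.sub {p q r r' : ℕ} (h : Admissible s t p q) (h1 : p ≤ r) (h2 : r < r')
    (h3 : r' ≤ q) : Admissible s t r r' := by
  unfold Admissible at *; omega

theorem exciseDeg_of_disjoint {p q : ℕ} (h : ArcDisjoint (s + t + 2) p₀ q₀ p q) (hpq : p < q)
    (h0 : p₀ < q₀) :
    exciseDeg (s + t + 2) q₀ e q - exciseDeg (s + t + 2) q₀ e p = e q - e p := by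
  unfold ArcDisjoint at h
  unfold exciseDeg
  split_ifs <;> omega

theorem exciseDeg_of_contains {p q : ℕ} (h : ArcContains (s + t + 2) p₀ q₀ p q)
    (h0 : Admissible s t p₀ q₀) (hp₀ : p₀ ≤ s + t + 1) (hpq : Admissible s t p q) :
    exciseDeg (s + t + 2) q₀ e q - exciseDeg (s + t + 2) q₀ e p = e q - e p - 1 := by
  unfold ArcContains at h
  unfold Admissible at h0 hpq
  unfold exciseDeg
  split_ifs <;> omega

theorem IsCyclicFamily.excise (hX : IsCyclicFamily ℬ s t e T X) (h0 : Admissible s t p₀ q₀)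
    (hp₀ : p₀ ≤ s + t + 1) (hz : z ∈ ℬ (e q₀ - e p₀)) :
    IsCyclicFamily ℬ s t (exciseDeg (s + t + 2) q₀ e) (T - 1)
      (MasseyIP.excise (s + t + 2) p₀ q₀ z X) where
  homogeneous p q hpq := by
    unfold MasseyIP.excise
    split_ifs with h1 h2
    · rw [exciseDeg_of_disjoint h1 hpq.1 h0.1]
      exact hX.homogeneous p q hpq
    · rw [exciseDeg_of_contains (by unfold ArcContains; omega) h0 hp₀ hpq, sub_add_cancel]
      rcases h2 with ⟨rfl, rfl⟩ | ⟨rfl, rfl⟩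
      · exact hz
      · unfold Admissible at h0 hpq
        rw [hX.degree_periodic _ (by omega), hX.degree_periodic _ (by omega)]
        simpa using hz
    · exact Submodule.zero_mem _
  periodic i j hij hj := by
    unfold Admissible at h0
    have h1 : ArcDisjoint (s + t + 2) p₀ q₀ (s + t + 2 + i) (s + t + 2 + j) ↔
        ArcDisjoint (s + t + 2) p₀ q₀ i j := by
      unfold ArcDisjoint; omega
    have h2 : (s + t + 2 + i = p₀ ∧ s + t + 2 + j = q₀) ∨
        (s + t + 2 + i = s + t + 2 + p₀ ∧ s + t + 2 + j = s + t + 2 + q₀) ↔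
        (i = p₀ ∧ j = q₀) ∨ (i = s + t + 2 + p₀ ∧ j = s + t + 2 + q₀) := by omega
    unfold MasseyIP.excise
    simp only [h1, h2, hX.periodic i j hij hj]
  degree_periodic i hi := by
    unfold Admissible at h0
    unfold exciseDeg
    rw [hX.degree_periodic i hi]
    split_ifs <;> omega

theorem excise_of_disjoint {p q : ℕ} (h : ArcDisjoint (s + t + 2) p₀ q₀ p q) :
    excise (s + t + 2) p₀ q₀ z X p q = X p q := if_pos h

theorem pathSum_excise_of_disjoint {V : Type*} [AddCommMonoid V] {p q : ℕ}
    (h : p < q → ArcDisjoint (s + t + 2) p₀ q₀ p q) (φ : List B → V) :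
    pathSum (excise (s + t + 2) p₀ q₀ z X) p q φ = pathSum X p q φ :=
  pathSum_congr_edges (fun r r' h1 h2 h3 => excise_of_disjoint (by
    have h := h (by omega)
    unfold ArcDisjoint at *; omega)) φ

theorem pathSum_excise_eq_zero {V : Type*} [AddCommGroup V] {p q : ℕ} (h0 : Admissible s t p₀ q₀)
    (hp₀ : p₀ ≤ s + t + 1) (hpq : Admissible s t p q) (h : ¬ ArcDisjoint (s + t + 2) p₀ q₀ p q)
    (h' : ¬ ArcContains (s + t + 2) p₀ q₀ p q) {φ : List B → V} (hφ : IsMultiadditive φ) :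
    pathSum (excise (s + t + 2) p₀ q₀ z X) p q φ = 0 := by
  unfold ArcDisjoint at h
  unfold ArcContains at h'
  unfold Admissible at h0 hpq
  have h1 : ((p₀ < p ∧ p < q₀) ∨ (s + t + 2 + p₀ < p ∧ p < s + t + 2 + q₀) ∨
      (p₀ < s + t + 2 + p ∧ s + t + 2 + p < q₀)) ∨ ((p₀ < q ∧ q < q₀) ∨
      (s + t + 2 + p₀ < q ∧ q < s + t + 2 + q₀) ∨
      (p₀ < s + t + 2 + q ∧ s + t + 2 + q < q₀)) := by omega
  rcases h1 with h1 | h1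
  · refine pathSum_eq_zero_of_start hpq.1 (fun r hr hr' => ?_) hφ
    unfold excise
    rw [if_neg (by unfold ArcDisjoint; omega), if_neg (by omega)]
  · refine pathSum_eq_zero_of_end hpq.1 (fun r hr hr' => ?_) hφ
    unfold excise
    rw [if_neg (by unfold ArcDisjoint; omega), if_neg (by omega)]

theorem gaugeChange_eq_zero {op : List B → B} {p q : ℕ}
    (h : ¬ ArcContains (s + t + 2) p₀ q₀ p q) :
    gaugeChange op (s + t + 2) p₀ q₀ z e X p q = 0 := by
  unfold ArcContains at h
  unfold gaugeChange
  rw [if_neg (by omega), if_neg (by omega)]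

theorem gaugeChange_eq {op : List B → B} {p q k : ℕ} (hk : k = 0 ∨ k = s + t + 2)
    (h0 : p₀ < q₀) (hpq : Admissible s t p q) (h : p ≤ k + p₀ ∧ k + q₀ ≤ q) :
    gaugeChange op (s + t + 2) p₀ q₀ z e X p q =
      (e (k + p₀) - e p).negOnePow • pathSum (excise (s + t + 2) p₀ q₀ z X) p q op := by
  unfold Admissible at hpq
  unfold gaugeChange
  rcases hk with rfl | rfl
  · rw [if_pos (by omega), Nat.zero_add]
  · rw [if_neg (by omega), if_pos h]

variable (ν : AInfAlgebra ℬ)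

theorem curvature_excise_eq_zero (hc : ∀ p q, Admissible s t p q → pathSum X p q ν.op = 0)
    (h0 : Admissible s t p₀ q₀) (hp₀ : p₀ ≤ s + t + 1) {p q : ℕ} (hpq : Admissible s t p q)
    (h : ¬ ArcContains (s + t + 2) p₀ q₀ p q) :
    pathSum (excise (s + t + 2) p₀ q₀ z X) p q ν.op = 0 := by
  by_cases hd : ArcDisjoint (s + t + 2) p₀ q₀ p q
  · rw [pathSum_excise_of_disjoint (fun _ => hd), hc p q hpq]
  · exact pathSum_excise_eq_zero h0 hp₀ hpq hd h ν.multilinear.isMultiadditive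

/-- The gauge transform of `X` by an element `z` at `[p₀, q₀)`. -/
def gauge (s t p₀ q₀ : ℕ) (z : B) (e : ℕ → ℤ) (X : ℕ → ℕ → B) (p q : ℕ) : B :=
  X p q + gaugeChange ν.op (s + t + 2) p₀ q₀ z e X p q

theorem gauge_eq {p q : ℕ} (h : ¬ ArcContains (s + t + 2) p₀ q₀ p q) :
    gauge ν s t p₀ q₀ z e X p q = X p q := by
  rw [gauge, gaugeChange_eq_zero h, add_zero]

theorem pathSum_gauge_eq {V : Type*} [AddCommMonoid V] {p q : ℕ}
    (h : ¬ ArcContains (s + t + 2) p₀ q₀ p q) (φ : List B → V) :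
    pathSum (gauge ν s t p₀ q₀ z e X) p q φ = pathSum X p q φ :=
  pathSum_congr_edges (fun r r' h1 h2 h3 => gauge_eq ν (by
    unfold ArcContains at *; omega)) φ

theorem pathSum_gauge {V : Type*} [AddCommGroup V]
    (hc : ∀ p q, Admissible s t p q → pathSum X p q ν.op = 0)
    (h0 : Admissible s t p₀ q₀) (hp₀ : p₀ ≤ s + t + 1) {p q k : ℕ} (hk : k = 0 ∨ k = s + t + 2)
    (hpq : Admissible s t p q) (h : p ≤ k + p₀ ∧ k + q₀ ≤ q) {φ : List B → V}
    (hφ : IsMultiadditive φ) :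
    pathSum (gauge ν s t p₀ q₀ z e X) p q φ = pathSum X p q φ + (e (k + p₀) - e p).negOnePow •
      markedSum (exciseDeg (s + t + 2) q₀ e) (excise (s + t + 2) p₀ q₀ z X)
        (fun a b => pathSum (excise (s + t + 2) p₀ q₀ z X) a b ν.op) p q φ := by
  have hcont : ∀ r r', p ≤ r → r < r' → r' ≤ q → ¬ (r ≤ k + p₀ ∧ k + q₀ ≤ r') →
      ¬ ArcContains (s + t + 2) p₀ q₀ r r' := by
    intro r r' h1 h2 h3 h4
    unfold Admissible at h0 hpq
    unfold ArcContains
    omega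
  unfold gauge
  rw [pathSum_add_perturbation (P := k + p₀) (Q := k + q₀) (by have := h0.1; omega)
    (fun r r' h1 h2 h3 h4 => gaugeChange_eq_zero (hcont r r' h1 h2 h3 h4)) hφ, markedSum]
  congr 1
  simp only [Finset.smul_sum]
  refine Finset.sum_congr rfl fun r hr => Finset.sum_congr rfl fun r' hr' => ?_
  obtain ⟨h1, h2⟩ := Finset.mem_Icc.1 hr
  obtain ⟨h3, h4⟩ := Finset.mem_Ioc.1 hr'
  by_cases hin : r ≤ k + p₀ ∧ k + q₀ ≤ r'
  · rw [gaugeChange_eq hk h0.1 (hpq.sub h1 h3 h4) hin]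
    simp only [hφ.map_units_smul, pathSum_smul]
    have hd1 : p < r → ArcDisjoint (s + t + 2) p₀ q₀ p r := by
      intro hlt
      unfold Admissible at h0 hpq
      unfold ArcDisjoint
      omega
    have hd2 : r' < q → ArcDisjoint (s + t + 2) p₀ q₀ r' q := by
      intro hlt
      unfold Admissible at h0 hpq
      unfold ArcDisjoint
      omega
    rw [pathSum_excise_of_disjoint hd1]
    simp only [pathSum_excise_of_disjoint hd2, smul_smul, ← Int.negOnePow_add]
    congr 1
    have h5 : exciseDeg (s + t + 2) q₀ e r - exciseDeg (s + t + 2) q₀ e p = e r - e p := by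
      rcases h1.eq_or_lt with rfl | hlt
      · simp
      · exact exciseDeg_of_disjoint (hd1 hlt) hlt h0.1
    rw [h5, Int.negOnePow_eq_iff]
    exact ⟨e p - e r, by ring⟩
  · have h6 := hcont r r' h1 h3 h4 hin
    rw [gaugeChange_eq_zero h6, curvature_excise_eq_zero ν hc h0 hp₀ (hpq.sub h1 h3 h4) h6]
    simp only [hφ.map_zero, pathSum_zero, smul_zero]

theorem exists_translate {p q : ℕ} (h : ArcContains (s + t + 2) p₀ q₀ p q) :
    ∃ k, (k = 0 ∨ k = s + t + 2) ∧ p ≤ k + p₀ ∧ k + q₀ ≤ q := by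
  rcases h with h | h
  · exact ⟨0, Or.inl rfl, by omega⟩
  · exact ⟨s + t + 2, Or.inr rfl, h⟩

theorem curvature_gauge (hX : IsCyclicFamily ℬ s t e T X)
    (hc : ∀ p q, Admissible s t p q → pathSum X p q ν.op = 0)
    (h0 : Admissible s t p₀ q₀) (hp₀ : p₀ ≤ s + t + 1) (hz : z ∈ ℬ (e q₀ - e p₀)) {p q : ℕ}
    (hpq : Admissible s t p q) : pathSum (gauge ν s t p₀ q₀ z e X) p q ν.op = 0 := by
  by_cases h : ArcContains (s + t + 2) p₀ q₀ p q
  · obtain ⟨k, hk, h⟩ := exists_translate h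
    rw [pathSum_gauge ν hc h0 hp₀ hk hpq h ν.multilinear.isMultiadditive, hc p q hpq,
      ν.markedSum_curvature (fun r r' h1 h2 h3 =>
        (hX.excise h0 hp₀ hz).homogeneous r r' (hpq.sub h1 h2 h3)), smul_zero, add_zero]
  · rw [pathSum_gauge_eq ν h, hc p q hpq]

theorem IsCyclicFamily.gauge (hX : IsCyclicFamily ℬ s t e T X)
    (h0 : Admissible s t p₀ q₀) (hp₀ : p₀ ≤ s + t + 1) (hz : z ∈ ℬ (e q₀ - e p₀)) :
    IsCyclicFamily ℬ s t e T (MasseyIP.gauge ν s t p₀ q₀ z e X) where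
  homogeneous p q hpq := by
    refine Submodule.add_mem _ (hX.homogeneous p q hpq) ?_
    by_cases h : ArcContains (s + t + 2) p₀ q₀ p q
    · obtain ⟨k, hk, h'⟩ := exists_translate h
      rw [gaugeChange_eq hk h0.1 hpq h']
      refine units_smul_mem ?_ _
      have h1 := pathSum_mem (ℬ := ℬ) hpq.1.ne (fun r r' h1 h2 h3 =>
        (hX.excise h0 hp₀ hz).homogeneous r r' (hpq.sub h1 h2 h3)) (φ := ν.op) (D := 1 + 1)
        (fun w hw hw' => by rw [← add_assoc]; exact ν.degree w hw hw')
      rw [exciseDeg_of_contains h h0 hp₀ hpq] at h1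
      convert h1 using 2
      ring
    · rw [gaugeChange_eq_zero h]
      exact Submodule.zero_mem _
  periodic i j hij hj := by
    have hadm : Admissible s t i j := by unfold Admissible; omega
    have hadm' : Admissible s t (s + t + 2 + i) (s + t + 2 + j) := by unfold Admissible; omega
    unfold MasseyIP.gauge
    rw [hX.periodic i j hij hj]
    congr 1
    by_cases h : i ≤ p₀ ∧ q₀ ≤ j
    · rw [gaugeChange_eq (k := 0) (Or.inl rfl) h0.1 hadm (by omega),
        gaugeChange_eq (k := s + t + 2) (Or.inr rfl) h0.1 hadm' (by omega), pathSum_shift,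
        hX.degree_periodic i (by omega), hX.degree_periodic p₀ (by have := h0.1; omega),
        Nat.zero_add, add_sub_add_right_eq_sub]
      congr 1
      exact pathSum_congr_edges (fun r r' h1 h2 h3 =>
        (hX.excise h0 hp₀ hz).periodic r r' h2 (by omega)) _
    · unfold Admissible at h0
      rw [gaugeChange_eq_zero (by unfold ArcContains; omega),
        gaugeChange_eq_zero (by unfold ArcContains; omega)]
  degree_periodic := hX.degree_periodic

end Gauge

section GaugeInvariance

variable {R B : Type*} [CommRing R] [AddCommGroup B] [Module R B] {ℬ : ℤ → Submodule R B}
  {s t : ℕ} {e : ℕ → ℤ} {T : ℤ} {X : ℕ → ℕ → B} {p₀ q₀ : ℕ} {z : B}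
  {ν : AInfAlgebra ℬ} {D : ℤ}

theorem AInfInnerProduct.multiadditive_pathSum_right (I : AInfInnerProduct ν D) (m : B)
    (v w : ℕ) (m' : B) : IsMultiadditive fun x => pathSum X v w fun y => I.toFun x m y m' :=
  ⟨fun a b x y => by
    rw [← pathSum_add]
    exact pathSum_congr fun c => (I.multiadditive_left m c m').map_add a b x y⟩

theorem AInfInnerProduct.map_mid_add (I : AInfInnerProduct ν D) (x y : List B) (m n m' : B)
    (c : ℤˣ) : I.toFun x (m + c • n) y m' = I.toFun x m y m' + c • I.toFun x n y m' := by
  rw [(I.linear_mid x y m').map_add, Units.smul_def, Units.smul_def]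
  exact congrArg _ (map_zsmul (IsLinearMap.mk' _ (I.linear_mid x y m')) (c : ℤ) n)

theorem AInfInnerProduct.map_dual_add (I : AInfInnerProduct ν D) (x y : List B) (m n m' : B)
    (c : ℤˣ) : I.toFun x m y (m' + c • n) = I.toFun x m y m' + c • I.toFun x m y n := by
  rw [(I.linear_dual x m y).map_add, Units.smul_def, Units.smul_def]
  exact congrArg _ (map_zsmul (IsLinearMap.mk' _ (I.linear_dual x m y)) (c : ℤ) n)

theorem AInfInnerProduct.map_mid_zero (I : AInfInnerProduct ν D) (x y : List B) (m' : B) :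
    I.toFun x 0 y m' = 0 := (I.linear_mid x y m').map_zero

theorem AInfInnerProduct.map_dual_zero (I : AInfInnerProduct ν D) (x y : List B) (m : B) :
    I.toFun x m y 0 = 0 := (I.linear_dual x m y).map_zero

theorem pairingTerm_gauge (hX : IsCyclicFamily ℬ s t e T X) (I : AInfInnerProduct ν D)
    (hc : ∀ p q, Admissible s t p q → pathSum X p q ν.op = 0)
    (h0 : Admissible s t p₀ q₀) (hp₀ : p₀ ≤ s + t + 1) {i u v w : ℕ} (hi : i ≤ s) (hu : u ≤ s)
    (hv : s + 1 ≤ v) (hv' : v ≤ s + t + 1) (hw : s + 1 ≤ w) (hw' : w ≤ s + t + 1) :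
    ((e i - e 0) * (e 0 + T - e i)).negOnePow •
      pairingTerm I.toFun s t (gauge ν s t p₀ q₀ z e X) i u v w =
    ((e i - e 0) * (e 0 + T - e i)).negOnePow • pairingTerm I.toFun s t X i u v w +
    (e p₀ - e 0 + if s + t + 2 < q₀ then T else 0).negOnePow •
      ((exciseDeg (s + t + 2) q₀ e i - exciseDeg (s + t + 2) q₀ e 0) *
        (exciseDeg (s + t + 2) q₀ e 0 + (T - 1) - exciseDeg (s + t + 2) q₀ e i)).negOnePow •
      markedTerm I.toFun s t (exciseDeg (s + t + 2) q₀ e) (excise (s + t + 2) p₀ q₀ z X)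
        (fun a b => pathSum (excise (s + t + 2) p₀ q₀ z X) a b ν.op) i u v w := by
  set N := s + t + 2 with hN
  set e' := exciseDeg N q₀ e with he'
  set Y := excise N p₀ q₀ z X with hY
  set C : ℕ → ℕ → B := fun a b => pathSum Y a b ν.op with hC
  rcases lt_or_ge u i with hui | hiu
  · simp only [pairingTerm, markedTerm, pathSum_of_lt _ hui, markedSum_of_lt _ _ _ hui,
      pathSum_zero, smul_zero, add_zero]
  rcases lt_or_ge w v with hwv | hvw
  · simp only [pairingTerm, markedTerm, pathSum_of_lt _ hwv, markedSum_of_lt _ _ _ hwv,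
      pathSum_zero, smul_zero, add_zero]
  have h0' := h0
  have auv : Admissible s t u v := by unfold Admissible; omega
  have awi : Admissible s t w (N + i) := by unfold Admissible; omega
  have aiu : i < u → Admissible s t i u := fun h => by unfold Admissible; omega
  have avw : v < w → Admissible s t v w := fun h => by unfold Admissible; omega
  have hC0 : ∀ {p q}, Admissible s t p q → ¬ ArcContains N p₀ q₀ p q → C p q = 0 :=
    fun h h' => curvature_excise_eq_zero ν hc h0 hp₀ h h'
  have hM : ∀ {p q} {φ : List B → R}, (p < q → Admissible s t p q) → ¬ ArcContains N p₀ q₀ p q →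
      IsMultiadditive φ → markedSum e' Y C p q φ = 0 := by
    intro p q φ h h' hφ
    refine markedSum_eq_zero e' (fun r r' h1 h2 h3 => ?_) hφ
    refine hC0 ((h (by omega)).sub h1 h2 h3) ?_
    unfold ArcContains at *; omega
  -- the vanishing of the marked terms at an arc that does not contain `[p₀, q₀)`
  have z1 : ¬ ArcContains N p₀ q₀ i u → (pathSum Y v w fun y => markedSum e' Y C i u fun x =>
      I.toFun x (Y u v) y (Y w (N + i))) = 0 := fun h => by
    simp only [hM aiu h (I.multiadditive_left _ _ _), pathSum_zero]
  have z2 : ¬ ArcContains N p₀ q₀ u v → (pathSum Y i u fun x => pathSum Y v w fun y =>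
      I.toFun x (C u v) y (Y w (N + i))) = 0 := fun h => by
    simp only [hC0 auv h, I.map_mid_zero, pathSum_zero]
  have z3 : ¬ ArcContains N p₀ q₀ v w → (pathSum Y i u fun x => markedSum e' Y C v w fun y =>
      I.toFun x (Y u v) y (Y w (N + i))) = 0 := fun h => by
    simp only [hM avw h (I.multiadditive_right _ _ _), pathSum_zero]
  have z4 : ¬ ArcContains N p₀ q₀ w (N + i) → (pathSum Y i u fun x => pathSum Y v w fun y =>
      I.toFun x (Y u v) y (C w (N + i))) = 0 := fun h => by
    simp only [hC0 awi h, I.map_dual_zero, pathSum_zero]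
  unfold Admissible at h0'
  by_cases c1 : ArcContains N p₀ q₀ i u
  · have n2 : ¬ ArcContains N p₀ q₀ u v := by unfold ArcContains at *; omega
    have n3 : ¬ ArcContains N p₀ q₀ v w := by unfold ArcContains at *; omega
    have n4 : ¬ ArcContains N p₀ q₀ w (N + i) := by unfold ArcContains at *; omega
    have d2 : ArcDisjoint N p₀ q₀ u v := by unfold ArcContains ArcDisjoint at *; omega
    have d3 : v < w → ArcDisjoint N p₀ q₀ v w := by unfold ArcContains ArcDisjoint at *; omega
    have d4 : ArcDisjoint N p₀ q₀ w (N + i) := by unfold ArcContains ArcDisjoint at *; omega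
    have h1 : i ≤ 0 + p₀ ∧ 0 + q₀ ≤ u := by unfold ArcContains at c1; omega
    have hlt : i < u := by omega
    rw [markedTerm, z2 n2, z3 n3, z4 n4, smul_zero, smul_zero, smul_zero, add_zero, add_zero,
      add_zero, pairingTerm, gauge_eq ν n2, gauge_eq ν n4,
      pathSum_gauge ν hc h0 hp₀ (Or.inl rfl) (aiu hlt) h1]
    swap
    · simp only [pathSum_gauge_eq ν n3]
      exact I.multiadditive_pathSum_right _ _ _ _
    simp only [pathSum_gauge_eq ν n3]
    rw [smul_add, pairingTerm]
    congr 1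
    rw [hY, excise_of_disjoint d2, excise_of_disjoint d4, pathSum_excise_of_disjoint d3, ← hY]
    have h5 : (pathSum X v w fun y => markedSum e' Y C i u fun x =>
        I.toFun x (X u v) y (X w (N + i))) = markedSum e' Y C i u fun x => pathSum X v w fun y =>
          I.toFun x (X u v) y (X w (N + i)) := by
      unfold markedSum
      simp only [pathSum_sum, pathSum_smul]
      refine Finset.sum_congr rfl fun r _ => Finset.sum_congr rfl fun r' _ => ?_
      congr 1
      rw [pathSum_comm]
      refine pathSum_congr fun x => ?_
      rw [pathSum_comm]
    rw [h5, smul_smul, smul_smul, ← Int.negOnePow_add, ← Int.negOnePow_add]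
    congr 1
    rw [Int.negOnePow_eq_iff, he', if_neg (by omega)]
    simp only [exciseDeg]
    rw [if_neg (show ¬ q₀ ≤ i by omega), if_neg (show ¬ N + q₀ ≤ i by omega),
      if_pos (show q₀ ≤ N + i by omega), if_neg (show ¬ q₀ ≤ 0 by omega),
      if_neg (show ¬ N + q₀ ≤ 0 by omega), if_pos (show q₀ ≤ N + 0 by omega), Nat.zero_add]
    exact ⟨0, by ring⟩
  have g1 : ∀ φ : List B → R, pathSum (gauge ν s t p₀ q₀ z e X) i u φ = pathSum X i u φ :=
    fun φ => pathSum_gauge_eq ν c1 φ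
  by_cases c2 : ArcContains N p₀ q₀ u v
  · have n3 : ¬ ArcContains N p₀ q₀ v w := by unfold ArcContains at *; omega
    have n4 : ¬ ArcContains N p₀ q₀ w (N + i) := by unfold ArcContains at *; omega
    have d1 : i < u → ArcDisjoint N p₀ q₀ i u := by unfold ArcContains ArcDisjoint at *; omega
    have d3 : v < w → ArcDisjoint N p₀ q₀ v w := by unfold ArcContains ArcDisjoint at *; omega
    have d4 : ArcDisjoint N p₀ q₀ w (N + i) := by unfold ArcContains ArcDisjoint at *; omega
    have h1 : u ≤ 0 + p₀ ∧ 0 + q₀ ≤ v := by unfold ArcContains at c2; omega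
    rw [markedTerm, z1 c1, z3 n3, z4 n4, smul_zero, smul_zero, add_zero, add_zero,
      zero_add, pairingTerm, g1, gauge_eq ν n4]
    simp only [pathSum_gauge_eq ν n3]
    rw [gauge, gaugeChange_eq (Or.inl rfl) h0.1 auv h1]
    simp only [I.map_mid_add, pathSum_add, pathSum_smul]
    rw [smul_add, pairingTerm]
    congr 1
    rw [hY, excise_of_disjoint d4, pathSum_excise_of_disjoint d1, ← hY]
    have gY : ∀ φ : List B → R, pathSum Y v w φ = pathSum X v w φ :=
      fun φ => pathSum_excise_of_disjoint d3 φ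
    simp only [gY]
    rw [smul_smul, smul_smul, smul_smul, ← Int.negOnePow_add, ← Int.negOnePow_add,
      ← Int.negOnePow_add]
    congr 1
    rw [Int.negOnePow_eq_iff, he', if_neg (by omega)]
    simp only [exciseDeg]
    rw [if_neg (show ¬ q₀ ≤ i by omega), if_neg (show ¬ N + q₀ ≤ i by omega),
      if_pos (show q₀ ≤ N + i by omega), if_neg (show ¬ q₀ ≤ 0 by omega),
      if_neg (show ¬ N + q₀ ≤ 0 by omega), if_pos (show q₀ ≤ N + 0 by omega),
      if_neg (show ¬ q₀ ≤ u by omega), if_neg (show ¬ N + q₀ ≤ u by omega),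
      if_pos (show q₀ ≤ N + u by omega), Nat.zero_add]
    exact ⟨e i - e u, by ring⟩
  by_cases c3 : ArcContains N p₀ q₀ v w
  · have n4 : ¬ ArcContains N p₀ q₀ w (N + i) := by unfold ArcContains at *; omega
    have d1 : i < u → ArcDisjoint N p₀ q₀ i u := by unfold ArcContains ArcDisjoint at *; omega
    have d2 : ArcDisjoint N p₀ q₀ u v := by unfold ArcContains ArcDisjoint at *; omega
    have d4 : ArcDisjoint N p₀ q₀ w (N + i) := by unfold ArcContains ArcDisjoint at *; omega
    have h1 : v ≤ 0 + p₀ ∧ 0 + q₀ ≤ w := by unfold ArcContains at c3; omega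
    have hlt : v < w := by omega
    rw [markedTerm, z1 c1, z2 c2, z4 n4, smul_zero, smul_zero, add_zero, zero_add,
      zero_add, pairingTerm, g1, gauge_eq ν c2, gauge_eq ν n4]
    simp only [pathSum_gauge ν hc h0 hp₀ (Or.inl rfl) (avw hlt) h1 (I.multiadditive_right _ _ _)]
    rw [pathSum_add, pathSum_smul, smul_add, pairingTerm]
    congr 1
    rw [hY, excise_of_disjoint d4, excise_of_disjoint d2, pathSum_excise_of_disjoint d1, ← hY]
    rw [smul_smul, smul_smul, smul_smul, ← Int.negOnePow_add, ← Int.negOnePow_add,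
      ← Int.negOnePow_add]
    congr 1
    rw [Int.negOnePow_eq_iff, he', if_neg (by omega)]
    simp only [exciseDeg]
    rw [if_neg (show ¬ q₀ ≤ i by omega), if_neg (show ¬ N + q₀ ≤ i by omega),
      if_pos (show q₀ ≤ N + i by omega), if_neg (show ¬ q₀ ≤ 0 by omega),
      if_neg (show ¬ N + q₀ ≤ 0 by omega), if_pos (show q₀ ≤ N + 0 by omega),
      if_neg (show ¬ q₀ ≤ v by omega), if_neg (show ¬ N + q₀ ≤ v by omega),
      if_pos (show q₀ ≤ N + v by omega), Nat.zero_add]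
    exact ⟨e i - e v, by ring⟩
  have g3 : ∀ φ : List B → R, pathSum (gauge ν s t p₀ q₀ z e X) v w φ = pathSum X v w φ :=
    fun φ => pathSum_gauge_eq ν c3 φ
  by_cases c4 : ArcContains N p₀ q₀ w (N + i)
  · have d1 : i < u → ArcDisjoint N p₀ q₀ i u := by unfold ArcContains ArcDisjoint at *; omega
    have d2 : ArcDisjoint N p₀ q₀ u v := by unfold ArcContains ArcDisjoint at *; omega
    have d3 : v < w → ArcDisjoint N p₀ q₀ v w := by unfold ArcContains ArcDisjoint at *; omega
    obtain ⟨k, hk, h1⟩ := exists_translate c4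
    rw [markedTerm, z1 c1, z2 c2, z3 c3, smul_zero, smul_zero, zero_add, zero_add,
      zero_add, pairingTerm, g1, gauge_eq ν c2]
    simp only [g3]
    rw [gauge, gaugeChange_eq hk h0.1 awi h1]
    simp only [I.map_dual_add, pathSum_add, pathSum_smul]
    rw [smul_add, pairingTerm]
    congr 1
    rw [hY, excise_of_disjoint d2, pathSum_excise_of_disjoint d1, ← hY]
    have gY : ∀ φ : List B → R, pathSum Y v w φ = pathSum X v w φ :=
      fun φ => pathSum_excise_of_disjoint d3 φ
    simp only [gY]
    rw [smul_smul, smul_smul, smul_smul, ← Int.negOnePow_add, ← Int.negOnePow_add,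
      ← Int.negOnePow_add]
    congr 1
    rw [Int.negOnePow_eq_iff, he']
    simp only [exciseDeg]
    rcases hk with rfl | rfl
    · rw [if_neg (show ¬ q₀ ≤ i by omega), if_neg (show ¬ N + q₀ ≤ i by omega),
        if_pos (show q₀ ≤ N + i by omega), if_neg (show ¬ q₀ ≤ 0 by omega),
        if_neg (show ¬ N + q₀ ≤ 0 by omega),
        if_neg (show ¬ q₀ ≤ w by omega), if_neg (show ¬ N + q₀ ≤ w by omega),
        if_pos (show q₀ ≤ N + w by omega), Nat.zero_add]
      by_cases hq : N < q₀
      · rw [if_pos hq, if_neg (by omega)]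
        exact ⟨e 0 - e w, by ring⟩
      · rw [if_neg hq, if_pos (by omega)]
        exact ⟨e i - e w, by ring⟩
    · rw [if_pos (show q₀ ≤ i by omega), if_neg (show ¬ N + q₀ ≤ i by omega),
        if_pos (show q₀ ≤ N + i by omega), if_neg (show ¬ q₀ ≤ 0 by omega),
        if_neg (show ¬ N + q₀ ≤ 0 by omega), if_pos (show q₀ ≤ N + 0 by omega),
        if_pos (show q₀ ≤ w by omega), if_neg (show ¬ N + q₀ ≤ w by omega),
        if_pos (show q₀ ≤ N + w by omega), if_neg (by omega), hX.degree_periodic p₀ (by omega)]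
      exact ⟨T + e 0 - e w, by ring⟩
  rw [markedTerm, z1 c1, z2 c2, z3 c3, z4 c4, pairingTerm, g1, gauge_eq ν c2, gauge_eq ν c4]
  simp only [g3, smul_zero, add_zero]
  rfl

/-- The sum over all cyclic words is invariant under gauge transformations. -/
theorem cyclicSum_gauge (hX : IsCyclicFamily ℬ s t e T X) (I : AInfInnerProduct ν D)
    (hc : ∀ p q, Admissible s t p q → pathSum X p q ν.op = 0)
    (h0 : Admissible s t p₀ q₀) (hp₀ : p₀ ≤ s + t + 1) (hz : z ∈ ℬ (e q₀ - e p₀)) :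
    cyclicSum s t e T (pairingTerm I.toFun s t (gauge ν s t p₀ q₀ z e X)) =
      cyclicSum s t e T (pairingTerm I.toFun s t X) := by
  have h1 := (hX.excise h0 hp₀ hz).cyclicSum_curvature I
  have h2 : cyclicSum s t e T (pairingTerm I.toFun s t (gauge ν s t p₀ q₀ z e X)) =
      cyclicSum s t e T (pairingTerm I.toFun s t X) +
      (e p₀ - e 0 + if s + t + 2 < q₀ then T else 0).negOnePow •
        cyclicSum s t (exciseDeg (s + t + 2) q₀ e) (T - 1) (markedTerm I.toFun s t
          (exciseDeg (s + t + 2) q₀ e) (excise (s + t + 2) p₀ q₀ z X)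
          fun a b => pathSum (excise (s + t + 2) p₀ q₀ z X) a b ν.op) := by
    simp only [cyclicSum, Finset.smul_sum, ← Finset.sum_add_distrib]
    refine Finset.sum_congr rfl fun i hi => Finset.sum_congr rfl fun u hu =>
      Finset.sum_congr rfl fun v hv => Finset.sum_congr rfl fun w hw => ?_
    rw [Finset.mem_Icc] at hi hu hv hw
    exact pairingTerm_gauge hX I hc h0 hp₀ hi.2 hu.2 hv.1 hv.2 hw.1 hw.2
  rw [h2, h1, smul_zero, add_zero]

end GaugeInvariance

/-! ### Massey inner products in terms of cyclic families -/

/-- The restriction of `φ` to the words of length at least two. -/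
def atLeastTwo {A V : Type*} [Zero V] (φ : List A → V) (w : List A) : V :=
  if 2 ≤ w.length then φ w else 0

theorem IsMultiadditive.atLeastTwo {A V : Type*} [AddCommGroup A] [AddCommGroup V] {φ : List A → V}
    (h : IsMultiadditive φ) : IsMultiadditive (atLeastTwo φ) :=
  ⟨fun u v x y => by
    unfold MasseyIP.atLeastTwo
    simp only [List.length_append, List.length_cons]
    split_ifs
    · exact h.map_add u v x y
    · simp⟩

theorem pathSum_eq_add_atLeastTwo {A V : Type*} [AddCommMonoid V] (X : ℕ → ℕ → A) {p q : ℕ}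
    (hpq : p < q) (φ : List A → V) :
    pathSum X p q φ = φ [X p q] + pathSum X p q (atLeastTwo φ) := by
  rw [pathSum_rec _ hpq.ne, pathSum_rec _ hpq.ne,
    ← Finset.add_sum_erase _ _ (Finset.mem_Ioc.2 ⟨hpq, le_rfl⟩),
    ← Finset.add_sum_erase (Finset.Ioc p q) (fun r => pathSum X r q fun w =>
      atLeastTwo φ (X p r :: w)) (Finset.mem_Ioc.2 ⟨hpq, le_rfl⟩)]
  simp only [pathSum_self]
  have h1 : atLeastTwo φ [X p q] = 0 := if_neg (by simp)
  rw [h1, zero_add]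
  congr 1
  refine Finset.sum_congr rfl fun r hr => ?_
  refine pathSum_congr_ne_nil (Finset.mem_erase.1 hr).1 fun w hw => ?_
  have := List.length_pos_iff.2 hw
  exact (if_pos (by rw [List.length_cons]; omega)).symm

theorem pathSum_atLeastTwo_congr {A V : Type*} [AddCommMonoid V] {X Y : ℕ → ℕ → A} {p q : ℕ}
    (h : ∀ r r', p ≤ r → r < r' → r' ≤ q → r' - r < q - p → X r r' = Y r r') (φ : List A → V) :
    pathSum X p q (atLeastTwo φ) = pathSum Y p q (atLeastTwo φ) := by
  rcases lt_trichotomy p q with hpq | rfl | hpq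
  · rw [pathSum_rec _ hpq.ne, pathSum_rec _ hpq.ne]
    refine Finset.sum_congr rfl fun r hr => ?_
    obtain ⟨h1, h2⟩ := Finset.mem_Ioc.1 hr
    rcases h2.eq_or_lt with rfl | hlt
    · simp [atLeastTwo]
    · rw [h p r le_rfl h1 h2 (by omega)]
      exact pathSum_congr_edges (fun a b h3 h4 h5 => h a b (by omega) h4 h5 (by omega)) _
  · simp
  · rw [pathSum_of_lt _ hpq, pathSum_of_lt _ hpq]

theorem length_stairWord {A : Type*} (x : ℕ → ℕ → A) (p : ℕ) (l : List ℕ) :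
    (stairWord x p l).length = l.length := by
  induction l generalizing p with
  | nil => rfl
  | cons n l ih => simp [stairWord, ih]

theorem staircase_eq {A : Type*} [AddCommGroup A] (op : List A → A) (x : ℕ → ℕ → A) {p q : ℕ}
    (hpq : p ≤ q) :
    staircase op x p q = pathSum (fun a b => x a (b - 1)) p (q + 1) (atLeastTwo op) := by
  rw [← sum_stairWord x (by omega), staircase]
  have h1 : ∀ c : Composition (q + 1 - p), atLeastTwo op (stairWord x p c.blocks) =
      if 2 ≤ c.length then op (stairWord x p c.blocks) else 0 := by
    intro c
    rw [atLeastTwo, length_stairWord]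
  simp only [h1]
  rw [← Finset.sum_filter]
  exact (Finset.sum_subtype (p := fun c : Composition (q + 1 - p) => 2 ≤ c.length) _
    (fun c => by simp) fun c => op (stairWord x p c.blocks)).symm

/-- The sum of the shifted degrees of the first `q` letters of a cyclic word. -/
def cumDeg {n : ℕ} [NeZero n] (d : Fin n → ℤ) (q : ℕ) : ℤ := ∑ l ∈ Finset.range q, (cyc d l - 1)

theorem cyc_add_left {α : Type*} {n : ℕ} [NeZero n] (a : Fin n → α) (j : ℕ) :
    cyc a (n + j) = cyc a j := by
  unfold cyc
  congr 1
  apply Fin.ext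
  simp [Fin.ofNat]

theorem cumDeg_add_left {n : ℕ} [NeZero n] (d : Fin n → ℤ) (i : ℕ) :
    cumDeg d (n + i) = cumDeg d i + cumDeg d n := by
  unfold cumDeg
  rw [Finset.sum_range_add, add_comm]
  simp only [cyc_add_left]

theorem cumDeg_sub {n : ℕ} [NeZero n] (d : Fin n → ℤ) {p q : ℕ} (h : p ≤ q) :
    ∑ l ∈ Finset.Ico p q, (cyc d l - 1) = cumDeg d q - cumDeg d p :=
  Finset.sum_Ico_eq_sub _ h

theorem cumDeg_succ_sub {n : ℕ} [NeZero n] (d : Fin n → ℤ) {p q : ℕ} (h : p ≤ q) :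
    ∑ l ∈ Finset.Icc p q, (cyc d l - 1) = cumDeg d (q + 1) - cumDeg d p := by
  rw [← cumDeg_sub d (by omega)]
  refine Finset.sum_congr ?_ fun _ _ => rfl
  ext a; simp only [Finset.mem_Icc, Finset.mem_Ico]; omega

/-- A cyclic family with vanishing curvature and given diagonal elements. -/
structure IsFlatCyclicFamily {R A : Type*} [CommRing R] [AddCommGroup A] [Module R A]
    (𝒜 : ℤ → Submodule R A) (op : List A → A) (s t : ℕ) (d : Fin (s + t + 2) → ℤ)
    (a : Fin (s + t + 2) → A) (X : ℕ → ℕ → A) : Prop where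
  family : IsCyclicFamily 𝒜 s t (cumDeg d) (cumDeg d (s + t + 2)) X
  diag : ∀ i, i ≤ s + t + 1 → X i (i + 1) = cyc a i
  curvature : ∀ p q, Admissible s t p q → pathSum X p q op = 0

theorem staircaseIP_eq {R A : Type*} [CommRing R] {s t : ℕ} {d : Fin (s + t + 2) → ℤ}
    (I : List A → A → List A → A → R) {x x' X : ℕ → ℕ → A}
    (hx : ∀ p q, p < q → q ≤ s + t + 1 → X p q = x p (q - 1))
    (hx' : ∀ w i, i ≤ s → s + 1 ≤ w → w ≤ s + t + 1 →
      X w (s + t + 2 + i) = x' w (s + t + 1 + i)) :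
    staircaseIP I s t d x x' =
      cyclicSum s t (cumDeg d) (cumDeg d (s + t + 2)) (pairingTerm I s t X) := by
  unfold staircaseIP cyclicSum
  refine Finset.sum_congr rfl fun i hi => ?_
  have hi := (Finset.mem_Icc.1 hi).2
  have hsub : Finset.Icc i s ⊆ Finset.Icc 0 s := fun a => by simp only [Finset.mem_Icc]; omega
  rw [← Finset.sum_subset hsub]
  swap
  · intro u hu hu'
    rw [Finset.mem_Icc] at hu hu'
    simp only [pairingTerm, pathSum_of_lt X (show u < i by omega), smul_zero, Finset.sum_const_zero]
  refine Finset.sum_congr rfl fun u hu => ?_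
  have hu := Finset.mem_Icc.1 hu
  refine Finset.sum_nbij' (· + 1) (· - 1) (fun v hv => ?_) (fun v hv => ?_) (fun v hv => ?_)
    (fun v hv => ?_) (fun v hv => ?_)
  · simp only [Finset.mem_Icc] at hv ⊢; omega
  · simp only [Finset.mem_Icc] at hv ⊢; omega
  · simp only [Finset.mem_Icc] at hv ⊢; omega
  · simp only [Finset.mem_Icc] at hv ⊢; omega
  have hv := Finset.mem_Icc.1 hv
  have hsub' : Finset.Icc (v + 1) (s + t + 1) ⊆ Finset.Icc (s + 1) (s + t + 1) := fun a => by
    simp only [Finset.mem_Icc]; omega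
  rw [← Finset.sum_subset hsub']
  swap
  · intro w hw hw'
    rw [Finset.mem_Icc] at hw hw'
    simp only [pairingTerm, pathSum_of_lt X (show w < v + 1 by omega), smul_zero, pathSum_zero]
  refine Finset.sum_nbij' (· + 1) (· - 1) (fun v hv => ?_) (fun v hv => ?_) (fun v hv => ?_)
    (fun v hv => ?_) (fun w hw => ?_)
  · simp only [Finset.mem_Icc] at hv ⊢; omega
  · simp only [Finset.mem_Icc] at hv ⊢; omega
  · simp only [Finset.mem_Icc] at hv ⊢; omega
  · simp only [Finset.mem_Icc] at hv ⊢; omega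
  have hw := Finset.mem_Icc.1 hw
  have h0 : cumDeg d 0 = 0 := rfl
  simp only [← Finset.smul_sum]
  rw [cumDeg_sub d (Nat.zero_le i), cumDeg_sub d (by omega), h0, zero_add]
  congr 1
  rw [pairingTerm, hx u (v + 1) (by omega) (by omega), hx' (w + 1) i hi (by omega) (by omega),
    pathSum_congr_edges (X' := fun a b => x a (b - 1)) fun r r' h1 h2 h3 =>
      hx r r' h2 (by omega), ← sum_stairWord x hu.1]
  refine Finset.sum_congr rfl fun c _ => ?_
  rw [pathSum_congr_edges (X' := fun a b => x a (b - 1)) fun r r' h1 h2 h3 =>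
      hx r r' h2 (by omega), ← sum_stairWord x (by omega), Nat.add_sub_add_right]
  rfl

section Massey

variable {R A : Type*} [CommRing R] [AddCommGroup A] [Module R A] {𝒜 : ℤ → Submodule R A}
  {s t : ℕ} {d : Fin (s + t + 2) → ℤ} {a : Fin (s + t + 2) → A} {op : List A → A}

theorem IsCyclicDefiningSystem.exists_flat {x x' : ℕ → ℕ → A}
    (h : IsCyclicDefiningSystem 𝒜 op s t d a x x') (I : List A → A → List A → A → R) :
    ∃ X, IsFlatCyclicFamily 𝒜 op s t d a X ∧
      cyclicSum s t (cumDeg d) (cumDeg d (s + t + 2)) (pairingTerm I s t X) =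
        staircaseIP I s t d x x' := by
  set X : ℕ → ℕ → A := fun p q => if q ≤ s + t + 1 then x p (q - 1) else x' p (q - 1) with hX
  have h1 : ∀ p q, p < q → q ≤ s + t + 1 → X p q = x p (q - 1) := fun p q _ hq => if_pos hq
  have h2 : ∀ p q, s + 1 ≤ p → p < q → X p q = x' p (q - 1) := fun p q hp hpq => by
    rw [hX]
    simp only
    split_ifs with hq
    · exact (h.overlap_right p (q - 1) hp (by omega) (by omega)).symm
    · rfl
  refine ⟨X, ⟨⟨fun p q hpq => ?_, fun i j hij hj => ?_, fun i _ => cumDeg_add_left d i⟩,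
    fun i hi => ?_, fun p q hpq => ?_⟩, (staircaseIP_eq I h1 fun w i _ hw _ => ?_).symm⟩
  · obtain ⟨h3, h4 | ⟨h4, h5⟩⟩ := hpq
    · have := h.fst.degree p (q - 1) (Nat.zero_le _) (by omega) (by omega)
      rwa [cumDeg_succ_sub d (by omega), Nat.sub_add_cancel (by omega), ← h1 p q h3 h4] at this
    · have := h.snd.degree p (q - 1) h4 (by omega) (by omega)
      rwa [cumDeg_succ_sub d (by omega), Nat.sub_add_cancel (by omega), ← h2 p q h4 h3] at this
  · rw [h2 _ _ (by omega) (by omega), h1 i j hij (by omega), Nat.add_sub_assoc (by omega),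
      h.overlap_left i (j - 1) (by omega) (by omega)]
  · rcases Nat.lt_or_ge i (s + t + 1) with hlt | hge
    · rw [h1 i (i + 1) (by omega) (by omega)]
      exact h.fst.diag i (Nat.zero_le _) (by omega)
    · rw [h2 i (i + 1) (by omega) (by omega)]
      exact h.snd.diag i (by omega) (by omega)
  · obtain ⟨h3, h4 | ⟨h4, h5⟩⟩ := hpq
    · have h6 := h.d_fst p (q - 1) (by omega) (by omega)
      rw [staircase_eq op x (by omega), Nat.sub_add_cancel (by omega),
        ← pathSum_congr_edges (X := X) fun r r' h7 h8 h9 => h1 r r' h8 (by omega),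
        ← h1 p q h3 h4] at h6
      rw [pathSum_eq_add_atLeastTwo X h3, h6, neg_add_cancel]
    · have h6 := h.d_snd p (q - 1) (by omega) (by omega) (by omega)
      rw [staircase_eq op x' (by omega), Nat.sub_add_cancel (by omega),
        ← pathSum_congr_edges (X := X) fun r r' h7 h8 h9 => h2 r r' (by omega) h8,
        ← h2 p q h4 h3] at h6
      rw [pathSum_eq_add_atLeastTwo X h3, h6, neg_add_cancel]
  · exact (h2 w _ hw (by omega)).trans (by rw [show s + t + 2 + i - 1 = s + t + 1 + i by omega])

theorem IsFlatCyclicFamily.isCyclicDefiningSystem {X : ℕ → ℕ → A}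
    (h : IsFlatCyclicFamily 𝒜 op s t d a X) :
    IsCyclicDefiningSystem 𝒜 op s t d a (fun p q => X p (q + 1)) fun p q => X p (q + 1) := by
  have h1 : ∀ i j, i ≤ j → Admissible s t i (j + 1) →
      op [X i (j + 1)] = -staircase op (fun p q => X p (q + 1)) i j := by
    intro i j hij hadm
    have h2 := h.curvature i (j + 1) hadm
    rw [pathSum_eq_add_atLeastTwo X hadm.1] at h2
    rw [staircase_eq op _ hij, eq_neg_of_add_eq_zero_left h2]
    congr 1
    refine pathSum_congr_edges (fun r r' h3 h4 h5 => ?_) _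
    rw [Nat.sub_add_cancel (by omega)]
  have h2 : ∀ i j, i ≤ j → Admissible s t i (j + 1) →
      X i (j + 1) ∈ 𝒜 ((∑ l ∈ Finset.Icc i j, (cyc d l - 1)) + 1) := by
    intro i j hij hadm
    rw [cumDeg_succ_sub d hij]
    exact h.family.homogeneous i (j + 1) hadm
  have h3 : ∀ i, i ≤ s + t + 1 + s → X i (i + 1) = cyc a i := by
    intro i hi
    rcases Nat.lt_or_ge i (s + t + 2) with hlt | hge
    · exact h.diag i (by omega)
    · obtain ⟨j, rfl⟩ := Nat.exists_eq_add_of_le hge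
      rw [cyc_add_left, ← h.diag j (by omega), ← h.family.periodic j (j + 1) (by omega) (by omega)]
      rfl
  exact
    { fst := ⟨fun i _ hi => h3 i (by omega), fun i j _ hij hj => h2 i j hij (by
        unfold Admissible; omega)⟩
      snd := ⟨fun i _ hi => h3 i (by omega), fun i j hi hij hj => h2 i j hij (by
        unfold Admissible; omega)⟩
      overlap_right := fun _ _ _ _ _ => rfl
      overlap_left := fun i j hij hj => h.family.periodic i (j + 1) (by omega) (by omega)
      d_fst := fun i j hij hj => h1 i j hij (by unfold Admissible; omega)
      d_snd := fun i j hi hij hj => h1 i j hij (by unfold Admissible; omega) }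

theorem mem_masseyInnerProduct_iff (I : List A → A → List A → A → R) (r : R) :
    r ∈ masseyInnerProduct 𝒜 op I s t d a ↔ ∃ X, IsFlatCyclicFamily 𝒜 op s t d a X ∧
      cyclicSum s t (cumDeg d) (cumDeg d (s + t + 2)) (pairingTerm I s t X) = r := by
  constructor
  · rintro ⟨x, x', h, rfl⟩
    exact h.exists_flat I
  · rintro ⟨X, h, rfl⟩
    refine ⟨_, _, h.isCyclicDefiningSystem, staircaseIP_eq I (fun p q hpq _ => ?_)
      fun w i _ _ _ => ?_⟩
    · rw [Nat.sub_add_cancel (by omega)]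
    · rw [show s + t + 1 + i + 1 = s + t + 2 + i by omega]

end Massey

/-! ### The pullback of an inner product on homogeneous elements -/

section HomSum

variable {R A V : Type*} [CommRing R] [AddCommGroup A] [Module R A] {𝒜 : ℤ → Submodule R A}
  [DirectSum.Decomposition 𝒜] [AddCommMonoid V]

theorem homSum_of_mem {φ : ℤ × A → V} {d : ℤ} {a : A} (ha : a ∈ 𝒜 d) (hφ : φ (d, 0) = 0) :
    homSum 𝒜 φ a = φ (d, a) := by
  classical
  unfold homSum
  by_cases h : a = 0
  · subst h
    simp [hφ]
  · rw [DirectSum.decompose_of_mem 𝒜 ha, DirectSum.support_of _ _ (by simpa using h),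
      Finset.sum_singleton]
    simp

theorem homSumList_of_homogeneous {φ : List (ℤ × A) → V}
    (hφ : ∀ w, (0 : A) ∈ letters w → φ w = 0) {w : List (ℤ × A)} (hw : IsHomogeneousWord 𝒜 w) :
    homSumList 𝒜 φ (letters w) = φ w := by
  induction w generalizing φ with
  | nil => rfl
  | cons y w ih =>
    have hw' : IsHomogeneousWord 𝒜 w := fun x hx => hw x (List.mem_cons_of_mem _ hx)
    rw [letters_cons, homSumList]
    have h1 : ∀ x : ℤ × A, homSumList 𝒜 (fun w => φ (x :: w)) (letters w) = φ (x :: w) :=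
      fun x => ih (fun v hv => hφ _ (by simp [hv])) hw'
    simp only [h1]
    exact homSum_of_mem (φ := fun x => φ (x :: w)) (hw y (by simp)) (hφ _ (by simp))

end HomSum

theorem cutSum_const_zero {A B V : Type*} [AddCommMonoid V] (k : List A → B) (l : List A) :
    cutSum k (fun _ => (0 : V)) l = 0 := Finset.sum_const_zero

theorem cutSum_of_mem_zero {A B V : Type*} [Zero A] [AddCommGroup B] [AddCommGroup V]
    {k : List A → B} (hk : ∀ w, (0 : A) ∈ w → k w = 0) {φ : List B → V} (hφ : IsMultiadditive φ)
    {l : List A} (hl : (0 : A) ∈ l) : cutSum k φ l = 0 := by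
  refine Finset.sum_eq_zero fun c _ => hφ.of_mem_zero ?_
  rw [← l.flatten_splitWrtComposition c] at hl
  obtain ⟨v, hv, h0⟩ := List.mem_flatten.1 hl
  rw [← hk v h0]
  exact List.mem_map_of_mem hv

theorem pathSum_cutSum_comm {A B L V : Type*} [AddCommMonoid V] (X : ℕ → ℕ → L) (p q : ℕ)
    (k : List A → B) (φ : List B → List L → V) (l : List A) :
    pathSum X p q (fun v => cutSum k (fun x => φ x v) l) =
      cutSum k (fun x => pathSum X p q (φ x)) l :=
  Finset.sum_comm

theorem AInfInnerProduct.multiadditive_cutSum_right {R A B : Type*} [CommRing R] [AddCommGroup B]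
    [Module R B] {ℬ : ℤ → Submodule R B} {ν : AInfAlgebra ℬ} {D : ℤ} (I : AInfInnerProduct ν D) (k : List A → B)
    (m : B) (l : List A) (m' : B) :
    IsMultiadditive fun x => cutSum k (fun y => I.toFun x m y m') l :=
  ⟨fun a b x y => by
    unfold cutSum
    rw [← Finset.sum_add_distrib]
    exact Finset.sum_congr rfl fun c _ => (I.multiadditive_left m _ m').map_add a b x y⟩

/-- The summand of `pullbackHom` for a cut of the two words into three words each. -/
def pullbackTerm {R A B : Type*} [CommRing R] (k : List A → B) (I : List B → B → List B → B → R) (m m' : ℤ × A)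
    (u₁ u₂ u₃ v₁ v₂ v₃ : List (ℤ × A)) : R :=
  (sdeg u₁ * sdeg (u₂ ++ u₃ ++ m :: (v₁ ++ v₂ ++ v₃) ++ [m'])).negOnePow •
    cutSum k (fun x => cutSum k (fun y => I x (k (letters (u₃ ++ m :: v₁))) y
      (k (letters (v₃ ++ m' :: u₁)))) (letters v₂)) (letters u₂)

theorem pullbackHom_eq {R A B : Type*} [CommRing R] (k : List A → B) (I : List B → B → List B → B → R) (u : List (ℤ × A))
    (m : ℤ × A) (v : List (ℤ × A)) (m' : ℤ × A) :
    pullbackHom k I u m v m' =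
      ∑ i ∈ Finset.range (u.length + 1), ∑ q ∈ Finset.range (v.length + 1),
        ∑ j ∈ Finset.range ((u.drop i).length + 1), ∑ r ∈ Finset.range ((v.take q).length + 1),
          pullbackTerm k I m m' (u.take i) ((u.drop i).take j) ((u.drop i).drop j)
            ((v.take q).take r) ((v.take q).drop r) (v.drop q) := by
  unfold pullbackHom
  refine Finset.sum_congr rfl fun i hi => ?_
  have hi := Finset.mem_range.1 hi
  rw [Finset.sum_comm]
  refine Finset.sum_congr rfl fun q hq => ?_
  have hq := Finset.mem_range.1 hq
  refine Finset.sum_nbij' (· - i) (· + i) (fun j hj => ?_) (fun j hj => ?_) (fun j hj => ?_)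
    (fun j hj => ?_) (fun j hj => ?_)
  · simp only [Finset.mem_Icc, Finset.mem_range, List.length_drop] at hj ⊢; omega
  · simp only [Finset.mem_Icc, Finset.mem_range, List.length_drop] at hj ⊢; omega
  · simp only [Finset.mem_Icc] at hj ⊢; omega
  · simp
  have hj := Finset.mem_Icc.1 hj
  refine Finset.sum_congr (by rw [List.length_take, min_eq_left (by omega)]) fun r hr => ?_
  have hr := Finset.mem_range.1 hr
  rw [List.length_take, min_eq_left (by omega)] at hr
  unfold pullbackTerm
  rw [List.take_append_drop, List.take_append_drop, List.take_append_drop, List.take_take,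
    min_eq_left (by omega), List.drop_drop, List.drop_take (l := u), Nat.add_sub_cancel' hj.1]

theorem AInfInnerProduct.pullbackHom_of_mem_zero {R A B : Type*} [CommRing R] [AddCommGroup A]
    [AddCommGroup B] [Module R B] {ℬ : ℤ → Submodule R B} {ν : AInfAlgebra ℬ} {D : ℤ}
    (I : AInfInnerProduct ν D) {k : List A → B}
    (hk : ∀ w, (0 : A) ∈ w → k w = 0) (u : List (ℤ × A)) (m : ℤ × A) (v : List (ℤ × A))
    (m' : ℤ × A) (h : (0 : A) ∈ letters (u ++ m :: v ++ [m'])) :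
    pullbackHom k I.toFun u m v m' = 0 := by
  refine Finset.sum_eq_zero fun i _ => Finset.sum_eq_zero fun j hj => Finset.sum_eq_zero fun q _ =>
    Finset.sum_eq_zero fun r hr => (congrArg _ ?_).trans (smul_zero _)
  have hu : u = u.take i ++ (u.take j).drop i ++ u.drop j := by
    have h1 : (u.take j).take i = u.take i := by
      rw [List.take_take, min_eq_left (Finset.mem_Icc.1 hj).1]
    rw [← h1, List.take_append_drop, List.take_append_drop]
  have hv : v = v.take r ++ (v.take q).drop r ++ v.drop q := by
    have h1 : (v.take q).take r = v.take r := by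
      rw [List.take_take, min_eq_left (by have := Finset.mem_range.1 hr; omega)]
    rw [← h1, List.take_append_drop, List.take_append_drop]
  have h' : (0 : A) ∈ letters ((u.take j).drop i) ∨ (0 : A) ∈ letters ((v.take q).drop r) ∨
      (0 : A) ∈ letters (u.drop j ++ m :: v.take r) ∨
      (0 : A) ∈ letters (v.drop q ++ m' :: u.take i) := by
    rw [hu, hv] at h
    simp only [letters_append, letters_cons, letters_nil, List.mem_append, List.mem_cons,
      List.not_mem_nil, or_false] at h ⊢
    tauto
  rcases h' with h' | h' | h' | h'
  · exact cutSum_of_mem_zero hk (I.multiadditive_cutSum_right k _ _ _) h'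
  · simp only [cutSum_of_mem_zero hk (I.multiadditive_right _ _ _) h', cutSum_const_zero]
  · simp only [hk _ h', I.map_mid_zero, cutSum_const_zero]
  · simp only [hk _ h', I.map_dual_zero, cutSum_const_zero]

section Pullback

variable {R A B : Type*} [CommRing R] [AddCommGroup A] [Module R A] {𝒜 : ℤ → Submodule R A}
  [AddCommGroup B] [Module R B] {ℬ : ℤ → Submodule R B} {ν : AInfAlgebra ℬ} {D : ℤ}

theorem AInfInnerProduct.pullback_of_homogeneous [DirectSum.Decomposition 𝒜]
    (I : AInfInnerProduct ν D) {k : List A → B}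
    (hk : ∀ w, (0 : A) ∈ w → k w = 0) {u : List (ℤ × A)} {m : ℤ × A} {v : List (ℤ × A)}
    {m' : ℤ × A} (hu : IsHomogeneousWord 𝒜 u) (hm : m.2 ∈ 𝒜 m.1) (hv : IsHomogeneousWord 𝒜 v)
    (hm' : m'.2 ∈ 𝒜 m'.1) :
    pullback 𝒜 k I.toFun (letters u) m.2 (letters v) m'.2 = pullbackHom k I.toFun u m v m' := by
  have h1 : ∀ u n v, homSum 𝒜 (fun n' => pullbackHom k I.toFun u n v n') m'.2 =
      pullbackHom k I.toFun u n v m' := fun u n v =>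
    homSum_of_mem hm' (I.pullbackHom_of_mem_zero hk _ _ _ _ (by simp))
  unfold pullback
  simp only [h1]
  have h2 : ∀ u n, homSumList 𝒜 (fun v => pullbackHom k I.toFun u n v m') (letters v) =
      pullbackHom k I.toFun u n v m' := fun u n =>
    homSumList_of_homogeneous (fun v hv => I.pullbackHom_of_mem_zero hk _ _ _ _ (by simp [hv])) hv
  simp only [h2]
  have h3 : ∀ u, homSum 𝒜 (fun n => pullbackHom k I.toFun u n v m') m.2 =
      pullbackHom k I.toFun u m v m' := fun u =>
    homSum_of_mem hm (I.pullbackHom_of_mem_zero hk _ _ _ _ (by simp))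
  simp only [h3]
  exact homSumList_of_homogeneous
    (fun u hu => I.pullbackHom_of_mem_zero hk _ _ _ _ (by simp [hu])) hu

variable {s t : ℕ} {e : ℕ → ℤ} {T : ℤ} {X : ℕ → ℕ → A}

theorem sum_comm_pair {α β γ δ V : Type*} [AddCommMonoid V] (a : Finset α) (b : Finset β)
    (c : Finset γ) (d : Finset δ) (f : α → β → γ → δ → V) :
    ∑ i ∈ a, ∑ j ∈ b, ∑ k ∈ c, ∑ l ∈ d, f i j k l =
      ∑ k ∈ c, ∑ l ∈ d, ∑ i ∈ a, ∑ j ∈ b, f i j k l :=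
  (sum_comm_last _ _ _ _ _).trans ((sum_comm_last _ _ _ _ _))

theorem sum_comm_third {α β γ V : Type*} [AddCommMonoid V] (a : Finset α) (b : Finset β)
    (c : Finset γ) (f : α → β → γ → V) :
    ∑ i ∈ a, ∑ j ∈ b, ∑ k ∈ c, f i j k = ∑ k ∈ c, ∑ i ∈ a, ∑ j ∈ b, f i j k :=
  (Finset.sum_congr rfl fun _ _ => Finset.sum_comm).trans Finset.sum_comm

theorem sum_comm_fifth {α β γ δ ε V : Type*} [AddCommMonoid V] (a : Finset α) (b : Finset β)
    (c : Finset γ) (d : Finset δ) (e : Finset ε) (f : α → β → γ → δ → ε → V) :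
    ∑ i ∈ a, ∑ j ∈ b, ∑ k ∈ c, ∑ l ∈ d, ∑ m ∈ e, f i j k l m =
      ∑ m ∈ e, ∑ i ∈ a, ∑ j ∈ b, ∑ k ∈ c, ∑ l ∈ d, f i j k l m :=
  (Finset.sum_congr rfl fun _ _ => sum_comm_last _ _ _ _ _).trans Finset.sum_comm

theorem pathSum_pullbackHom (I : AInfInnerProduct ν D)
    (k : List A → B) (hX : IsCyclicFamily 𝒜 s t e T X) {i u v w : ℕ} (hi : i ≤ s) (hu : u ≤ s)
    (hv : s + 1 ≤ v) (hw' : w ≤ s + t + 1) :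
    ((e i - e 0) * (e 0 + T - e i)).negOnePow •
      (pathSum (tagged e X) i u fun x => pathSum (tagged e X) v w fun y =>
        pullbackHom k I.toFun x (tagged e X u v) y (tagged e X w (s + t + 2 + i))) =
    ∑ a ∈ Finset.Icc 0 s, ∑ f ∈ Finset.Icc (s + 1) (s + t + 1), ∑ b ∈ Finset.Icc 0 s,
      ∑ c ∈ Finset.Icc (s + 1) (s + t + 1), ((e a - e 0) * (e 0 + T - e a)).negOnePow •
        (pathSum X i a fun x₁ => pathSum X f w fun y₃ => pathSum X b u fun x₃ =>
          pathSum X v c fun y₁ => pathSum (fun p q => pathSum X p q k) a b fun x =>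
            pathSum (fun p q => pathSum X p q k) c f fun y =>
              I.toFun x (k (x₃ ++ X u v :: y₁)) y (k (y₃ ++ X w (s + t + 2 + i) :: x₁))) := by
  have hsub : ∀ p q, q ≤ s → Finset.Icc p q ⊆ Finset.Icc 0 s := fun p q _ a => by
    simp only [Finset.mem_Icc]; omega
  have hsub' : ∀ p q, s + 1 ≤ p → q ≤ s + t + 1 →
      Finset.Icc p q ⊆ Finset.Icc (s + 1) (s + t + 1) := fun p q _ _ a => by
    simp only [Finset.mem_Icc]; omega
  have hh : ∀ a c, c ≤ s + t + 1 → ∀ a' b', a ≤ a' → a' < b' → b' ≤ c →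
      X a' b' ∈ 𝒜 (e b' - e a' + 1) := fun a c h a' b' _ h2 h3 =>
    hX.homogeneous a' b' (by unfold Admissible; omega)
  simp only [pullbackHom_eq]
  rw [pathSum_split_split _ _ (hsub i u hu) (hsub' v w hv hw') (fun x₁ x' y' y₃ =>
    ∑ j ∈ Finset.range (x'.length + 1), ∑ r ∈ Finset.range (y'.length + 1),
      pullbackTerm k I.toFun (tagged e X u v) (tagged e X w (s + t + 2 + i)) x₁ (x'.take j)
        (x'.drop j) (y'.take r) (y'.drop r) y₃), Finset.smul_sum]
  refine Finset.sum_congr rfl fun a ha => ?_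
  rw [Finset.smul_sum]
  refine Finset.sum_congr rfl fun f hf => ?_
  rw [Finset.mem_Icc] at ha hf
  have h1 : (pathSum (tagged e X) i a fun x₁ => pathSum (tagged e X) a u fun x' =>
      pathSum (tagged e X) v f fun y' => pathSum (tagged e X) f w fun y₃ =>
        ∑ j ∈ Finset.range (x'.length + 1), ∑ r ∈ Finset.range (y'.length + 1),
        pullbackTerm k I.toFun (tagged e X u v) (tagged e X w (s + t + 2 + i)) x₁ (x'.take j)
        (x'.drop j) (y'.take r) (y'.drop r) y₃) =
      ∑ b ∈ Finset.Icc 0 s, ∑ c ∈ Finset.Icc (s + 1) (s + t + 1),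
        pathSum (tagged e X) i a fun x₁ => pathSum (tagged e X) f w fun y₃ =>
          pathSum (tagged e X) b u fun x₃ => pathSum (tagged e X) v c fun y₁ =>
          pathSum (tagged e X) a b fun x₂ => pathSum (tagged e X) c f fun y₂ =>
            pullbackTerm k I.toFun (tagged e X u v) (tagged e X w (s + t + 2 + i)) x₁ x₂ x₃ y₁ y₂
              y₃ := by
    have h4 : ∀ x₁ y₃ : List (ℤ × A), (pathSum (tagged e X) a u fun x' =>
        pathSum (tagged e X) v f fun y' =>
        ∑ j ∈ Finset.range (x'.length + 1), ∑ r ∈ Finset.range (y'.length + 1),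
        pullbackTerm k I.toFun (tagged e X u v) (tagged e X w (s + t + 2 + i)) x₁ (x'.take j)
        (x'.drop j) (y'.take r) (y'.drop r) y₃) =
        ∑ b ∈ Finset.Icc 0 s, ∑ c ∈ Finset.Icc (s + 1) (s + t + 1),
          pathSum (tagged e X) b u fun x₃ => pathSum (tagged e X) v c fun y₁ =>
          pathSum (tagged e X) a b fun x₂ => pathSum (tagged e X) c f fun y₂ =>
            pullbackTerm k I.toFun (tagged e X u v) (tagged e X w (s + t + 2 + i)) x₁ x₂ x₃ y₁ y₂
              y₃ := by
      intro x₁ y₃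
      rw [pathSum_split_split _ _ (hsub a u hu) (hsub' v f hv hf.2) (fun x₂ x₃ y₁ y₂ =>
        pullbackTerm k I.toFun (tagged e X u v) (tagged e X w (s + t + 2 + i)) x₁ x₂ x₃ y₁ y₂ y₃)]
      refine Finset.sum_congr rfl fun b _ => Finset.sum_congr rfl fun c _ => ?_
      rw [pathSum_comm]
      refine pathSum_congr fun x₃ => ?_
      rw [pathSum_comm]
    simp only [← pathSum_sum (tagged e X) _ i a, ← pathSum_sum (tagged e X) _ f w, ← h4]
    refine pathSum_congr fun x₁ => ?_
    have h2 : ∀ x' : List (ℤ × A), (pathSum (tagged e X) v f fun y' => pathSum (tagged e X) f w fun y₃ =>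
        ∑ j ∈ Finset.range (x'.length + 1), ∑ r ∈ Finset.range (y'.length + 1),
        pullbackTerm k I.toFun (tagged e X u v) (tagged e X w (s + t + 2 + i)) x₁ (x'.take j)
        (x'.drop j) (y'.take r) (y'.drop r) y₃) =
        pathSum (tagged e X) f w fun y₃ => pathSum (tagged e X) v f fun y' =>
        ∑ j ∈ Finset.range (x'.length + 1), ∑ r ∈ Finset.range (y'.length + 1),
        pullbackTerm k I.toFun (tagged e X u v) (tagged e X w (s + t + 2 + i)) x₁ (x'.take j)
        (x'.drop j) (y'.take r) (y'.drop r) y₃ := fun x' => pathSum_comm _ _ _ _ _ _ _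
    simp only [h2]
    rw [pathSum_comm]
  rw [h1, Finset.smul_sum]
  refine Finset.sum_congr rfl fun b hb => ?_
  rw [Finset.smul_sum]
  refine Finset.sum_congr rfl fun c hc => ?_
  rw [Finset.mem_Icc] at hb hc
  have h3 : ∀ m m' : B, (pathSum (fun p q => pathSum X p q k) a b fun x =>
      pathSum (fun p q => pathSum X p q k) c f fun y => I.toFun x m y m') =
      pathSum (tagged e X) a b fun x₂ => pathSum (tagged e X) c f fun y₂ =>
        cutSum k (fun x => cutSum k (fun y => I.toFun x m y m') (letters y₂)) (letters x₂) := by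
    intro m m'
    rw [← pathSum_cutSum X k a b (I.multiadditive_pathSum_right _ _ _ _), ← pathSum_tagged e X a b]
    refine pathSum_congr fun x₂ => ?_
    rw [pathSum_cutSum_comm]
    unfold cutSum
    refine Finset.sum_congr rfl fun _ _ => ?_
    exact (pathSum_cutSum X k c f (I.multiadditive_right _ _ _)).symm.trans
      (pathSum_tagged e X c f _).symm
  simp only [h3]
  simp only [← pathSum_smul]
  rw [← pathSum_tagged e X i a]
  refine pathSum_tagged_congr (hh i a (by omega)) fun x₁ _ hx₁ => ?_
  rw [← pathSum_tagged e X f w]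
  refine pathSum_tagged_congr (hh f w (by omega)) fun y₃ _ hy₃ => ?_
  rw [← pathSum_tagged e X b u]
  refine pathSum_tagged_congr (hh b u (by omega)) fun x₃ _ hx₃ => ?_
  rw [← pathSum_tagged e X v c]
  refine pathSum_tagged_congr (hh v c (by omega)) fun y₁ _ hy₁ => ?_
  refine pathSum_tagged_congr (hh a b (by omega)) fun x₂ _ hx₂ => ?_
  refine pathSum_tagged_congr (hh c f (by omega)) fun y₂ _ hy₂ => ?_
  rw [pullbackTerm, smul_smul, ← Int.negOnePow_add]
  congr 1
  · rw [Int.negOnePow_eq_iff]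
    simp only [sdeg_append, sdeg_cons, sdeg_nil, hx₁, hx₂, hx₃, hy₁, hy₂, hy₃, tagged,
      hX.degree_periodic i hi]
    exact ⟨(e a - e i) * (e i - e 0), by ring⟩
  · simp [tagged]

/-- The sum of the pullback over the cyclic words of `X` is the sum over the cyclic words of the
family obtained from `X` by applying `k` to all paths. -/
theorem cyclicSum_pullback [DirectSum.Decomposition 𝒜] (I : AInfInnerProduct ν D) {k : List A → B}
    (hk : ∀ w, (0 : A) ∈ w → k w = 0) (hX : IsCyclicFamily 𝒜 s t e T X) :
    cyclicSum s t e T (pairingTerm (pullback 𝒜 k I.toFun) s t X) =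
      cyclicSum s t e T (pairingTerm I.toFun s t fun p q => pathSum X p q k) := by
  have hh : ∀ a c, c ≤ s + t + 1 → ∀ a' b', a ≤ a' → a' < b' → b' ≤ c →
      X a' b' ∈ 𝒜 (e b' - e a' + 1) := fun a c h a' b' _ h2 h3 =>
    hX.homogeneous a' b' (by unfold Admissible; omega)
  have h1 : cyclicSum s t e T (pairingTerm (pullback 𝒜 k I.toFun) s t X) =
      cyclicSum s t e T fun i u v w => pathSum (tagged e X) i u fun x =>
        pathSum (tagged e X) v w fun y =>
          pullbackHom k I.toFun x (tagged e X u v) y (tagged e X w (s + t + 2 + i)) := by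
    refine cyclicSum_congr fun i u v w hi hu hv hv' hw hw' => ?_
    rw [pairingTerm, ← pathSum_tagged e X i u]
    refine pathSum_tagged_congr (hh i u (by omega)) fun x hx _ => ?_
    rw [← pathSum_tagged e X v w]
    refine pathSum_tagged_congr (hh v w (by omega)) fun y hy _ => ?_
    exact I.pullback_of_homogeneous hk (m := tagged e X u v)
      (m' := tagged e X w (s + t + 2 + i)) hx (hX.homogeneous u v (by unfold Admissible; omega)) hy
      (hX.homogeneous w _ (by unfold Admissible; omega))
  rw [h1]
  unfold cyclicSum
  have h2 : ∀ i ∈ Finset.Icc 0 s, ∀ u ∈ Finset.Icc 0 s, ∀ v ∈ Finset.Icc (s + 1) (s + t + 1),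
      ∀ w ∈ Finset.Icc (s + 1) (s + t + 1), _ := fun i hi u hu v hv w hw =>
    pathSum_pullbackHom I k hX (i := i) (u := u) (v := v) (w := w) (Finset.mem_Icc.1 hi).2
      (Finset.mem_Icc.1 hu).2 (Finset.mem_Icc.1 hv).1
      (Finset.mem_Icc.1 hw).2
  rw [Finset.sum_congr rfl fun i hi => Finset.sum_congr rfl fun u hu => Finset.sum_congr rfl
    fun v hv => Finset.sum_congr rfl fun w hw => h2 i hi u hu v hv w hw]
  have h3 : ∀ a ∈ Finset.Icc 0 s, ∀ b ∈ Finset.Icc 0 s, ∀ c ∈ Finset.Icc (s + 1) (s + t + 1),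
      ∀ f ∈ Finset.Icc (s + 1) (s + t + 1), ((e a - e 0) * (e 0 + T - e a)).negOnePow •
        pairingTerm I.toFun s t (fun p q => pathSum X p q k) a b c f =
      ∑ i ∈ Finset.Icc 0 s, ∑ u ∈ Finset.Icc 0 s, ∑ v ∈ Finset.Icc (s + 1) (s + t + 1),
        ∑ w ∈ Finset.Icc (s + 1) (s + t + 1), ((e a - e 0) * (e 0 + T - e a)).negOnePow •
        (pathSum X i a fun x₁ => pathSum X f w fun y₃ => pathSum X b u fun x₃ =>
          pathSum X v c fun y₁ => pathSum (fun p q => pathSum X p q k) a b fun x =>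
            pathSum (fun p q => pathSum X p q k) c f fun y =>
              I.toFun x (k (x₃ ++ X u v :: y₁)) y (k (y₃ ++ X w (s + t + 2 + i) :: x₁))) := by
    intro a ha b hb c hc f hf
    rw [Finset.mem_Icc] at ha hb hc hf
    simp only [← Finset.smul_sum]
    congr 1
    rw [pairingTerm, pathSum_cross_fst X (t := t) hb.2 hc.1 hc.2 k,
      pathSum_cross_snd X hX.periodic ha.2 hf.1 hf.2 k]
    simp only [I.map_sum_mid, I.map_pathSum_mid, I.map_sum_dual, I.map_pathSum_dual, pathSum_sum]
    rw [sum_comm_last]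
    refine Finset.sum_congr rfl fun i _ => Finset.sum_congr rfl fun u _ =>
      Finset.sum_congr rfl fun v _ => Finset.sum_congr rfl fun w _ => ?_
    simp only [pathSum]
    symm
    refine (Finset.sum_congr rfl fun x₁ _ => Finset.sum_congr rfl fun y₃ _ =>
      sum_comm_pair _ _ _ _ _).trans ((sum_comm_pair _ _ _ _ _).trans ?_)
    refine Finset.sum_congr rfl fun x _ => Finset.sum_congr rfl fun y _ => ?_
    refine (sum_comm_pair _ _ _ _ _).trans ?_
    exact Finset.sum_congr rfl fun x₃ _ => Finset.sum_congr rfl fun y₁ _ => Finset.sum_comm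
  rw [Finset.sum_congr rfl fun a ha => Finset.sum_congr rfl fun b hb => Finset.sum_congr rfl
    fun c hc => Finset.sum_congr rfl fun f hf => h3 a ha b hb c hc f hf]
  refine (sum_comm_fifth _ _ _ _ _ _).trans (Finset.sum_congr rfl fun a _ => ?_)
  refine (sum_comm_fifth _ _ _ _ _ _).trans (Eq.trans ?_ (sum_comm_third _ _ _ _).symm)
  refine Finset.sum_congr rfl fun f _ => ?_
  refine (sum_comm_fifth _ _ _ _ _ _).trans (Finset.sum_congr rfl fun b _ => ?_)
  exact sum_comm_fifth _ _ _ _ _ _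

end Pullback

/-! ### The transferred operations and the transferred morphism -/

theorem splitWrtCompositionAux_map {α β : Type*} (f : α → β) (l : List α) (ns : List ℕ) :
    (l.map f).splitWrtCompositionAux ns = (l.splitWrtCompositionAux ns).map (List.map f) := by
  induction ns generalizing l with
  | nil => rfl
  | cons n ns ih =>
    simp only [List.splitWrtCompositionAux, List.splitAt_eq, List.map_cons, ← List.map_drop, ← List.map_take, ih]

theorem sum_subtype_composition {V : Type*} [AddCommMonoid V] {n m : ℕ} (h : n = m)
    (G : List ℕ → V) :
    ∑ c : {c : Composition n // 2 ≤ c.length}, G c.1.blocks =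
      ∑ c : Composition m, if 2 ≤ c.length then G c.blocks else 0 := by
  subst h
  rw [← Finset.sum_filter]
  exact (Finset.sum_subtype (p := fun c : Composition n => 2 ≤ c.length) _
    (fun c => by simp) fun c => G c.blocks).symm

theorem pKernel_of_length_lt_two {B : Type*} [AddCommMonoid B] (op : List B → B) (h : B → B)
    {l : List B} (hl : l.length < 2) : pKernel op h l = 0 := by
  rw [pKernel_eq]
  have : IsEmpty {c : Composition l.length // 2 ≤ c.length} :=
    ⟨fun c => by have := c.1.length_le; have := c.2; omega⟩
  exact Finset.sum_of_isEmpty _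

theorem pKernel_of_mem_zero {B : Type*} [AddCommGroup B] {op : List B → B}
    (hop : IsMultiadditive op) {h : B → B} (h0 : h 0 = 0) (n : ℕ) :
    ∀ l : List B, l.length = n → (0 : B) ∈ l → pKernel op h l = 0 := by
  induction n using Nat.strong_induction_on with
  | _ n ih =>
    rintro l rfl hl
    rw [pKernel_eq]
    refine Finset.sum_eq_zero fun c _ => hop.of_mem_zero ?_
    rw [← l.flatten_splitWrtComposition c.1, List.mem_flatten] at hl
    obtain ⟨x, hx, h0x⟩ := hl
    refine List.mem_map.2 ⟨x, hx, ?_⟩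
    rw [ih _ (length_lt_of_mem_split l c.1 c.2 x hx) x rfl h0x, h0]
    unfold letterOr
    split
    · exact (List.mem_singleton.1 h0x).symm
    · rfl

theorem pathSum_atLeastTwo_succ {A V : Type*} [AddCommMonoid V] (X : ℕ → ℕ → A) (p : ℕ)
    (φ : List A → V) : pathSum X p (p + 1) (atLeastTwo φ) = 0 := by
  rw [pathSum_rec _ (by omega), Nat.Ioc_succ_singleton, Finset.sum_singleton, pathSum_self]
  exact if_neg (by simp)

section Transfer

variable {R A B : Type*} [CommRing R] [AddCommGroup A] [Module R A] {𝒜 : ℤ → Submodule R A}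
  [AddCommGroup B] [Module R B] {ℬ : ℤ → Submodule R B} {ν : AInfAlgebra ℬ}

namespace TransferData

variable (T : TransferData 𝒜 ν)

theorem k_of_mem_zero {w : List A} (hw : (0 : A) ∈ w) : T.k w = 0 := by
  unfold k
  split
  · rfl
  · rw [← List.mem_singleton.1 hw, map_zero]
  · rw [pKernel_of_mem_zero ν.multilinear.isMultiadditive (map_zero T.h) _ _ rfl
      (List.mem_map.2 ⟨0, hw, map_zero T.g⟩), map_zero]

theorem pKernel_map (w : List A) :
    pKernel ν.op T.h (w.map T.g) = cutSum T.k (atLeastTwo ν.op) w := by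
  have h1 : ∀ x : List A, letterOr (x.map T.g) (T.h (pKernel ν.op T.h (x.map T.g))) = T.k x := by
    rintro (_ | ⟨a, _ | ⟨b, x⟩⟩)
    · change T.h (pKernel ν.op T.h []) = 0
      rw [pKernel_of_length_lt_two _ _ (by simp), map_zero]
    · rfl
    · rfl
  rw [pKernel_eq, cutSum]
  unfold List.splitWrtComposition
  rw [sum_subtype_composition (List.length_map T.g) fun ns => ν.op
    (((w.map T.g).splitWrtCompositionAux ns).map fun x => letterOr x (T.h (pKernel ν.op T.h x)))]
  refine Finset.sum_congr rfl fun c _ => ?_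
  have h2 : ((w.splitWrtCompositionAux c.blocks).map T.k).length = c.length := by
    rw [List.length_map]; exact w.length_splitWrtComposition c
  rw [atLeastTwo, h2, splitWrtCompositionAux_map, List.map_map]
  refine if_congr Iff.rfl (congrArg _ (List.map_congr_left fun x _ => h1 x)) rfl

theorem atLeastTwo_k (w : List A) :
    atLeastTwo T.k w = T.h (cutSum T.k (atLeastTwo ν.op) w) := by
  rw [← T.pKernel_map]
  rcases w with _ | ⟨a, _ | ⟨b, w⟩⟩
  · rw [pKernel_of_length_lt_two _ _ (by simp), map_zero]; rfl
  · rw [pKernel_of_length_lt_two _ _ (by simp), map_zero]; rfl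
  · exact if_pos (by simp)

theorem atLeastTwo_op (w : List A) :
    atLeastTwo T.op w = T.f (cutSum T.k (atLeastTwo ν.op) w) := by
  rw [← T.pKernel_map]
  rcases w with _ | ⟨a, _ | ⟨b, w⟩⟩
  · rw [pKernel_of_length_lt_two _ _ (by simp), map_zero]; rfl
  · rw [pKernel_of_length_lt_two _ _ (by simp), map_zero]; rfl
  · exact if_pos (by simp)

theorem pathSum_k (X : ℕ → ℕ → A) {p q : ℕ} (hpq : p < q) :
    pathSum X p q T.k = T.g (X p q) +
      T.h (pathSum (fun a b => pathSum X a b T.k) p q (atLeastTwo ν.op)) := by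
  rw [pathSum_eq_add_atLeastTwo X hpq,
    ← pathSum_cutSum X T.k p q ν.multilinear.isMultiadditive.atLeastTwo, map_pathSum]
  exact congrArg _ (pathSum_congr T.atLeastTwo_k)

theorem pathSum_op (X : ℕ → ℕ → A) {p q : ℕ} (hpq : p < q) :
    pathSum X p q T.op = T.dA (X p q) +
      T.f (pathSum (fun a b => pathSum X a b T.k) p q (atLeastTwo ν.op)) := by
  rw [pathSum_eq_add_atLeastTwo X hpq,
    ← pathSum_cutSum X T.k p q ν.multilinear.isMultiadditive.atLeastTwo, map_pathSum]
  exact congrArg _ (pathSum_congr T.atLeastTwo_op)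

end TransferData

/-! ### The curvature of a family at a single arc -/

theorem AInfAlgebra.op_add (ν : AInfAlgebra ℬ) (x y : B) :
    ν.op [x + y] = ν.op [x] + ν.op [y] := ν.multilinear.map_add [] [] x y

theorem AInfAlgebra.op_op (ν : AInfAlgebra ℬ) {n : ℤ} {x : B} (hx : x ∈ ℬ n) :
    ν.op [ν.op [x]] = 0 := by
  simpa using ν.relation [(n, x)] fun y hy => by rw [List.mem_singleton.1 hy]; exact hx

variable {e : ℕ → ℤ} {X : ℕ → ℕ → B} {p q : ℕ}

theorem AInfAlgebra.pathSum_atLeastTwo_mem (ν : AInfAlgebra ℬ) (hpq : p < q)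
    (hX : ∀ r r', p ≤ r → r < r' → r' ≤ q → r' - r < q - p → X r r' ∈ ℬ (e r' - e r + 1)) :
    pathSum X p q (atLeastTwo ν.op) ∈ ℬ (e q - e p + 1 + 1) := by
  rw [pathSum_atLeastTwo_congr (Y := fun a b => if b - a < q - p then X a b else 0)
    fun r r' _ _ _ h => (if_pos h).symm, add_assoc]
  refine pathSum_mem (𝒜 := ℬ) hpq.ne (fun r r' h1 h2 h3 => ?_) fun w hw hw' => ?_
  · split_ifs with h
    · exact hX r r' h1 h2 h3 h
    · exact zero_mem _
  · unfold atLeastTwo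
    split_ifs
    · rw [← add_assoc]; exact ν.degree w hw hw'
    · exact zero_mem _

/-- The curvature at an arc is closed if it vanishes on all shorter arcs. -/
theorem AInfAlgebra.op_curvature (ν : AInfAlgebra ℬ) (hpq : p < q)
    (hX : ∀ r r', p ≤ r → r < r' → r' ≤ q → X r r' ∈ ℬ (e r' - e r + 1))
    (hc : ∀ r r', p ≤ r → r < r' → r' ≤ q → r' - r < q - p → pathSum X r r' ν.op = 0) :
    ν.op [pathSum X p q (atLeastTwo ν.op)] = 0 := by
  have hm := ν.multilinear.isMultiadditive
  have h1 := ν.markedSum_curvature hX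
  unfold markedSum at h1
  have h2 : ∀ r r', p ≤ r → r < r' → r' ≤ q → r' - r < q - p →
      ((e r - e p).negOnePow • pathSum X p r fun u => pathSum X r' q fun v =>
        ν.op (u ++ pathSum X r r' ν.op :: v)) = 0 := by
    intro r r' h3 h4 h5 h6
    rw [hc r r' h3 h4 h5 h6]
    simp only [hm.map_zero, pathSum_zero, smul_zero]
  rw [Finset.sum_eq_single p, Finset.sum_eq_single q] at h1
  · simp only [sub_self, Int.negOnePow_zero, one_smul, pathSum_self, List.nil_append] at h1
    rwa [pathSum_eq_add_atLeastTwo X hpq, ν.op_add, ν.op_op (hX p q le_rfl hpq le_rfl),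
      zero_add] at h1
  · intro r' hr' hne
    obtain ⟨h3, h4⟩ := Finset.mem_Ioc.1 hr'
    exact h2 p r' le_rfl h3 h4 (by omega)
  · intro h; exact absurd (Finset.mem_Ioc.2 ⟨hpq, le_rfl⟩) h
  · intro r hr hne
    obtain ⟨h3, h4⟩ := Finset.mem_Icc.1 hr
    refine Finset.sum_eq_zero fun r' hr' => ?_
    obtain ⟨h5, h6⟩ := Finset.mem_Ioc.1 hr'
    exact h2 r r' h3 h5 h6 (by omega)
  · intro h; exact absurd (Finset.mem_Icc.2 ⟨le_rfl, hpq.le⟩) h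

/-! ### The transferred morphism maps flat families to flat families -/

variable {s t : ℕ} {d : Fin (s + t + 2) → ℤ} {a : Fin (s + t + 2) → A} (T : TransferData 𝒜 ν)

theorem IsFlatCyclicFamily.transfer {X : ℕ → ℕ → A} (hX : IsFlatCyclicFamily 𝒜 T.op s t d a X) :
    IsFlatCyclicFamily ℬ ν.op s t d (fun i => T.g (a i)) fun p q => pathSum X p q T.k := by
  have h1 : ∀ n p q, q - p = n → Admissible s t p q →
      pathSum X p q T.k ∈ ℬ (cumDeg d q - cumDeg d p + 1) := by
    intro n
    induction n using Nat.strong_induction_on with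
    | _ n ih =>
      intro p q hn hpq
      rw [T.pathSum_k X hpq.1]
      refine Submodule.add_mem _ (T.g_degree _ _ (hX.family.homogeneous p q hpq)) ?_
      rw [← add_sub_cancel_right (cumDeg d q - cumDeg d p + 1) 1]
      exact T.h_degree _ _ (ν.pathSum_atLeastTwo_mem hpq.1 fun r r' h2 h3 h4 h5 =>
        ih (r' - r) (by omega) r r' rfl (hpq.sub h2 h3 h4))
  refine ⟨⟨fun p q hpq => h1 _ p q rfl hpq, fun i j hij hj => ?_, hX.family.degree_periodic⟩,
    fun i hi => ?_, fun p q hpq => ?_⟩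
  · rw [pathSum_shift]
    exact pathSum_congr_edges (fun r r' _ h3 h4 => hX.family.periodic r r' h3 (by omega)) _
  · rw [T.pathSum_k X (Nat.lt_succ_self i), pathSum_atLeastTwo_succ, map_zero, add_zero,
      hX.diag i hi]
    rfl
  · obtain ⟨n, hn⟩ : ∃ n, q - p = n := ⟨_, rfl⟩
    induction n using Nat.strong_induction_on generalizing p q with
    | _ n ih =>
      have h2 := ν.op_curvature (X := fun p q => pathSum X p q T.k) (e := cumDeg d) hpq.1
        (fun r r' h3 h4 h5 => h1 _ r r' rfl (hpq.sub h3 h4 h5))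
        (fun r r' h3 h4 h5 h6 => ih (r' - r) (by omega) r r' (hpq.sub h3 h4 h5) rfl)
      have h3 := hX.curvature p q hpq
      rw [T.pathSum_op X hpq.1] at h3
      rw [pathSum_eq_add_atLeastTwo _ hpq.1]
      rw [T.pathSum_k X hpq.1, ν.op_add, ← T.g_chain, eq_neg_of_add_eq_zero_left h3, map_neg]
      set y := pathSum (fun a b => pathSum X a b T.k) p q (atLeastTwo ν.op)
      have h4 := T.homotopy y
      rw [h2, map_zero, add_zero] at h4
      rw [← h4]
      abel

/-! ### Flat families are gauge equivalent to transferred families -/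

/-- The value of the family `Y` at an arc is of the form that the transferred morphism produces. -/
def IsTransferred (e : ℕ → ℤ) (a : Fin (s + t + 2) → A) (Y : ℕ → ℕ → B) (p q : ℕ) : Prop :=
  ∃ x ∈ 𝒜 (e q - e p + 1), T.dA x = -T.f (pathSum Y p q (atLeastTwo ν.op)) ∧
    Y p q = T.g x + T.h (pathSum Y p q (atLeastTwo ν.op)) ∧ (q = p + 1 → x = cyc a p)

theorem IsTransferred.congr {Y Y' : ℕ → ℕ → B} {p q : ℕ} (h : IsTransferred T e a Y p q)
    (hpq : p < q) (hY : ∀ r r', p ≤ r → r < r' → r' ≤ q → Y r r' = Y' r r') :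
    IsTransferred T e a Y' p q := by
  unfold IsTransferred at h ⊢
  rwa [← pathSum_congr_edges hY, ← hY p q le_rfl hpq le_rfl]

variable {D : ℤ}

/-- A flat family can be changed such that its value at a given arc is transferred, without changing
the values at the arcs that do not contain the given one. -/
theorem IsFlatCyclicFamily.exists_isTransferred_arc {Y : ℕ → ℕ → B}
    (hY : IsFlatCyclicFamily ℬ ν.op s t d (fun i => T.g (a i)) Y) (I : AInfInnerProduct ν D)
    (ha : ∀ i, a i ∈ 𝒜 (d i)) (ha' : ∀ i, T.dA (a i) = 0) {p q : ℕ} (hpq : Admissible s t p q)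
    (hp : p ≤ s + t + 1) :
    ∃ Y', IsFlatCyclicFamily ℬ ν.op s t d (fun i => T.g (a i)) Y' ∧
      cyclicSum s t (cumDeg d) (cumDeg d (s + t + 2)) (pairingTerm I.toFun s t Y') =
        cyclicSum s t (cumDeg d) (cumDeg d (s + t + 2)) (pairingTerm I.toFun s t Y) ∧
      (∀ p' q', ¬ ArcContains (s + t + 2) p q p' q' → Y' p' q' = Y p' q') ∧
      IsTransferred T (cumDeg d) a Y' p q := by
  have hlt := hpq.1
  rcases Nat.lt_or_ge (p + 1) q with hq | hq
  swap
  · obtain rfl : q = p + 1 := by omega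
    refine ⟨Y, hY, rfl, fun _ _ _ => rfl, cyc a p, ?_, ?_, ?_, fun _ => rfl⟩
    · have : cumDeg d (p + 1) - cumDeg d p + 1 = cyc d p := by
        rw [cumDeg, cumDeg, Finset.sum_range_succ]; ring
      rw [this]
      exact ha _
    · rw [pathSum_atLeastTwo_succ, map_zero, neg_zero]
      exact ha' _
    · rw [pathSum_atLeastTwo_succ, map_zero, add_zero, hY.diag p hp]
      rfl
  have hm := ν.multilinear.isMultiadditive
  have hz : T.h (Y p q) ∈ ℬ (cumDeg d q - cumDeg d p) := by
    rw [← add_sub_cancel_right (cumDeg d q - cumDeg d p) 1]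
    exact T.h_degree _ _ (hY.family.homogeneous p q hpq)
  have h1 : ∀ p' q', ¬ ArcContains (s + t + 2) p q p' q' →
      gauge ν s t p q (T.h (Y p q)) (cumDeg d) Y p' q' = Y p' q' := fun p' q' h => gauge_eq ν h
  have h2 : pathSum (gauge ν s t p q (T.h (Y p q)) (cumDeg d) Y) p q (atLeastTwo ν.op) =
      pathSum Y p q (atLeastTwo ν.op) :=
    pathSum_atLeastTwo_congr (fun r r' _ _ _ _ => h1 r r' (by unfold ArcContains; omega)) _
  have h3 : gauge ν s t p q (T.h (Y p q)) (cumDeg d) Y p q = Y p q + ν.op [T.h (Y p q)] := by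
    have h4 : ∀ r, p < r → r ≤ q → r - p < q - p →
        excise (s + t + 2) p q (T.h (Y p q)) Y p r = 0 := fun r h5 h6 h7 => by
      rw [excise, if_neg (by unfold ArcDisjoint; omega), if_neg (by omega)]
    have h5 : excise (s + t + 2) p q (T.h (Y p q)) Y p q = T.h (Y p q) := by
      rw [excise, if_neg (by unfold ArcDisjoint; omega), if_pos (Or.inl ⟨rfl, rfl⟩)]
    rw [gauge, gaugeChange_eq (k := 0) (Or.inl rfl) hlt hpq (by omega), zero_add, sub_self,
      Int.negOnePow_zero, one_smul, pathSum_eq_add_atLeastTwo _ hlt, h5]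
    rw [pathSum_atLeastTwo_congr (Y := fun r r' => if r = p then 0 else
      excise (s + t + 2) p q (T.h (Y p q)) Y r r') fun r r' _ h6 h7 h8 => ?_,
      pathSum_eq_zero_of_start hlt (fun r _ _ => if_pos rfl) hm.atLeastTwo, add_zero]
    split_ifs with h9
    · subst h9
      exact h4 r' h6 h7 h8
    · rfl
  refine ⟨gauge ν s t p q (T.h (Y p q)) (cumDeg d) Y, ⟨hY.family.gauge ν hpq hp hz, fun i hi => ?_,
    fun p' q' h => curvature_gauge ν hY.family hY.curvature hpq hp hz h⟩,
    cyclicSum_gauge hY.family I hY.curvature hpq hp hz, h1, T.f (Y p q), ?_, ?_, ?_, by omega⟩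
  · rw [h1 i (i + 1) (by unfold ArcContains; omega), hY.diag i hi]
  · exact T.f_degree _ _ (hY.family.homogeneous p q hpq)
  all_goals
    have h4 := hY.curvature p q hpq
    rw [pathSum_eq_add_atLeastTwo Y hlt] at h4
    have h5 := eq_neg_of_add_eq_zero_left h4
  · rw [h2, ← T.f_chain, h5, map_neg]
  · have h6 := T.homotopy (Y p q)
    rw [h5, map_neg] at h6
    rw [h2, h3, eq_add_of_sub_eq h6]
    abel

theorem IsFlatCyclicFamily.exists_isTransferred {Y : ℕ → ℕ → B}
    (hY : IsFlatCyclicFamily ℬ ν.op s t d (fun i => T.g (a i)) Y) (I : AInfInnerProduct ν D)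
    (ha : ∀ i, a i ∈ 𝒜 (d i)) (ha' : ∀ i, T.dA (a i) = 0) (n m : ℕ) :
    ∃ Y', IsFlatCyclicFamily ℬ ν.op s t d (fun i => T.g (a i)) Y' ∧
      cyclicSum s t (cumDeg d) (cumDeg d (s + t + 2)) (pairingTerm I.toFun s t Y') =
        cyclicSum s t (cumDeg d) (cumDeg d (s + t + 2)) (pairingTerm I.toFun s t Y) ∧
      ∀ p q, Admissible s t p q → p ≤ s + t + 1 → (q < p + n ∨ (q = p + n ∧ p < m)) →
        IsTransferred T (cumDeg d) a Y' p q := by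
  induction n generalizing m with
  | zero => exact ⟨Y, hY, rfl, fun p q h _ h' => by have := h.1; omega⟩
  | succ n ihn =>
    induction m with
    | zero =>
      obtain ⟨Y', h1, h2, h3⟩ := ihn (s + t + 2)
      exact ⟨Y', h1, h2, fun p q h4 h5 h6 => h3 p q h4 h5 (by omega)⟩
    | succ m ihm =>
      obtain ⟨Y', h1, h2, h3⟩ := ihm
      by_cases h4 : Admissible s t m (m + (n + 1)) ∧ m ≤ s + t + 1
      · obtain ⟨Y'', h5, h6, h7, h8⟩ := h1.exists_isTransferred_arc T I ha ha' h4.1 h4.2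
        refine ⟨Y'', h5, h6.trans h2, fun p q h9 h10 h11 => ?_⟩
        by_cases h12 : p = m ∧ q = m + (n + 1)
        · rw [h12.1, h12.2]; exact h8
        · refine (h3 p q h9 h10 (by omega)).congr T h9.1 fun r r' h13 h14 h15 => (h7 r r' ?_).symm
          unfold ArcContains
          omega
      · refine ⟨Y', h1, h2, fun p q h9 h10 h11 => h3 p q h9 h10 ?_⟩
        by_contra h12
        obtain ⟨rfl, rfl⟩ : p = m ∧ q = m + (n + 1) := by omega
        exact h4 ⟨h9, h10⟩

theorem IsFlatCyclicFamily.exists_transfer_eq {Y : ℕ → ℕ → B}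
    (hY : IsFlatCyclicFamily ℬ ν.op s t d (fun i => T.g (a i)) Y)
    (h : ∀ p q, Admissible s t p q → p ≤ s + t + 1 → IsTransferred T (cumDeg d) a Y p q) :
    ∃ X, IsFlatCyclicFamily 𝒜 T.op s t d a X ∧
      ∀ p q, Admissible s t p q → pathSum X p q T.k = Y p q := by
  choose! x hx hdx hYx hdiag using h
  set X : ℕ → ℕ → A := fun p q =>
    if p ≤ s + t + 1 then x p q else x (p - (s + t + 2)) (q - (s + t + 2)) with hX
  have h1 : ∀ p q, p ≤ s + t + 1 → X p q = x p q := fun p q hp => if_pos hp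
  have h2 : ∀ p q, X (s + t + 2 + p) (s + t + 2 + q) = x p q := fun p q => by
    simp only [hX]
    rw [if_neg (by omega), Nat.add_sub_cancel_left, Nat.add_sub_cancel_left]
  have h3 : ∀ p q, Admissible s t p q → X p q ∈ 𝒜 (cumDeg d q - cumDeg d p + 1) ∧
      T.dA (X p q) = -T.f (pathSum Y p q (atLeastTwo ν.op)) ∧
      Y p q = T.g (X p q) + T.h (pathSum Y p q (atLeastTwo ν.op)) := by
    intro p q hpq
    rcases Nat.lt_or_ge p (s + t + 2) with hp | hp
    · rw [h1 p q (by omega)]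
      exact ⟨hx p q hpq (by omega), hdx p q hpq (by omega), hYx p q hpq (by omega)⟩
    · obtain ⟨p, rfl⟩ := Nat.exists_eq_add_of_le hp
      obtain ⟨q, rfl⟩ := Nat.exists_eq_add_of_le (hp.trans hpq.1.le)
      unfold Admissible at hpq
      have hpq' : Admissible s t p q := by unfold Admissible; omega
      have h4 : pathSum Y (s + t + 2 + p) (s + t + 2 + q) (atLeastTwo ν.op) =
          pathSum Y p q (atLeastTwo ν.op) := by
        rw [pathSum_shift]
        exact pathSum_congr_edges (fun r r' _ _ _ => hY.family.periodic r r' (by omega) (by omega)) _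
      rw [h2, h4, hY.family.periodic p q (by omega) (by omega),
        hY.family.degree_periodic p (by omega), hY.family.degree_periodic q (by omega),
        add_sub_add_right_eq_sub]
      exact ⟨hx p q hpq' (by omega), hdx p q hpq' (by omega), hYx p q hpq' (by omega)⟩
  have h4 : ∀ n p q, q - p = n → Admissible s t p q → pathSum X p q T.k = Y p q := by
    intro n
    induction n using Nat.strong_induction_on with
    | _ n ih =>
      intro p q hn hpq
      rw [T.pathSum_k X hpq.1, (h3 p q hpq).2.2, pathSum_atLeastTwo_congr (Y := Y)]
      exact fun r r' h5 h6 h7 h8 => ih (r' - r) (by omega) r r' rfl (hpq.sub h5 h6 h7)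
  refine ⟨X, ⟨⟨fun p q hpq => (h3 p q hpq).1, fun i j hij hj => ?_, hY.family.degree_periodic⟩,
    fun i hi => ?_, fun p q hpq => ?_⟩, fun p q => h4 _ p q rfl⟩
  · rw [h2, h1 i j (by omega)]
  · rw [h1 i _ hi]
    exact hdiag i (i + 1) (by unfold Admissible; omega) hi rfl
  · rw [T.pathSum_op X hpq.1, (h3 p q hpq).2.1, pathSum_congr_edges (X' := Y)
      fun r r' h5 h6 h7 => h4 _ r r' rfl (hpq.sub h5 h6 h7), neg_add_cancel]

theorem masseyInnerProduct_pullback [DirectSum.Decomposition 𝒜] (I : AInfInnerProduct ν D)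
    (ha : ∀ i, a i ∈ 𝒜 (d i)) (ha' : ∀ i, T.dA (a i) = 0) :
    masseyInnerProduct 𝒜 T.op (pullback 𝒜 T.k I.toFun) s t d a =
      masseyInnerProduct ℬ ν.op I.toFun s t d fun i => T.g (a i) := by
  ext r
  rw [mem_masseyInnerProduct_iff, mem_masseyInnerProduct_iff]
  have hk : ∀ w : List A, (0 : A) ∈ w → T.k w = 0 := fun w => T.k_of_mem_zero
  constructor
  · rintro ⟨X, hX, rfl⟩
    exact ⟨_, hX.transfer T, (cyclicSum_pullback I hk hX.family).symm⟩
  · rintro ⟨Y, hY, rfl⟩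
    obtain ⟨Y', hY', h1, h2⟩ := hY.exists_isTransferred T I ha ha' (s + t + 2 + s + 1) 0
    obtain ⟨X, hX, h3⟩ := hY'.exists_transfer_eq T fun p q hpq hp => h2 p q hpq hp (by
      unfold Admissible at hpq; omega)
    refine ⟨X, hX, ?_⟩
    rw [cyclicSum_pullback I hk hX.family, ← h1]
    refine cyclicSum_congr fun i u v w hi hu hv hv' hw hw' => ?_
    rw [pairingTerm, pairingTerm, h3 u v (by unfold Admissible; omega),
      h3 w _ (by unfold Admissible; omega),
      pathSum_congr_edges fun r r' _ _ _ => h3 r r' (by unfold Admissible; omega)]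
    exact pathSum_congr fun x =>
      pathSum_congr_edges (fun r r' _ _ _ => h3 r r' (by unfold Admissible; omega)) _

end Transfer

end MasseyIP

end

theorem mainTheorem3 {R A B : Type*} [CommRing R] [AddCommGroup A] [Module R A]
    [AddCommGroup B] [Module R B]
    (𝒜 : ℤ → Submodule R A) [DirectSum.Decomposition 𝒜]
    (ℬ : ℤ → Submodule R B) [DirectSum.Decomposition ℬ]
    (ν : MasseyIP.AInfAlgebra ℬ) (T : MasseyIP.TransferData 𝒜 ν)
    (D : ℤ) (I : MasseyIP.AInfInnerProduct ν D)
    (s t : ℕ) (d : Fin (s + t + 2) → ℤ) (a : Fin (s + t + 2) → A)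
    (ha : ∀ i, a i ∈ 𝒜 (d i)) (ha' : ∀ i, T.dA (a i) = 0) :
    MasseyIP.masseyInnerProduct 𝒜 T.op (MasseyIP.pullback 𝒜 T.k I.toFun) s t d a =
      MasseyIP.masseyInnerProduct ℬ ν.op I.toFun s t d (fun i => T.g (a i)) :=
  MasseyIP.masseyInnerProduct_pullback T I ha ha'
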